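/- Let $0<q<1$, $a\in\mathbb R$, and put $[s]=\frac{q^{s}-q^{-s}}{q-q^{-1}}$, $\{s\}=q^{s}+q^{-s}$, $t=q^{a}-q^{-a}$. **The algebra.** Let $\mathcal O_q(SU(2))$ be the unital $*$-algebra generated by $\alpha,\gamma$ with relations $\alpha^*\alpha+\gamma^*\gamma=1$, $\alpha\alpha^*+q^2\gamma\gamma^*=1$, $\gamma^*\gamma=\gamma\gamma^*$, $\alpha\gamma=q\gamma\alpha$, $\alpha\gamma^*=q\gamma^*\alpha$, with $\Delta(\alpha)=\alpha\otimes\alpha-q\gamma^*\otimes\gamma$, $\Delta(\gamma)=\gamma\otimes\alpha+\alpha^*\otimes\gamma$, and let $\Phi$ be its Haar state. Let $k,e,f\in U_q(\mathfrak{su}(2))$, regarded as functionals on $\mathcal O_q(SU(2))$, have the values $$k\mapsto\begin{pmatrix}q&0\\0&q^{-1}\end{pmatrix},\qquad e\mapsto\begin{pmatrix}0&q^{1/2}\\0&0\end{pmatrix},\qquad f\mapsto\begin{pmatrix}0&0\\q^{-1/2}&0\end{pmatrix}$$ on the matrix $\begin{pmatrix}\alpha&-q\gamma^*\\ \gamma&\alpha^*\end{pmatrix}$,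 where $k$ is multiplicative, $e(xy)=e(x)\varepsilon(y)+k(x)e(y)$ and $f(xy)=f(x)k^{-1}(y)+\varepsilon(x)f(y)$. Put $$B_t=q^{-1/2}(e-fk)-\sqrt{-1}\,(q-q^{-1})^{-1}t\,k,\qquad \mathcal O_q(S_t^2)=\{b\in\mathcal O_q(SU(2)) : B_t(b_{(1)})\,b_{(2)}=B_t(1)\,b\},$$ the Podleś sphere (a right coideal $*$-subalgebra). In every finite-dimensional unitary representation of $U_q(\mathfrak{su}(2))$ (equivalently, in every finite-dimensional $\mathcal O_q(SU(2))$-comodule) $\sqrt{-1}B_t$ is diagonalizable with eigenvalues of the form $[a+n]$, $n\in\mathbb Z$; let $\Phi_n$, a functional on $\mathcal O_q(SU(2))$, be its spectral projection for $[a+n]$. For $c\in\mathcal O_q(SU(2))$ the functional $\Phi_n\triangleleft c:=\Phi_n(c\,\cdot)$ is a finite linear combination of the $\Phi_m$. Put $\mathcal I_c=\bigoplus_{n\in\mathbb Z}\mathbb C\Phi_n$. The convolution algebra $$C_c(SL_q(2,\mathbb R)_t)=\mathcal O_q(S_t^2)\bowtie\mathcal I_c$$ is the vector space of finite sums $\sum_n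 b_n\Phi_n$ with $b_n\in\mathcal O_q(S_t^2)$, with the associative product determined by the product of $\mathcal O_q(S_t^2)$, $\Phi_n\Phi_m=\delta_{nm}\Phi_n$ and $\Phi_n c=c_{(1)}(\Phi_n\triangleleft c_{(2)})$, and the involution $(b\Phi_n)^*=\Phi_n b^*$. **The integral and the regular representation.** The invariant integral $\varphi_t$ on $C_c(SL_q(2,\mathbb R)_t)$ is the positive linear functional $$\varphi_t(b\Phi_n)=\frac{\{a+n\}}{\{a\}}\,\Phi(b),\qquad b\in\mathcal O_q(S_t^2),\ n\in\mathbb Z.$$ Let $H_{\mathrm{reg}}$ be the Hilbert space completion of $C_c(SL_q(2,\mathbb R)_t)$ for the pre-inner product $\langle y,x\rangle=\varphi_t(y^*x)$, with canonical map $\Lambda$. Left multiplication is bounded for it, and the regular representation $\pi_{\mathrm{reg}}$ is the $*$-representation of $C_c(SL_q(2,\mathbb R)_t)$ on $H_{\mathrm{reg}}$ with $\pi_{\mathrm{reg}}(z)\Lambda(x)=\Lambda(zx)$. **Proposition.** The integral $\varphi_t$ is faithful on $C_c(SL_q(2,\mathbb R)_t)$: if $x\in C_c(SL_q(2,\mathbb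 R)_t)$ and $\varphi_t(x^*x)=0$, then $x=0$. Moreover, the regular representation $\pi_{\mathrm{reg}}$ is faithful (injective) on $C_c(SL_q(2,\mathbb R)_t)$. -/

import Mathlib

set_option linter.unusedSimpArgs false
open scoped TensorProduct ComplexConjugate InnerProductSpace

noncomputable section

namespace QSL

/-- The range of the deformation parameter, `0 < q < 1`. -/
abbrev Param : Type := Set.Ioo (0 : ℝ) 1

/-- The parameter `q` as a complex number. -/
def qc (q : Param) : ℂ := ((q : ℝ) : ℂ)

theorem qc_ne_zero (q : Param) : qc q ≠ 0 := by
  have := q.2.1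
  simp [qc, this.ne']

theorem conj_qc (q : Param) : conj (qc q) = qc q := by simp [qc]

/-! ### The Hopf `*`-algebra of the quantum group `SU_q(2)` -/

/-- The four generators `α`, `α^*`, `γ`, `γ^*`. -/
inductive Gen : Type
  | α | αs | γ | γs

/-- The defining relations for elements `x, xs, y, ys` (standing for `α, α^*, γ, γ^*`)
of an algebra.  The last two are the adjoints of the two before them. -/
structure SURel (q : Param) {S : Type*} [Ring S] [Algebra ℂ S] (x xs y ys : S) : Prop where
  r1 : xs * x + ys * y = 1
  r2 : x * xs + (qc q ^ 2) • (y * ys) = 1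
  r3 : ys * y = y * ys
  r4 : x * y = qc q • (y * x)
  r5 : x * ys = qc q • (ys * x)
  r6 : ys * xs = qc q • (xs * ys)
  r7 : y * xs = qc q • (xs * y)

open FreeAlgebra in
/-- The same relations, as a relation on the free algebra. -/
inductive Rel (q : Param) : FreeAlgebra ℂ Gen → FreeAlgebra ℂ Gen → Prop
  | r1 : Rel q (ι ℂ .αs * ι ℂ .α + ι ℂ .γs * ι ℂ .γ) 1
  | r2 : Rel q (ι ℂ .α * ι ℂ .αs + (qc q ^ 2) • (ι ℂ .γ * ι ℂ .γs)) 1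
  | r3 : Rel q (ι ℂ .γs * ι ℂ .γ) (ι ℂ .γ * ι ℂ .γs)
  | r4 : Rel q (ι ℂ .α * ι ℂ .γ) (qc q • (ι ℂ .γ * ι ℂ .α))
  | r5 : Rel q (ι ℂ .α * ι ℂ .γs) (qc q • (ι ℂ .γs * ι ℂ .α))
  | r6 : Rel q (ι ℂ .γs * ι ℂ .αs) (qc q • (ι ℂ .αs * ι ℂ .γs))
  | r7 : Rel q (ι ℂ .γ * ι ℂ .αs) (qc q • (ι ℂ .αs * ι ℂ .γ))

/-- `O_q(SU(2))`: the universal unital algebra with these generators and relations. -/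
def Oq (q : Param) : Type := RingQuot (Rel q)

instance (q : Param) : Ring (Oq q) := inferInstanceAs (Ring (RingQuot (Rel q)))
instance (q : Param) : Algebra ℂ (Oq q) := inferInstanceAs (Algebra ℂ (RingQuot (Rel q)))

namespace Oq

variable (q : Param)

def mk : FreeAlgebra ℂ Gen →ₐ[ℂ] Oq q := RingQuot.mkAlgHom ℂ (Rel q)

def α : Oq q := mk q (FreeAlgebra.ι ℂ .α)
def αs : Oq q := mk q (FreeAlgebra.ι ℂ .αs)
def γ : Oq q := mk q (FreeAlgebra.ι ℂ .γ)
def γs : Oq q := mk q (FreeAlgebra.ι ℂ .γs)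

variable {q} in
theorem mk_rel {a b : FreeAlgebra ℂ Gen} (h : Rel q a b) : mk q a = mk q b :=
  RingQuot.mkAlgHom_rel ℂ h

theorem surel : SURel q (α q) (αs q) (γ q) (γs q) where
  r1 := by
    have h := mk_rel (Rel.r1 (q := q))
    simp only [map_add, map_mul, map_smul, map_one] at h
    exact h
  r2 := by
    have h := mk_rel (Rel.r2 (q := q))
    simp only [map_add, map_mul, map_smul, map_one] at h
    exact h
  r3 := by
    have h := mk_rel (Rel.r3 (q := q))
    simp only [map_add, map_mul, map_smul, map_one] at h
    exact h
  r4 := by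
    have h := mk_rel (Rel.r4 (q := q))
    simp only [map_add, map_mul, map_smul, map_one] at h
    exact h
  r5 := by
    have h := mk_rel (Rel.r5 (q := q))
    simp only [map_add, map_mul, map_smul, map_one] at h
    exact h
  r6 := by
    have h := mk_rel (Rel.r6 (q := q))
    simp only [map_add, map_mul, map_smul, map_one] at h
    exact h
  r7 := by
    have h := mk_rel (Rel.r7 (q := q))
    simp only [map_add, map_mul, map_smul, map_one] at h
    exact h

variable {q}

/-- The universal property of `O_q(SU(2))`. -/
def lift {S : Type*} [Ring S] [Algebra ℂ S] {x xs y ys : S} (h : SURel q x xs y ys) :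
    Oq q →ₐ[ℂ] S :=
  RingQuot.liftAlgHom ℂ ⟨FreeAlgebra.lift ℂ (fun g : Gen => match g with
    | .α => x | .αs => xs | .γ => y | .γs => ys), by
    intro a b r
    cases r
    · simpa using h.r1
    · simpa using h.r2
    · simpa using h.r3
    · simpa using h.r4
    · simpa using h.r5
    · simpa using h.r6
    · simpa using h.r7⟩

section
variable {S : Type*} [Ring S] [Algebra ℂ S] {x xs y ys : S} (h : SURel q x xs y ys)

@[simp] theorem lift_α : lift h (α q) = x := by
  simp only [lift, α, mk]; erw [RingQuot.liftAlgHom_mkAlgHom_apply]; simp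
@[simp] theorem lift_αs : lift h (αs q) = xs := by
  simp only [lift, αs, mk]; erw [RingQuot.liftAlgHom_mkAlgHom_apply]; simp
@[simp] theorem lift_γ : lift h (γ q) = y := by
  simp only [lift, γ, mk]; erw [RingQuot.liftAlgHom_mkAlgHom_apply]; simp
@[simp] theorem lift_γs : lift h (γs q) = ys := by
  simp only [lift, γs, mk]; erw [RingQuot.liftAlgHom_mkAlgHom_apply]; simp
end

theorem induction {P : Oq q → Prop} (hα : P (α q)) (hαs : P (αs q)) (hγ : P (γ q))
    (hγs : P (γs q)) (h1 : P 1) (hs : ∀ (c : ℂ) x, P x → P (c • x))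
    (ha : ∀ x y, P x → P y → P (x + y)) (hm : ∀ x y, P x → P y → P (x * y)) (x : Oq q) :
    P x := by
  obtain ⟨y, rfl⟩ := RingQuot.mkAlgHom_surjective ℂ (Rel q) x
  change P (mk q y)
  induction y using FreeAlgebra.induction with
  | grade0 r =>
    rw [AlgHom.commutes, Algebra.algebraMap_eq_smul_one]; exact hs _ _ h1
  | grade1 g => cases g <;> assumption
  | mul a b h h' => rw [map_mul]; exact hm _ _ h h'
  | add a b h h' => rw [map_add]; exact ha _ _ h h'

theorem hom_ext {S : Type*} [Ring S] [Algebra ℂ S] {f g : Oq q →ₐ[ℂ] S}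
    (hα : f (α q) = g (α q)) (hαs : f (αs q) = g (αs q)) (hγ : f (γ q) = g (γ q))
    (hγs : f (γs q) = g (γs q)) : f = g := by
  ext x
  refine induction (P := fun x => f x = g x) hα hαs hγ hγs (by simp) (fun c x h => by simp [h])
    (fun x y h h' => by simp [h, h']) (fun x y h h' => by simp [h, h']) x

/-- The opposite algebra with the complex conjugate scalar multiplication; used to define the
conjugate-linear antimultiplicative involution. -/
def ConjOp (q : Param) : Type := (Oq q)ᵐᵒᵖ

instance : Ring (ConjOp q) := inferInstanceAs (Ring (Oq q)ᵐᵒᵖ)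
instance : Algebra ℂ (ConjOp q) :=
  RingHom.toAlgebra' ((algebraMap ℂ (Oq q)ᵐᵒᵖ).comp (starRingEnd ℂ))
    (fun c x => Algebra.commutes (A := (Oq q)ᵐᵒᵖ) (conj c) x)

def ConjOp.op (x : Oq q) : ConjOp q := MulOpposite.op x
def ConjOp.unop (x : ConjOp q) : Oq q := MulOpposite.unop x

theorem ConjOp.op_mul (x y : Oq q) : op x * op y = op (y * x) := rfl
theorem ConjOp.op_add (x y : Oq q) : op x + op y = op (x + y) := rfl
theorem ConjOp.op_one : (1 : ConjOp q) = op 1 := rfl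
theorem ConjOp.unop_mul (x y : ConjOp q) : unop (x * y) = unop y * unop x := rfl
theorem ConjOp.unop_add (x y : ConjOp q) : unop (x + y) = unop x + unop y := rfl

theorem ConjOp.smul_op (c : ℂ) (x : Oq q) : c • op x = op (conj c • x) := by
  rw [Algebra.smul_def]
  exact (Algebra.smul_def (A := (Oq q)ᵐᵒᵖ) (conj c) (MulOpposite.op x)).symm

theorem ConjOp.unop_smul (c : ℂ) (x : ConjOp q) : unop (c • x) = conj c • unop x :=
  congrArg unop (ConjOp.smul_op c (unop x))

/-- The involution, with values in the opposite algebra: `α ↦ α^*`, `γ ↦ γ^*`. -/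
def starHom (q : Param) : Oq q →ₐ[ℂ] ConjOp q :=
  lift (x := ConjOp.op (αs q)) (xs := ConjOp.op (α q))
    (y := ConjOp.op (γs q)) (ys := ConjOp.op (γ q)) <| by
  have h := surel q
  have hc := conj_qc q
  constructor <;> simp only [ConjOp.op_mul, ConjOp.smul_op, ConjOp.op_add, ConjOp.op_one,
    map_pow, hc]
  · rw [h.r1]
  · rw [h.r2]
  · rw [h.r3]
  · rw [h.r6]
  · rw [h.r7]
  · rw [h.r4]
  · rw [h.r5]

instance : Star (Oq q) := ⟨fun x => (starHom q x).unop⟩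

theorem star_def (x : Oq q) : star x = (starHom q x).unop := rfl

@[simp] theorem star_α : star (α q) = αs q := by rw [star_def, starHom, lift_α]; rfl
@[simp] theorem star_αs : star (αs q) = α q := by rw [star_def, starHom, lift_αs]; rfl
@[simp] theorem star_γ : star (γ q) = γs q := by rw [star_def, starHom, lift_γ]; rfl
@[simp] theorem star_γs : star (γs q) = γ q := by rw [star_def, starHom, lift_γs]; rfl

theorem star_mul' (x y : Oq q) : star (x * y) = star y * star x := by
  rw [star_def, map_mul, ConjOp.unop_mul]; rfl
theorem star_add' (x y : Oq q) : star (x + y) = star x + star y := by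
  rw [star_def, map_add, ConjOp.unop_add]; rfl
theorem star_smul' (c : ℂ) (x : Oq q) : star (c • x) = conj c • star x := by
  rw [star_def, map_smul, ConjOp.unop_smul]; rfl
theorem star_one' : star (1 : Oq q) = 1 := by
  rw [star_def, map_one]; rfl

instance : StarRing (Oq q) where
  star_involutive x := by
    refine induction (P := fun x => star (star x) = x) ?_ ?_ ?_ ?_ ?_ ?_ ?_ ?_ x
    · simp
    · simp
    · simp
    · simp
    · rw [star_one', star_one']
    · intro c x h; rw [star_smul', star_smul', h]; simp
    · intro x y h h'; rw [star_add', star_add', h, h']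
    · intro x y h h'; rw [star_mul', star_mul', h, h']
  star_mul := star_mul'
  star_add := star_add'

instance : StarModule ℂ (Oq q) := ⟨star_smul'⟩

/-- The counit: `α, α^* ↦ 1`, `γ, γ^* ↦ 0`. -/
def counitHom (q : Param) : Oq q →ₐ[ℂ] ℂ :=
  lift (x := 1) (xs := 1) (y := 0) (ys := 0) (by constructor <;> simp)

/-- The coproduct: `Δ(α) = α ⊗ α - q γ^* ⊗ γ`, `Δ(γ) = γ ⊗ α + α^* ⊗ γ`, and the adjoints of
these. -/
def comulHom (q : Param) : Oq q →ₐ[ℂ] Oq q ⊗[ℂ] Oq q :=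
  lift (x := α q ⊗ₜ α q - qc q • (γs q ⊗ₜ γ q)) (xs := αs q ⊗ₜ αs q - qc q • (γ q ⊗ₜ γs q))
    (y := γ q ⊗ₜ α q + αs q ⊗ₜ γ q) (ys := γs q ⊗ₜ αs q + α q ⊗ₜ γs q) <| by
  have h := surel q
  have e1 : αs q * α q = 1 - γ q * γs q := by rw [← h.r3, ← h.r1]; abel
  have e2 : α q * αs q = 1 - qc q ^ 2 • (γ q * γs q) := by rw [← h.r2]; abel
  constructor <;>
    simp only [mul_add, add_mul, mul_sub, sub_mul, Algebra.TensorProduct.tmul_mul_tmul, e1, e2,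
      h.r3, h.r4, h.r5, h.r6, h.r7, TensorProduct.tmul_smul, ← TensorProduct.smul_tmul', smul_mul_assoc,
      mul_smul_comm, TensorProduct.sub_tmul, TensorProduct.tmul_sub,
      Algebra.TensorProduct.one_def] <;>
    module

end Oq

section

namespace Oq

variable {q : Param}

@[simp] theorem comulHom_α : comulHom q (α q) = α q ⊗ₜ α q - qc q • (γs q ⊗ₜ γ q) := by
  rw [comulHom, lift_α]
@[simp] theorem comulHom_αs : comulHom q (αs q) = αs q ⊗ₜ αs q - qc q • (γ q ⊗ₜ γs q) := by
  rw [comulHom, lift_αs]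
@[simp] theorem comulHom_γ : comulHom q (γ q) = γ q ⊗ₜ α q + αs q ⊗ₜ γ q := by
  rw [comulHom, lift_γ]
@[simp] theorem comulHom_γs : comulHom q (γs q) = γs q ⊗ₜ αs q + α q ⊗ₜ γs q := by
  rw [comulHom, lift_γs]

@[simp] theorem counitHom_α : counitHom q (α q) = 1 := by rw [counitHom, lift_α]
@[simp] theorem counitHom_αs : counitHom q (αs q) = 1 := by rw [counitHom, lift_αs]
@[simp] theorem counitHom_γ : counitHom q (γ q) = 0 := by rw [counitHom, lift_γ]
@[simp] theorem counitHom_γs : counitHom q (γs q) = 0 := by rw [counitHom, lift_γs]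

instance : Bialgebra ℂ (Oq q) :=
  Bialgebra.ofAlgHom (comulHom q) (counitHom q)
    (by
      apply hom_ext <;>
        simp [TensorProduct.add_tmul, TensorProduct.tmul_add, TensorProduct.sub_tmul,
          TensorProduct.tmul_sub, ← TensorProduct.smul_tmul', TensorProduct.tmul_smul] <;>
        module)
    (by
      apply hom_ext <;> simp [← TensorProduct.smul_tmul'])
    (by
      apply hom_ext <;> simp)

theorem comul_def (x : Oq q) : Coalgebra.comul (R := ℂ) x = comulHom q x := rfl
theorem counit_def (x : Oq q) : Coalgebra.counit (R := ℂ) x = counitHom q x := rfl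

/-! ### The dual algebra and the elements `k`, `k⁻¹`, `e`, `f` of `U_q(su(2))` -/

/-- The full dual `Hom(O_q(SU(2)), ℂ)`, with its convolution product; by the unitary pairing
`U_q(su(2))` acts by functionals on `O_q(SU(2))`, i.e. it maps to this algebra. -/
abbrev Dual (q : Param) : Type := WithConv (Oq q →ₗ[ℂ] ℂ)

/-- The right action `a ◁ h = h(a₍₁₎) a₍₂₎`. -/
def lact (h : Oq q →ₗ[ℂ] ℂ) : Oq q →ₗ[ℂ] Oq q :=
  (TensorProduct.lid ℂ (Oq q)).toLinearMap ∘ₗ h.rTensor (Oq q) ∘ₗ Coalgebra.comul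

/-- The left action `h ▷ a = a₍₁₎ h(a₍₂₎)`. -/
def ract (h : Oq q →ₗ[ℂ] ℂ) : Oq q →ₗ[ℂ] Oq q :=
  (TensorProduct.rid ℂ (Oq q)).toLinearMap ∘ₗ h.lTensor (Oq q) ∘ₗ Coalgebra.comul

theorem lact_apply (h : Oq q →ₗ[ℂ] ℂ) (x : Oq q) :
    lact h x = TensorProduct.lid ℂ (Oq q) (h.rTensor (Oq q) (comulHom q x)) := rfl
theorem ract_apply (h : Oq q →ₗ[ℂ] ℂ) (x : Oq q) :
    ract h x = TensorProduct.rid ℂ (Oq q) (h.lTensor (Oq q) (comulHom q x)) := rfl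

/-- The functional `(·, k)`: the character with matrix `diag(q, q⁻¹)`. -/
def kHom (q : Param) : Oq q →ₐ[ℂ] ℂ :=
  lift (x := qc q) (xs := (qc q)⁻¹) (y := 0) (ys := 0)
    (by have := qc_ne_zero q; constructor <;> simp [this])

/-- The functional `(·, k⁻¹)`. -/
def kInvHom (q : Param) : Oq q →ₐ[ℂ] ℂ :=
  lift (x := (qc q)⁻¹) (xs := qc q) (y := 0) (ys := 0)
    (by have := qc_ne_zero q; constructor <;> simp [this])

@[simp] theorem kHom_α : kHom q (α q) = qc q := by rw [kHom, lift_α]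
@[simp] theorem kHom_αs : kHom q (αs q) = (qc q)⁻¹ := by rw [kHom, lift_αs]
@[simp] theorem kHom_γ : kHom q (γ q) = 0 := by rw [kHom, lift_γ]
@[simp] theorem kHom_γs : kHom q (γs q) = 0 := by rw [kHom, lift_γs]
@[simp] theorem kInvHom_α : kInvHom q (α q) = (qc q)⁻¹ := by rw [kInvHom, lift_α]
@[simp] theorem kInvHom_αs : kInvHom q (αs q) = qc q := by rw [kInvHom, lift_αs]
@[simp] theorem kInvHom_γ : kInvHom q (γ q) = 0 := by rw [kInvHom, lift_γ]
@[simp] theorem kInvHom_γs : kInvHom q (γs q) = 0 := by rw [kInvHom, lift_γs]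

/-- `q^{1/2}`. -/
def sqc (q : Param) : ℂ := ((Real.sqrt (q : ℝ) : ℝ) : ℂ)

theorem sqc_mul_sqc (q : Param) : sqc q * sqc q = qc q := by
  rw [sqc, qc, ← Complex.ofReal_mul, Real.mul_self_sqrt q.2.1.le]
theorem sqc_ne_zero (q : Param) : sqc q ≠ 0 := by
  intro h
  exact qc_ne_zero q (by rw [← sqc_mul_sqc, h, zero_mul])

/-- Since `Δ(e) = e ⊗ 1 + k ⊗ e`, the pairing with `e` is the corner of the algebra homomorphism
`x ↦ [[(x, k), (x, e)], [0, ε(x)]]`.  Its value on the matrix `[[α, -q γ^*], [γ, α^*]]` is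
`[[0, q^{1/2}], [0, 0]]`. -/
def eMat (q : Param) : Oq q →ₐ[ℂ] Matrix (Fin 2) (Fin 2) ℂ :=
  lift (x := !![qc q, 0; 0, 1]) (xs := !![(qc q)⁻¹, 0; 0, 1]) (y := 0)
    (ys := !![0, - (qc q)⁻¹ * sqc q; 0, 0])
    (by
      have := qc_ne_zero q
      constructor <;> ext i j <;> fin_cases i <;> fin_cases j <;>
        simp [Matrix.mul_apply, Fin.sum_univ_two, this])

/-- Since `Δ(f) = 1 ⊗ f + f ⊗ k⁻¹`, the pairing with `f` is the corner of the algebra homomorphism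
`x ↦ [[ε(x), (x, f)], [0, (x, k⁻¹)]]`.  Its value on the matrix `[[α, -q γ^*], [γ, α^*]]` is
`[[0, 0], [q^{-1/2}, 0]]`. -/
def fMat (q : Param) : Oq q →ₐ[ℂ] Matrix (Fin 2) (Fin 2) ℂ :=
  lift (x := !![1, 0; 0, (qc q)⁻¹]) (xs := !![1, 0; 0, qc q]) (y := !![0, (sqc q)⁻¹; 0, 0])
    (ys := 0)
    (by
      have := qc_ne_zero q
      constructor <;> ext i j <;> fin_cases i <;> fin_cases j <;>
        simp [Matrix.mul_apply, Fin.sum_univ_two, this] <;> field_simp)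

/-- The functional `(·, e)`. -/
def eFun (q : Param) : Oq q →ₗ[ℂ] ℂ := Matrix.entryLinearMap ℂ ℂ 0 1 ∘ₗ (eMat q).toLinearMap
/-- The functional `(·, f)`. -/
def fFun (q : Param) : Oq q →ₗ[ℂ] ℂ := Matrix.entryLinearMap ℂ ℂ 0 1 ∘ₗ (fMat q).toLinearMap

@[simp] theorem eFun_α : eFun q (α q) = 0 := by simp [eFun, eMat]
@[simp] theorem eFun_αs : eFun q (αs q) = 0 := by simp [eFun, eMat]
@[simp] theorem eFun_γ : eFun q (γ q) = 0 := by simp [eFun, eMat]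
@[simp] theorem eFun_γs : eFun q (γs q) = - (qc q)⁻¹ * sqc q := by simp [eFun, eMat]
@[simp] theorem fFun_α : fFun q (α q) = 0 := by simp [fFun, fMat]
@[simp] theorem fFun_αs : fFun q (αs q) = 0 := by simp [fFun, fMat]
@[simp] theorem fFun_γ : fFun q (γ q) = (sqc q)⁻¹ := by simp [fFun, fMat]
@[simp] theorem fFun_γs : fFun q (γs q) = 0 := by simp [fFun, fMat]

theorem eMat_spec (x : Oq q) :
    eMat q x 0 0 = kHom q x ∧ eMat q x 1 0 = 0 ∧ eMat q x 1 1 = counitHom q x := by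
  refine induction (P := fun x => eMat q x 0 0 = kHom q x ∧ eMat q x 1 0 = 0 ∧
    eMat q x 1 1 = counitHom q x) ?_ ?_ ?_ ?_ ?_ ?_ ?_ ?_ x
  · simp [eMat]
  · simp [eMat]
  · simp [eMat]
  · simp [eMat]
  · simp
  · rintro c x ⟨h1, h2, h3⟩; simp [h1, h2, h3]
  · rintro x y ⟨h1, h2, h3⟩ ⟨h4, h5, h6⟩; simp [*]
  · rintro x y ⟨h1, h2, h3⟩ ⟨h4, h5, h6⟩; simp [Matrix.mul_apply, Fin.sum_univ_two, *]

theorem fMat_spec (x : Oq q) :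
    fMat q x 0 0 = counitHom q x ∧ fMat q x 1 0 = 0 ∧ fMat q x 1 1 = kInvHom q x := by
  refine induction (P := fun x => fMat q x 0 0 = counitHom q x ∧ fMat q x 1 0 = 0 ∧
    fMat q x 1 1 = kInvHom q x) ?_ ?_ ?_ ?_ ?_ ?_ ?_ ?_ x
  · simp [fMat]
  · simp [fMat]
  · simp [fMat]
  · simp [fMat]
  · simp
  · rintro c x ⟨h1, h2, h3⟩; simp [h1, h2, h3]
  · rintro x y ⟨h1, h2, h3⟩ ⟨h4, h5, h6⟩; simp [*]
  · rintro x y ⟨h1, h2, h3⟩ ⟨h4, h5, h6⟩; simp [Matrix.mul_apply, Fin.sum_univ_two, *]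

theorem eFun_mul (x y : Oq q) : eFun q (x * y) = eFun q x * counitHom q y + kHom q x * eFun q y := by
  simp only [eFun, LinearMap.comp_apply, AlgHom.toLinearMap_apply, map_mul,
    Matrix.entryLinearMap_apply, Matrix.mul_apply, Fin.sum_univ_two, (eMat_spec x).1,
    (eMat_spec y).2.2]
  ring

theorem fFun_mul (x y : Oq q) :
    fFun q (x * y) = counitHom q x * fFun q y + fFun q x * kInvHom q y := by
  simp only [fFun, LinearMap.comp_apply, AlgHom.toLinearMap_apply, map_mul,
    Matrix.entryLinearMap_apply, Matrix.mul_apply, Fin.sum_univ_two, (fMat_spec x).1,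
    (fMat_spec y).2.2]

open WithConv in
/-- `B_t = q^{-1/2} (e - f k) - √-1 (q - q⁻¹)⁻¹ t k`, as a functional on `O_q(SU(2))`. -/
def Bt (q : Param) (t : ℝ) : Dual q :=
  (sqc q)⁻¹ • (toConv (eFun q) - toConv (fFun q) * toConv (kHom q).toLinearMap) -
    (Complex.I * (qc q - (qc q)⁻¹)⁻¹ * (t : ℂ)) • toConv (kHom q).toLinearMap

/-- `q^s - q^{-s}`. -/
def dbr (q : Param) (s : ℝ) : ℝ := (q : ℝ) ^ s - (q : ℝ) ^ (-s)
/-- `[s] = (q^s - q^{-s}) / (q - q⁻¹)`. -/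
def qnum (q : Param) (s : ℝ) : ℝ := dbr q s / ((q : ℝ) - (q : ℝ)⁻¹)
/-- `{s} = q^s + q^{-s}`. -/
def cbr (q : Param) (s : ℝ) : ℝ := (q : ℝ) ^ s + (q : ℝ) ^ (-s)

/-! ### Properties of the actions -/

@[simp] theorem ract_one_gen (h : Oq q →ₗ[ℂ] ℂ) : ract h 1 = h 1 • 1 := by
  simp [ract_apply, Algebra.TensorProduct.one_def]
@[simp] theorem lact_one_gen (h : Oq q →ₗ[ℂ] ℂ) : lact h 1 = h 1 • 1 := by
  simp [lact_apply, Algebra.TensorProduct.one_def]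
theorem ract_α (h : Oq q →ₗ[ℂ] ℂ) :
    ract h (α q) = h (α q) • α q - (qc q * h (γ q)) • γs q := by
  simp [ract_apply, mul_smul]
theorem ract_αs (h : Oq q →ₗ[ℂ] ℂ) :
    ract h (αs q) = h (αs q) • αs q - (qc q * h (γs q)) • γ q := by
  simp [ract_apply, mul_smul]
theorem ract_γ (h : Oq q →ₗ[ℂ] ℂ) : ract h (γ q) = h (α q) • γ q + h (γ q) • αs q := by
  simp [ract_apply]
theorem ract_γs (h : Oq q →ₗ[ℂ] ℂ) : ract h (γs q) = h (αs q) • γs q + h (γs q) • α q := by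
  simp [ract_apply]
theorem lact_α (h : Oq q →ₗ[ℂ] ℂ) :
    lact h (α q) = h (α q) • α q - (qc q * h (γs q)) • γ q := by
  simp [lact_apply, mul_smul]
theorem lact_αs (h : Oq q →ₗ[ℂ] ℂ) :
    lact h (αs q) = h (αs q) • αs q - (qc q * h (γ q)) • γs q := by
  simp [lact_apply, mul_smul]
theorem lact_γ (h : Oq q →ₗ[ℂ] ℂ) : lact h (γ q) = h (γ q) • α q + h (αs q) • γ q := by
  simp [lact_apply]
theorem lact_γs (h : Oq q →ₗ[ℂ] ℂ) : lact h (γs q) = h (γs q) • αs q + h (α q) • γs q := by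
  simp [lact_apply]

theorem lact_counit (x : Oq q) : lact (counitHom q).toLinearMap x = x :=
  (congrArg (TensorProduct.lid ℂ (Oq q)) (Coalgebra.rTensor_counit_comul (R := ℂ) x)).trans
    (by simp)
theorem ract_counit (x : Oq q) : ract (counitHom q).toLinearMap x = x :=
  (congrArg (TensorProduct.rid ℂ (Oq q)) (Coalgebra.lTensor_counit_comul (R := ℂ) x)).trans
    (by simp)

/-- Functionals `h` with `Δ(h) = h ⊗ l + m ⊗ h` act by twisted derivations. -/
theorem lact_mul_of {h m l : Oq q →ₗ[ℂ] ℂ} (H : ∀ x y, h (x * y) = h x * l y + m x * h y)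
    (x y : Oq q) : lact h (x * y) = lact h x * lact l y + lact m x * lact h y := by
  simp only [lact_apply, map_mul]
  generalize comulHom q x = s
  generalize comulHom q y = t
  induction s using TensorProduct.induction_on with
  | zero => simp
  | add s s' hs hs' => simp only [add_mul, map_add, hs, hs']; abel
  | tmul a b =>
    induction t using TensorProduct.induction_on with
    | zero => simp
    | add s s' hs hs' => simp only [mul_add, map_add, hs, hs']; abel
    | tmul c d =>
      simp only [Algebra.TensorProduct.tmul_mul_tmul, LinearMap.rTensor_tmul,
        TensorProduct.lid_tmul, H, add_smul, smul_mul_smul_comm]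

theorem ract_mul_of {h m l : Oq q →ₗ[ℂ] ℂ} (H : ∀ x y, h (x * y) = h x * l y + m x * h y)
    (x y : Oq q) : ract h (x * y) = ract h x * ract l y + ract m x * ract h y := by
  simp only [ract_apply, map_mul]
  generalize comulHom q x = s
  generalize comulHom q y = t
  induction s using TensorProduct.induction_on with
  | zero => simp
  | add s s' hs hs' => simp only [add_mul, map_add, hs, hs']; abel
  | tmul a b =>
    induction t using TensorProduct.induction_on with
    | zero => simp
    | add s s' hs hs' => simp only [mul_add, map_add, hs, hs']; abel
    | tmul c d =>
      simp only [Algebra.TensorProduct.tmul_mul_tmul, LinearMap.lTensor_tmul,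
        TensorProduct.rid_tmul, H, add_smul, smul_mul_smul_comm]

theorem lact_mul_char (k : Oq q →ₐ[ℂ] ℂ) (x y : Oq q) :
    lact k.toLinearMap (x * y) = lact k.toLinearMap x * lact k.toLinearMap y := by
  have := lact_mul_of (h := k.toLinearMap) (m := 0) (l := k.toLinearMap) (by simp) x y
  rw [this]; simp [lact_apply]

theorem ract_mul_char (k : Oq q →ₐ[ℂ] ℂ) (x y : Oq q) :
    ract k.toLinearMap (x * y) = ract k.toLinearMap x * ract k.toLinearMap y := by
  have := ract_mul_of (h := k.toLinearMap) (m := 0) (l := k.toLinearMap) (by simp) x y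
  rw [this]; simp [ract_apply]

theorem conv_apply (h l : Oq q →ₗ[ℂ] ℂ) (x : Oq q) :
    (WithConv.toConv h * WithConv.toConv l) x = h (ract l x) := by
  rw [LinearMap.convMul_apply, ract_apply, comul_def]
  generalize comulHom q x = s
  induction s using TensorProduct.induction_on with
  | zero => simp
  | add s s' hs hs' => simp only [map_add, hs, hs']
  | tmul a b => simp [mul_comm]

end Oq

end

section

namespace Oq

variable {q : Param}

/-- `X = q^{-1/2} (e - f k)`, so that `B_t = X - √-1 (q - q⁻¹)⁻¹ t k` and
`Δ(X) = X ⊗ 1 + k ⊗ X`. -/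
def Xfun (q : Param) : Oq q →ₗ[ℂ] ℂ :=
  (sqc q)⁻¹ • (eFun q - fFun q ∘ₗ ract (kHom q).toLinearMap)

theorem kInv_ract_k (x : Oq q) : kInvHom q (ract (kHom q).toLinearMap x) = counitHom q x := by
  have := qc_ne_zero q
  refine induction (P := fun x => kInvHom q (ract (kHom q).toLinearMap x) = counitHom q x)
    ?_ ?_ ?_ ?_ ?_ ?_ ?_ ?_ x
  · simp [ract_α, this]
  · simp [ract_αs, this]
  · simp [ract_γ]
  · simp [ract_γs]
  · simp
  · intro c x h; simp [h]
  · intro x y h h'; simp [h, h']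
  · intro x y h h'; simp [ract_mul_char, h, h']

theorem counit_ract_k (x : Oq q) : counitHom q (ract (kHom q).toLinearMap x) = kHom q x := by
  refine induction (P := fun x => counitHom q (ract (kHom q).toLinearMap x) = kHom q x)
    ?_ ?_ ?_ ?_ ?_ ?_ ?_ ?_ x
  · simp [ract_α]
  · simp [ract_αs]
  · simp [ract_γ]
  · simp [ract_γs]
  · simp
  · intro c x h; simp [h]
  · intro x y h h'; simp [h, h']
  · intro x y h h'; simp [ract_mul_char, h, h']

@[simp] theorem Xfun_α : Xfun q (α q) = 0 := by simp [Xfun, ract_α]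
@[simp] theorem Xfun_αs : Xfun q (αs q) = 0 := by simp [Xfun, ract_αs]
@[simp] theorem Xfun_γ : Xfun q (γ q) = -1 := by
  have h := sqc_ne_zero q
  simp [Xfun, ract_γ, ← sqc_mul_sqc]
  field_simp
@[simp] theorem Xfun_γs : Xfun q (γs q) = -(qc q)⁻¹ := by
  have h := sqc_ne_zero q
  simp [Xfun, ract_γs]
  field_simp

theorem Xfun_mul (x y : Oq q) :
    Xfun q (x * y) = Xfun q x * counitHom q y + kHom q x * Xfun q y := by
  simp only [Xfun, LinearMap.smul_apply, LinearMap.sub_apply, LinearMap.comp_apply, eFun_mul,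
    ract_mul_char, fFun_mul, kInv_ract_k, counit_ract_k, smul_eq_mul]
  ring

@[simp] theorem Xfun_one : Xfun q 1 = 0 := by
  have := Xfun_mul (1 : Oq q) 1
  simpa using this

theorem Bt_apply (t : ℝ) (x : Oq q) :
    (Bt q t).ofConv x = Xfun q x - (Complex.I * (qc q - (qc q)⁻¹)⁻¹ * (t : ℂ)) * kHom q x := by
  have := conv_apply (fFun q) (kHom q).toLinearMap x
  simp only [Bt, Xfun, WithConv.ofConv_sub, WithConv.ofConv_smul, LinearMap.sub_apply,
    LinearMap.smul_apply, smul_eq_mul, LinearMap.comp_apply, AlgHom.toLinearMap_apply,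
    WithConv.ofConv_toConv]
  rw [← this]

theorem Bt_one (t : ℝ) : (Bt q t).ofConv 1 = -(Complex.I * (qc q - (qc q)⁻¹)⁻¹ * (t : ℂ)) := by
  simp [Bt_apply]

theorem lact_add_fun (h l : Oq q →ₗ[ℂ] ℂ) (x : Oq q) :
    lact (h + l) x = lact h x + lact l x := by
  simp [lact_apply, LinearMap.rTensor_add]
theorem lact_smul_fun (c : ℂ) (h : Oq q →ₗ[ℂ] ℂ) (x : Oq q) :
    lact (c • h) x = c • lact h x := by
  simp [lact_apply, LinearMap.rTensor_smul]
theorem ract_add_fun (h l : Oq q →ₗ[ℂ] ℂ) (x : Oq q) :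
    ract (h + l) x = ract h x + ract l x := by
  simp [ract_apply, LinearMap.lTensor_add]
theorem ract_smul_fun (c : ℂ) (h : Oq q →ₗ[ℂ] ℂ) (x : Oq q) :
    ract (c • h) x = c • ract h x := by
  simp [ract_apply, LinearMap.lTensor_smul]

/-- `a ↦ a ◁ k`. -/
abbrev lk (x : Oq q) : Oq q := lact (kHom q).toLinearMap x
/-- `a ↦ a ◁ k⁻¹`. -/
abbrev lki (x : Oq q) : Oq q := lact (kInvHom q).toLinearMap x

theorem lk_lki (x : Oq q) : lk (lki x) = x := by
  have := qc_ne_zero q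
  refine induction (P := fun x => lk (lki x) = x) ?_ ?_ ?_ ?_ ?_ ?_ ?_ ?_ x
  · simp [lact_α, this]
  · simp [lact_αs, this]
  · simp [lact_γ, this]
  · simp [lact_γs, this]
  · simp
  · intro c x h; simp only [lk, lki, map_smul] at *; rw [h]
  · intro x y h h'; simp only [lk, lki, map_add] at *; rw [h, h']
  · intro x y h h'; simp only [lk, lki, lact_mul_char] at *; rw [h, h']

theorem lki_lk (x : Oq q) : lki (lk x) = x := by
  have := qc_ne_zero q
  refine induction (P := fun x => lki (lk x) = x) ?_ ?_ ?_ ?_ ?_ ?_ ?_ ?_ x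
  · simp [lact_α, this]
  · simp [lact_αs, this]
  · simp [lact_γ, this]
  · simp [lact_γs, this]
  · simp
  · intro c x h; simp only [lk, lki, map_smul] at *; rw [h]
  · intro x y h h'; simp only [lk, lki, map_add] at *; rw [h, h']
  · intro x y h h'; simp only [lk, lki, lact_mul_char] at *; rw [h, h']

theorem star_lki (x : Oq q) : star (lki (star x)) = lk x := by
  have hc := conj_qc q
  refine induction (P := fun x => star (lki (star x)) = lk x) ?_ ?_ ?_ ?_ ?_ ?_ ?_ ?_ x
  · simp [lact_α, lact_αs, hc]
  · simp [lact_α, lact_αs, hc]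
  · simp [lact_γ, lact_γs, hc]
  · simp [lact_γ, lact_γs, hc]
  · simp
  · intro c x h; simp only [lk, lki, map_smul, star_smul] at *; rw [h, star_star]
  · intro x y h h'; simp only [lk, lki, map_add, star_add] at *; rw [h, h']
  · intro x y h h'; simp only [lk, lki, star_mul, lact_mul_char] at *; rw [h, h']

/-- `a ↦ a ◁ (B_t - ε(B_t))`. -/
def Dt (q : Param) (t : ℝ) : Oq q →ₗ[ℂ] Oq q :=
  lact (Bt q t).ofConv - (Bt q t).ofConv 1 • LinearMap.id

theorem Dt_apply (t : ℝ) (x : Oq q) : Dt q t x =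
    lact (Xfun q) x - (Complex.I * (qc q - (qc q)⁻¹)⁻¹ * (t : ℂ)) • (lk x - x) := by
  have : (Bt q t).ofConv = Xfun q +
      (-(Complex.I * (qc q - (qc q)⁻¹)⁻¹ * (t : ℂ))) • (kHom q).toLinearMap := by
    ext x; simp [Bt_apply]; ring
  rw [Dt, Bt_one, LinearMap.sub_apply, this, lact_add_fun, lact_smul_fun, LinearMap.smul_apply,
    LinearMap.id_apply]
  module

theorem lactX_mul (x y : Oq q) :
    lact (Xfun q) (x * y) = lact (Xfun q) x * y + lk x * lact (Xfun q) y := by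
  have := lact_mul_of (h := Xfun q) (m := (kHom q).toLinearMap) (l := (counitHom q).toLinearMap)
    Xfun_mul x y
  rw [this, lact_counit]

theorem ractX_mul (x y : Oq q) : ract (Xfun q) (x * y) =
    ract (Xfun q) x * y + ract (kHom q).toLinearMap x * ract (Xfun q) y := by
  have := ract_mul_of (h := Xfun q) (m := (kHom q).toLinearMap) (l := (counitHom q).toLinearMap)
    Xfun_mul x y
  rw [this, ract_counit]

theorem Dt_mul (t : ℝ) (x y : Oq q) : Dt q t (x * y) = Dt q t x * y + lk x * Dt q t y := by
  simp only [Dt_apply, lactX_mul, lk, lact_mul_char, sub_mul, mul_sub, smul_mul_assoc,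
    mul_smul_comm]
  module

theorem star_Dt (t : ℝ) (x : Oq q) : star (lki (Dt q t (star x))) = Dt q t x := by
  have hq := qc_ne_zero q
  have hc := conj_qc q
  have ht : conj (Complex.I * (qc q - (qc q)⁻¹)⁻¹ * (t : ℂ)) =
      - (Complex.I * (qc q - (qc q)⁻¹)⁻¹ * (t : ℂ)) := by simp [hc]
  refine induction (P := fun x => star (lki (Dt q t (star x))) = Dt q t x)
    ?_ ?_ ?_ ?_ ?_ ?_ ?_ ?_ x
  · simp only [Dt_apply]
    generalize Complex.I * (qc q - (qc q)⁻¹)⁻¹ * (t : ℂ) = τ at ht ⊢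
    simp [lact_α, lact_αs, lact_γ, lact_γs, smul_sub, smul_smul, hc, hq, ht]
    match_scalars <;> field_simp <;> ring
  · simp only [Dt_apply]
    generalize Complex.I * (qc q - (qc q)⁻¹)⁻¹ * (t : ℂ) = τ at ht ⊢
    simp [lact_α, lact_αs, lact_γ, lact_γs, smul_sub, smul_smul, hc, hq, ht]
    match_scalars <;> field_simp <;> ring
  · simp only [Dt_apply]
    generalize Complex.I * (qc q - (qc q)⁻¹)⁻¹ * (t : ℂ) = τ at ht ⊢
    simp [lact_α, lact_αs, lact_γ, lact_γs, smul_sub, smul_smul, hc, hq, ht]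
    match_scalars <;> field_simp <;> ring
  · simp only [Dt_apply]
    generalize Complex.I * (qc q - (qc q)⁻¹)⁻¹ * (t : ℂ) = τ at ht ⊢
    simp [lact_α, lact_αs, lact_γ, lact_γs, smul_sub, smul_smul, hc, hq, ht]
    match_scalars <;> field_simp <;> ring
  · simp [Dt_apply]
  · intro c x h; rw [star_smul, map_smul, map_smul, ← h, lki, map_smul, star_smul, star_star]
  · intro x y h h'; rw [star_add, map_add, map_add, ← h, ← h', lki, map_add, star_add]
  · intro x y h h'
    have e1 : lact (kInvHom q).toLinearMap (lk (star y)) = star y := lki_lk (star y)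
    have e2 : star (lact (kInvHom q).toLinearMap (star x)) = lk x := star_lki x
    rw [star_mul, Dt_mul, lki, map_add, lact_mul_char, lact_mul_char, star_add, star_mul, star_mul,
      Dt_mul, e1, e2, star_star, h, h', add_comm]
theorem mem_podles_aux {t : ℝ} {x : Oq q} :
    lact (Bt q t).ofConv x = (Bt q t).ofConv 1 • x ↔ Dt q t x = 0 := by
  rw [Dt, LinearMap.sub_apply, sub_eq_zero]; rfl

theorem Dt_star {t : ℝ} {x : Oq q} (h : Dt q t x = 0) : Dt q t (star x) = 0 := by
  have h1 := star_Dt t x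
  rw [h, star_eq_zero] at h1
  have h2 := lk_lki (Dt q t (star x))
  rw [h1] at h2
  simpa using h2.symm

/-- The Podleś sphere `O_q(S_t^2) = {a | a ◁ B_t = ε(B_t) a}`, where `ε(B_t) = B_t(1)`. -/
def podles (q : Param) (t : ℝ) : StarSubalgebra ℂ (Oq q) where
  carrier := {x | lact (Bt q t).ofConv x = (Bt q t).ofConv 1 • x}
  mul_mem' {x y} hx hy := by
    simp only [Set.mem_ofPred_eq, mem_podles_aux] at *
    rw [Dt_mul, hx, hy]; simp
  add_mem' {x y} hx hy := by
    simp only [Set.mem_ofPred_eq, mem_podles_aux] at *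
    rw [map_add, hx, hy]; simp
  algebraMap_mem' c := by
    simp only [Set.mem_ofPred_eq, Algebra.algebraMap_eq_smul_one, map_smul, lact_one_gen]
    rw [smul_comm]
  star_mem' {x} hx := by
    simp only [Set.mem_ofPred_eq, mem_podles_aux] at *
    exact Dt_star hx

theorem mem_podles {t : ℝ} {x : Oq q} : x ∈ podles q t ↔ Dt q t x = 0 := mem_podles_aux

/-- Coassociativity: `a ↦ a ◁ h` is a map of right comodules. -/
theorem comul_lact (h : Oq q →ₗ[ℂ] ℂ) (x : Oq q) :
    comulHom q (lact h x) = (lact h).rTensor (Oq q) (comulHom q x) := by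
  have key : ∀ s : Oq q ⊗[ℂ] Oq q,
      TensorProduct.lid ℂ (Oq q ⊗[ℂ] Oq q) (TensorProduct.map h (comulHom q).toLinearMap s)
        = comulHom q (TensorProduct.lid ℂ (Oq q) (h.rTensor (Oq q) s)) := by
    intro s
    induction s using TensorProduct.induction_on with
    | zero => simp
    | add s s' hs hs' => simp only [map_add, hs, hs']
    | tmul a b => simp
  have key2 : ∀ s : (Oq q ⊗[ℂ] Oq q) ⊗[ℂ] Oq q,
      TensorProduct.lid ℂ (Oq q ⊗[ℂ] Oq q) (h.rTensor (Oq q ⊗[ℂ] Oq q)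
        (TensorProduct.assoc ℂ (Oq q) (Oq q) (Oq q) s)) =
      ((TensorProduct.lid ℂ (Oq q)).toLinearMap ∘ₗ h.rTensor (Oq q)).rTensor (Oq q) s := by
    intro s
    induction s using TensorProduct.induction_on with
    | zero => simp
    | add s s' hs hs' => simp only [map_add, hs, hs']
    | tmul u c =>
      induction u using TensorProduct.induction_on with
      | zero => simp
      | add s s' hs hs' => simp only [TensorProduct.add_tmul, map_add, hs, hs']
      | tmul a b => simp [TensorProduct.smul_tmul']
  rw [lact_apply, ← key]
  have co := Coalgebra.coassoc_apply (R := ℂ) x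
  have e1 : TensorProduct.map h (comulHom q).toLinearMap (comulHom q x) =
      h.rTensor _ ((comulHom q).toLinearMap.lTensor (Oq q) (comulHom q x)) := by
    rw [← LinearMap.comp_apply, LinearMap.rTensor_comp_lTensor]
  rw [e1]
  change TensorProduct.lid ℂ (Oq q ⊗[ℂ] Oq q)
    (h.rTensor _ (Coalgebra.comul.lTensor (Oq q) (Coalgebra.comul (R := ℂ) x))) = _
  rw [← co, key2, ← LinearMap.comp_apply (f := LinearMap.rTensor _ _), ← LinearMap.rTensor_comp]
  rfl

end Oq

end

section

namespace Oq

variable {q : Param}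

/-! ### The right `O_q(SU(2))`-module `𝓘 = ∏ₙ ℂ Φₙ` -/

/-- `q^{a+m}`. -/
def qpw (q : Param) (a : ℝ) (m : ℤ) : ℂ := (((q : ℝ) ^ (a + m) : ℝ) : ℂ)
/-- `{a+m}`. -/
def wt (q : Param) (a : ℝ) (m : ℤ) : ℂ := ((cbr q (a + m) : ℝ) : ℂ)

theorem qpw_ne_zero (q : Param) (a : ℝ) (m : ℤ) : qpw q a m ≠ 0 := by
  rw [qpw, Complex.ofReal_ne_zero]
  exact (Real.rpow_pos_of_pos q.2.1 _).ne'
theorem qpw_succ (q : Param) (a : ℝ) (m : ℤ) : qpw q a (m + 1) = qc q * qpw q a m := by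
  simp only [qpw, qc, ← Complex.ofReal_mul, Int.cast_add, Int.cast_one]
  rw [← add_assoc, Real.rpow_add_one q.2.1.ne', mul_comm]
theorem qpw_pred (q : Param) (a : ℝ) (m : ℤ) : qpw q a (m - 1) = (qc q)⁻¹ * qpw q a m := by
  have h := qpw_succ q a (m - 1)
  rw [sub_add_cancel] at h
  rw [h, inv_mul_cancel_left₀ (qc_ne_zero q)]
theorem wt_eq (q : Param) (a : ℝ) (m : ℤ) : wt q a m = qpw q a m + (qpw q a m)⁻¹ := by
  rw [wt, cbr, qpw, Real.rpow_neg q.2.1.le]; push_cast; rfl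
theorem wt_ne_zero (q : Param) (a : ℝ) (m : ℤ) : wt q a m ≠ 0 := by
  rw [wt, Complex.ofReal_ne_zero, cbr]
  exact (add_pos (Real.rpow_pos_of_pos q.2.1 _) (Real.rpow_pos_of_pos q.2.1 _)).ne'
theorem qpw_sq_ne (q : Param) (a : ℝ) (m : ℤ) : qpw q a m ^ 2 + 1 ≠ 0 := by
  intro h
  apply wt_ne_zero q a m
  have := qpw_ne_zero q a m
  rw [wt_eq]; field_simp; rw [h, mul_zero]

/-- The operator `x ↦ (m ↦ p(m) x(m+1) + s(m) x(m-1))` on sequences. -/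
def hop (V : Type*) [AddCommGroup V] [Module ℂ V] (p s : ℤ → ℂ) : Module.End ℂ (ℤ → V) where
  toFun x m := p m • x (m + 1) + s m • x (m - 1)
  map_add' x y := by ext m; simp only [Pi.add_apply, smul_add]; abel
  map_smul' c x := by ext m; simp only [Pi.smul_apply, smul_add, smul_comm c, RingHom.id_apply]

@[simp] theorem hop_apply {V : Type*} [AddCommGroup V] [Module ℂ V] (p s : ℤ → ℂ) (x : ℤ → V)
    (m : ℤ) : hop V p s x m = p m • x (m + 1) + s m • x (m - 1) := rfl

/-- Right action of `O_q(SU(2))` on `V`-valued sequences over `ℤ`.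

A complex sequence `(xₙ)` stands for the element `∑ₙ xₙ Φₙ` of `𝓘 = ∏ₙ ℂ Φₙ`, where `Φₙ` is the
spectral projection of `√-1 B_t` (for `t = q^a - q^{-a}`) at its eigenvalue `[a+n]`, and the action
is `(Φ ◁ c, d) = (Φ, c d)`.  On generators it is the shift below, because `[a+m]` occurs in the
tensor product with the two-dimensional representation only from the neighbours `[a+m±1]`.
That this is the right action is proved in `Bt_mul_Phi` (`√-1 B_t Φₙ = [a+n] Φₙ` in the dual of
`O_q(SU(2))`), `sum_Phi` (`∑ₙ Φₙ = 1`) and `Phi_mul_apply` (`(Φₙ, c d) = (Φₙ ◁ c, d)`). -/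
def rmod (q : Param) (a : ℝ) (V : Type*) [AddCommGroup V] [Module ℂ V] :
    Oq q →ₐ[ℂ] (Module.End ℂ (ℤ → V))ᵐᵒᵖ :=
  lift
    (x := MulOpposite.op (hop V (fun m => qpw q a m / wt q a m)
      (fun m => (qpw q a m)⁻¹ / wt q a m)))
    (xs := MulOpposite.op (hop V (fun m => (qpw q a m)⁻¹ / wt q a m)
      (fun m => qpw q a m / wt q a m)))
    (y := MulOpposite.op (hop V (fun m => -Complex.I / wt q a m)
      (fun m => Complex.I / wt q a m)))
    (ys := MulOpposite.op (hop V (fun m => -((qc q)⁻¹ * Complex.I) / wt q a m)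
      (fun m => (qc q)⁻¹ * Complex.I / wt q a m))) <| by
  have hq := qc_ne_zero q
  constructor <;> apply MulOpposite.unop_injective <;> ext x m <;>
    simp only [MulOpposite.unop_add, MulOpposite.unop_mul, MulOpposite.unop_op, MulOpposite.unop_one,
      MulOpposite.unop_smul, Module.End.mul_apply, LinearMap.add_apply, LinearMap.smul_apply,
      Module.End.one_apply, Pi.add_apply, Pi.smul_apply, hop_apply, add_sub_cancel_right,
      sub_add_cancel, wt_eq, qpw_succ, qpw_pred] <;>
    have h0 := qpw_ne_zero q a m <;>
    have h1 := qpw_sq_ne q a m <;>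
    have h2 := qpw_sq_ne q a (m + 1) <;>
    have h3 := qpw_sq_ne q a (m - 1) <;>
    rw [qpw_succ] at h2 <;> rw [qpw_pred] at h3 <;>
    generalize qpw q a m = z at * <;> generalize qc q = w at * <;>
    (have h4 : z ^ 2 + w ^ 2 ≠ 0 := by
      intro h; apply h3; field_simp; rw [h, mul_zero]) <;>
    (have h5 : w ^ 2 * z ^ 2 + 1 ≠ 0 := by rwa [← mul_pow]) <;>
    (have h7 : z ^ 2 * w ^ 2 + 1 ≠ 0 := by rwa [mul_comm]) <;>
    (have h8 : w ^ 2 + z ^ 2 ≠ 0 := by rwa [add_comm]) <;>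
    (have h6 := Complex.I_sq) <;>
    match_scalars <;> field_simp <;> ring_nf <;> (try simp only [h6]) <;> (try ring_nf)

end Oq

end

section

namespace Oq

variable {q : Param}

variable {a : ℝ} {V W : Type*} [AddCommGroup V] [Module ℂ V] [AddCommGroup W] [Module ℂ W]

/-- The right action `x ↦ x ◁ c`. -/
def ractI (a : ℝ) (c : Oq q) : Module.End ℂ (ℤ → V) := (rmod q a V c).unop

theorem ractI_mul (c d : Oq q) (x : ℤ → V) :
    ractI a (c * d) x = ractI a d (ractI a c x) := by simp [ractI]
@[simp] theorem ractI_one (x : ℤ → V) : ractI a (1 : Oq q) x = x := by simp [ractI]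
theorem ractI_add (c d : Oq q) (x : ℤ → V) :
    ractI a (c + d) x = ractI a c x + ractI a d x := by simp [ractI]
theorem ractI_smul (s : ℂ) (c : Oq q) (x : ℤ → V) :
    ractI a (s • c) x = s • ractI a c x := by simp [ractI]
theorem ractI_α : ractI a (α q) = hop V (fun m => qpw q a m / wt q a m)
      (fun m => (qpw q a m)⁻¹ / wt q a m) := by simp [ractI, rmod]
theorem ractI_αs : ractI a (αs q) = hop V (fun m => (qpw q a m)⁻¹ / wt q a m)
      (fun m => qpw q a m / wt q a m) := by simp [ractI, rmod]
theorem ractI_γ : ractI a (γ q) = hop V (fun m => -Complex.I / wt q a m)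
      (fun m => Complex.I / wt q a m) := by simp [ractI, rmod]
theorem ractI_γs : ractI a (γs q) = hop V (fun m => -((qc q)⁻¹ * Complex.I) / wt q a m)
      (fun m => (qc q)⁻¹ * Complex.I / wt q a m) := by simp [ractI, rmod]

/-- The action is natural in the coefficients. -/
theorem ractI_map (φ : V →ₗ[ℂ] W) (c : Oq q) (x : ℤ → V) :
    ractI a c (fun m => φ (x m)) = fun m => φ (ractI a c x m) := by
  revert x
  refine induction (P := fun c => ∀ x : ℤ → V, ractI a c (fun m => φ (x m)) =
    fun m => φ (ractI a c x m)) ?_ ?_ ?_ ?_ ?_ ?_ ?_ ?_ c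
  · intro x; ext m; simp [ractI_α]
  · intro x; ext m; simp [ractI_αs]
  · intro x; ext m; simp [ractI_γ]
  · intro x; ext m; simp [ractI_γs]
  · intro x; simp
  · intro s c h x; ext m; simp [ractI_smul, h]
  · intro c d h h' x; ext m; simp [ractI_add, h, h']
  · intro c d h h' x; rw [ractI_mul, h, h', ractI_mul]

/-- Coordinatewise right multiplication. -/
def mulR (q : Param) : Oq q →ₐ[ℂ] (Module.End ℂ (ℤ → Oq q))ᵐᵒᵖ :=
  AlgHom.ofLinearMap
    { toFun := fun c => MulOpposite.op
        { toFun := fun x m => x m * c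
          map_add' := fun x y => by ext m; simp [add_mul]
          map_smul' := fun s x => by ext m; simp }
      map_add' := fun c d => by
        apply MulOpposite.unop_injective; ext x m; simp [mul_add]
      map_smul' := fun s c => by
        apply MulOpposite.unop_injective; ext x m; simp }
    (by apply MulOpposite.unop_injective; ext x m; simp)
    (fun c d => by apply MulOpposite.unop_injective; ext x m; simp [mul_assoc])

@[simp] theorem mulR_apply (c : Oq q) (x : ℤ → Oq q) (m : ℤ) : (mulR q c).unop x m = x m * c := rfl

/-- The action of `c ⊗ d` on sequences: `x ↦ (x c) ◁ d`. -/
def mulT (q : Param) (a : ℝ) : Oq q ⊗[ℂ] Oq q →ₐ[ℂ] (Module.End ℂ (ℤ → Oq q))ᵐᵒᵖ :=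
  Algebra.TensorProduct.lift (mulR q) (rmod q a (Oq q)) (by
    intro c d
    apply MulOpposite.unop_injective
    ext1 x
    exact ractI_map (LinearMap.mulRight ℂ c) d x)

@[simp] theorem mulT_tmul (c d : Oq q) (x : ℤ → Oq q) :
    (mulT q a (c ⊗ₜ d)).unop x = ractI a d (fun m => x m * c) := by
  simp only [mulT, Algebra.TensorProduct.lift_tmul, MulOpposite.unop_mul, Module.End.mul_apply]
  rfl

/-- Right multiplication by `c` on formal sums `x = ∑ₙ xₙ Φₙ` with `xₙ ∈ O_q(SU(2))`:
`(∑ₙ xₙ Φₙ) c = ∑ₙ xₙ c₍₁₎ (Φₙ ◁ c₍₂₎)`. -/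
def rmul (a : ℝ) (c : Oq q) : Module.End ℂ (ℤ → Oq q) := (mulT q a (Coalgebra.comul c)).unop

theorem rmul_def (c : Oq q) : rmul a c = (mulT q a (comulHom q c)).unop := rfl
theorem rmul_mul (c d : Oq q) (x : ℤ → Oq q) : rmul a (c * d) x = rmul a d (rmul a c x) := by
  simp [rmul_def]
@[simp] theorem rmul_one (x : ℤ → Oq q) : rmul a (1 : Oq q) x = x := by simp [rmul_def]
@[simp] theorem rmul_zero' (x : ℤ → Oq q) : rmul a (0 : Oq q) x = 0 := by simp [rmul_def]
theorem rmul_add (c d : Oq q) (x : ℤ → Oq q) : rmul a (c + d) x = rmul a c x + rmul a d x := by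
  simp [rmul_def]
theorem rmul_smul (s : ℂ) (c : Oq q) (x : ℤ → Oq q) : rmul a (s • c) x = s • rmul a c x := by
  simp [rmul_def]

theorem rmul_α (x : ℤ → Oq q) : rmul a (α q) x = ractI a (α q) (fun m => x m * α q) -
    qc q • ractI a (γ q) (fun m => x m * γs q) := by simp [rmul_def]
theorem rmul_αs (x : ℤ → Oq q) : rmul a (αs q) x = ractI a (αs q) (fun m => x m * αs q) -
    qc q • ractI a (γs q) (fun m => x m * γ q) := by simp [rmul_def]
theorem rmul_γ (x : ℤ → Oq q) : rmul a (γ q) x = ractI a (α q) (fun m => x m * γ q) +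
    ractI a (γ q) (fun m => x m * αs q) := by simp [rmul_def]
theorem rmul_γs (x : ℤ → Oq q) : rmul a (γs q) x = ractI a (αs q) (fun m => x m * γs q) +
    ractI a (γs q) (fun m => x m * α q) := by simp [rmul_def]

/-- Left multiplication commutes with right multiplication. -/
theorem rmul_left (b c : Oq q) (x : ℤ → Oq q) :
    rmul a c (fun m => b * x m) = fun m => b * rmul a c x m := by
  rw [rmul_def]
  generalize comulHom q c = s
  induction s using TensorProduct.induction_on with
  | zero => ext m; simp
  | add s s' hs hs' =>
    ext m
    simp only [map_add, MulOpposite.unop_add, LinearMap.add_apply, hs, hs', Pi.add_apply, mul_add]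
  | tmul u v =>
    simp only [mulT_tmul, mul_assoc]
    exact ractI_map (LinearMap.mulLeft ℂ b) v _

/-- The action of `c` only involves finitely many coordinates at a time. -/
theorem ractI_local (V : Type*) [AddCommGroup V] [Module ℂ V] (a : ℝ) (c : Oq q) :
    ∃ N : ℕ, ∀ (x : ℤ → V) (m : ℤ), (∀ n, |n - m| ≤ N → x n = 0) → ractI a c x m = 0 := by
  have base : ∀ p s : ℤ → ℂ, ∃ N : ℕ, ∀ (x : ℤ → V) (m : ℤ), (∀ n, |n - m| ≤ N → x n = 0) →
      hop V p s x m = 0 := by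
    refine fun p s => ⟨1, fun x m h => ?_⟩
    rw [hop_apply, h, h] <;> simp
  refine induction (P := fun c => ∃ N : ℕ, ∀ (x : ℤ → V) (m : ℤ),
    (∀ n, |n - m| ≤ N → x n = 0) → ractI a c x m = 0) ?_ ?_ ?_ ?_ ?_ ?_ ?_ ?_ c
  · rw [ractI_α]; exact base _ _
  · rw [ractI_αs]; exact base _ _
  · rw [ractI_γ]; exact base _ _
  · rw [ractI_γs]; exact base _ _
  · exact ⟨0, fun x m h => by rw [ractI_one]; exact h m (by simp)⟩
  · rintro s c ⟨N, h⟩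
    exact ⟨N, fun x m hx => by rw [ractI_smul, Pi.smul_apply, h x m hx, smul_zero]⟩
  · rintro c d ⟨N, h⟩ ⟨N', h'⟩
    refine ⟨max N N', fun x m hx => ?_⟩
    rw [ractI_add, Pi.add_apply, h x m fun n hn => hx n (hn.trans (by simp)),
      h' x m fun n hn => hx n (hn.trans (by simp)), add_zero]
  · rintro c d ⟨N, h⟩ ⟨N', h'⟩
    refine ⟨N + N', fun x m hx => ?_⟩
    rw [ractI_mul]
    refine h' _ _ fun n hn => h _ _ fun l hl => hx l ?_
    have := abs_sub_le l n m
    push_cast; linarith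

theorem rmul_local (a : ℝ) (c : Oq q) : ∃ N : ℕ, ∀ (x : ℤ → Oq q) (m : ℤ),
    (∀ n, |n - m| ≤ N → x n = 0) → rmul a c x m = 0 := by
  rw [rmul_def]
  generalize comulHom q c = s
  induction s using TensorProduct.induction_on with
  | zero => exact ⟨0, by simp⟩
  | add s s' hs hs' =>
    obtain ⟨N, h⟩ := hs
    obtain ⟨N', h'⟩ := hs'
    refine ⟨max N N', fun x m hx => ?_⟩
    rw [map_add, MulOpposite.unop_add, LinearMap.add_apply, Pi.add_apply,
      h x m fun n hn => hx n (hn.trans (by simp)),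
      h' x m fun n hn => hx n (hn.trans (by simp)), add_zero]
  | tmul u v =>
    obtain ⟨N, h⟩ := ractI_local (Oq q) a v
    exact ⟨N, fun x m hx => by
      rw [mulT_tmul]; exact h _ _ fun n hn => by rw [hx n hn, zero_mul]⟩

theorem rmul_finite (a : ℝ) (c : Oq q) {x : ℤ → Oq q} (hx : (Function.support x).Finite) :
    (Function.support (rmul a c x)).Finite := by
  obtain ⟨N, h⟩ := rmul_local a c
  have hfin : (⋃ n ∈ Function.support x, Set.Icc (n - N) (n + N)).Finite :=
    hx.biUnion fun n _ => Set.finite_Icc _ _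
  refine hfin.subset fun m hm => ?_
  by_contra hcon
  refine hm (h x m fun n hn => ?_)
  by_contra hn0
  refine hcon (Set.mem_biUnion (x := n) hn0 ?_)
  rw [abs_le] at hn
  constructor <;> linarith

/-- `Podleś`-valued sequences are stable under right multiplication by the Podleś sphere. -/
theorem rmul_mem_podles {t : ℝ} {c : Oq q} (hc : c ∈ podles q t) {x : ℤ → Oq q}
    (hx : ∀ m, x m ∈ podles q t) (m : ℤ) : rmul a c x m ∈ podles q t := by
  have key : ∀ s : Oq q ⊗[ℂ] Oq q, (fun m => Dt q t ((mulT q a s).unop x m)) =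
      (mulT q a ((Dt q t).rTensor (Oq q) s)).unop (fun m => lk (x m)) := by
    intro s
    induction s using TensorProduct.induction_on with
    | zero => ext m; simp
    | add s s' hs hs' =>
      ext m
      simp only [map_add, MulOpposite.unop_add, LinearMap.add_apply, Pi.add_apply, ← hs, ← hs']
    | tmul u v =>
      rw [mulT_tmul, LinearMap.rTensor_tmul, mulT_tmul, ← ractI_map (Dt q t)]
      congr 1; ext m
      rw [Dt_mul, mem_podles.1 (hx m), zero_mul, zero_add]
  have h2 : (Dt q t).rTensor (Oq q) (comulHom q c) = 0 := by
    rw [Dt, LinearMap.rTensor_sub, LinearMap.sub_apply, ← comul_lact, LinearMap.rTensor_smul,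
      LinearMap.rTensor_id, LinearMap.smul_apply, LinearMap.id_apply, ← map_smul, ← map_sub]
    have := mem_podles.1 hc
    rw [Dt, LinearMap.sub_apply] at this
    rw [show lact (Bt q t).ofConv c - (Bt q t).ofConv 1 • c = 0 from this, map_zero]
  have := congrFun (key (comulHom q c)) m
  rw [h2] at this
  rw [mem_podles, rmul_def, this]; simp

end Oq

end

section

namespace Oq

variable {q : Param}

variable {a : ℝ}

theorem rmul_apply_α (x : ℤ → Oq q) (m : ℤ) : rmul a (α q) x m =
    ((qpw q a m / wt q a m) • (x (m + 1) * α q) +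
      ((qpw q a m)⁻¹ / wt q a m) • (x (m - 1) * α q)) -
    qc q • ((-Complex.I / wt q a m) • (x (m + 1) * γs q) +
      (Complex.I / wt q a m) • (x (m - 1) * γs q)) := by
  simp [rmul_α, ractI_α, ractI_γ]
theorem rmul_apply_αs (x : ℤ → Oq q) (m : ℤ) : rmul a (αs q) x m =
    (((qpw q a m)⁻¹ / wt q a m) • (x (m + 1) * αs q) +
      (qpw q a m / wt q a m) • (x (m - 1) * αs q)) -
    qc q • ((-((qc q)⁻¹ * Complex.I) / wt q a m) • (x (m + 1) * γ q) +
      ((qc q)⁻¹ * Complex.I / wt q a m) • (x (m - 1) * γ q)) := by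
  simp only [rmul_αs, ractI_αs, ractI_γs]; rfl
theorem rmul_apply_γ (x : ℤ → Oq q) (m : ℤ) : rmul a (γ q) x m =
    ((qpw q a m / wt q a m) • (x (m + 1) * γ q) +
      ((qpw q a m)⁻¹ / wt q a m) • (x (m - 1) * γ q)) +
    ((-Complex.I / wt q a m) • (x (m + 1) * αs q) +
      (Complex.I / wt q a m) • (x (m - 1) * αs q)) := by
  simp only [rmul_γ, ractI_α, ractI_γ]; rfl
theorem rmul_apply_γs (x : ℤ → Oq q) (m : ℤ) : rmul a (γs q) x m =
    (((qpw q a m)⁻¹ / wt q a m) • (x (m + 1) * γs q) +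
      (qpw q a m / wt q a m) • (x (m - 1) * γs q)) +
    ((-((qc q)⁻¹ * Complex.I) / wt q a m) • (x (m + 1) * α q) +
      ((qc q)⁻¹ * Complex.I / wt q a m) • (x (m - 1) * α q)) := by
  simp only [rmul_γs, ractI_αs, ractI_γs]; rfl

/-- The product of formal sums: `(x y)ₘ = ((x yₘ) Φₘ)ₘ`, i.e. the coefficient of `Φₘ` in
`x · yₘ`. -/
def seqMul (a : ℝ) (x y : ℤ → Oq q) : ℤ → Oq q := fun m => rmul a (y m) x m

theorem rmul_seqMul (c : Oq q) (x y : ℤ → Oq q) :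
    rmul a c (seqMul a x y) = seqMul a x (rmul a c y) := by
  have hq := qc_ne_zero q
  have h6 := Complex.I_sq
  have aux : ∀ (u v : Oq q), (∀ y, rmul a u (seqMul a x y) = seqMul a x (rmul a u y)) →
    (∀ y, rmul a v (seqMul a x y) = seqMul a x (rmul a v y)) →
    (∀ y, rmul a (u * v) (seqMul a x y) = seqMul a x (rmul a (u * v) y)) := by
    intro u v h h' y
    rw [rmul_mul, h, h', rmul_mul]
  revert y
  refine induction (P := fun c => ∀ y, rmul a c (seqMul a x y) = seqMul a x (rmul a c y))
    ?_ ?_ ?_ ?_ ?_ ?_ ?_ aux c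
  · intro y; ext m
    simp only [seqMul, rmul_apply_α, rmul_add, rmul_smul, sub_eq_add_neg, ← neg_smul, rmul_mul,
      Pi.add_apply, Pi.smul_apply, rmul_apply_γs, wt_eq]
    have h0 := qpw_ne_zero q a m
    have h1 := qpw_sq_ne q a m
    generalize qpw q a m = z at *
    match_scalars <;> field_simp <;> ring_nf <;> (try simp only [h6]) <;> (try ring_nf)
  · intro y; ext m
    simp only [seqMul, rmul_apply_αs, rmul_add, rmul_smul, sub_eq_add_neg, ← neg_smul, rmul_mul,
      Pi.add_apply, Pi.smul_apply, rmul_apply_γ, wt_eq]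
    have h0 := qpw_ne_zero q a m
    have h1 := qpw_sq_ne q a m
    generalize qpw q a m = z at *
    match_scalars <;> field_simp <;> ring_nf <;> (try simp only [h6]) <;> (try ring_nf)
  · intro y; ext m
    simp only [seqMul, rmul_apply_γ, rmul_add, rmul_smul, sub_eq_add_neg, ← neg_smul, rmul_mul,
      Pi.add_apply, Pi.smul_apply, rmul_apply_αs, wt_eq]
    have h0 := qpw_ne_zero q a m
    have h1 := qpw_sq_ne q a m
    generalize qpw q a m = z at *
    match_scalars <;> field_simp <;> ring_nf <;> (try simp only [h6]) <;> (try ring_nf)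
  · intro y; ext m
    simp only [seqMul, rmul_apply_γs, rmul_add, rmul_smul, sub_eq_add_neg, ← neg_smul, rmul_mul,
      Pi.add_apply, Pi.smul_apply, rmul_apply_α, wt_eq]
    have h0 := qpw_ne_zero q a m
    have h1 := qpw_sq_ne q a m
    generalize qpw q a m = z at *
    match_scalars <;> field_simp <;> ring_nf <;> (try simp only [h6]) <;> (try ring_nf)
  · intro y; simp
  · intro s c h y; ext m; rw [rmul_smul, h]; simp [seqMul, rmul_smul]
  · intro c d h h' y; ext m; rw [rmul_add, h, h']; simp [seqMul, rmul_add]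

theorem seqMul_assoc (x y z : ℤ → Oq q) :
    seqMul a (seqMul a x y) z = seqMul a x (seqMul a y z) := by
  ext m
  change rmul a (z m) (seqMul a x y) m = _
  rw [rmul_seqMul]; rfl

/-- The smash product: finite formal sums `∑ₙ xₙ Φₙ` with `xₙ ∈ O_q(SU(2))`, multiplied by the
rules `Φₙ Φₘ = δₙₘ Φₙ` and `Φₙ c = c₍₁₎ (Φₙ ◁ c₍₂₎)`. -/
def Smash (q : Param) (_a : ℝ) : Type := ℤ →₀ Oq q

namespace Smash

instance : AddCommGroup (Smash q a) := inferInstanceAs (AddCommGroup (ℤ →₀ Oq q))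
instance : Module ℂ (Smash q a) := inferInstanceAs (Module ℂ (ℤ →₀ Oq q))
instance : FunLike (Smash q a) ℤ (Oq q) := inferInstanceAs (FunLike (ℤ →₀ Oq q) ℤ (Oq q))

@[ext] theorem ext {x y : Smash q a} (h : ∀ m, x m = y m) : x = y := Finsupp.ext h

@[simp] theorem add_apply (x y : Smash q a) (m : ℤ) : (x + y) m = x m + y m := rfl
@[simp] theorem zero_apply (m : ℤ) : (0 : Smash q a) m = 0 := rfl
@[simp] theorem smul_apply (s : ℂ) (x : Smash q a) (m : ℤ) : (s • x) m = s • x m := rfl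
theorem coe_add (x y : Smash q a) : ⇑(x + y) = ⇑x + ⇑y := rfl
theorem coe_smul (s : ℂ) (x : Smash q a) : ⇑(s • x) = s • ⇑x := rfl
theorem coe_zero : ⇑(0 : Smash q a) = 0 := rfl

theorem finite_support (x : Smash q a) : (Function.support x).Finite :=
  Finsupp.hasFiniteSupport (x : ℤ →₀ Oq q)

def ofFun (x : ℤ → Oq q) (h : (Function.support x).Finite) : Smash q a :=
  (Finsupp.ofSupportFinite x h : ℤ →₀ Oq q)
@[simp] theorem coe_ofFun (x : ℤ → Oq q) (h : (Function.support x).Finite) :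
    ⇑(ofFun x h : Smash q a) = x := rfl

/-- `b Φₙ`. -/
def single (a : ℝ) (n : ℤ) (b : Oq q) : Smash q a := (Finsupp.single n b : ℤ →₀ Oq q)
@[simp] theorem single_apply (n m : ℤ) (b : Oq q) :
    (single a n b) m = if m = n then b else 0 := by
  simp only [eq_comm (a := m)]; exact Finsupp.single_apply

theorem induction_single {P : Smash q a → Prop} (h0 : P 0) (ha : ∀ x y, P x → P y → P (x + y))
    (hs : ∀ n b, P (single a n b)) (x : Smash q a) : P x :=
  Finsupp.induction_linear (motive := P) x h0 ha hs

instance : Mul (Smash q a) where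
  mul x y := ofFun (seqMul a x y) (y.finite_support.subset fun m hm => by
    intro h; apply hm; simp [seqMul, h])

theorem coe_mul (x y : Smash q a) : ⇑(x * y) = seqMul a x y := rfl
theorem mul_apply (x y : Smash q a) (m : ℤ) : (x * y) m = rmul a (y m) x m := rfl

instance : NonUnitalRing (Smash q a) where
  left_distrib x y z := by ext m; simp [mul_apply, rmul_add]
  right_distrib x y z := by ext m; simp [mul_apply, coe_add]
  zero_mul x := by ext m; simp [mul_apply, coe_zero]
  mul_zero x := by ext m; simp [mul_apply]
  mul_assoc x y z := by ext m; rw [coe_mul, coe_mul, coe_mul, coe_mul, seqMul_assoc]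

instance : IsScalarTower ℂ (Smash q a) (Smash q a) :=
  ⟨fun s x y => by ext m; simp [mul_apply, coe_smul]⟩
instance : SMulCommClass ℂ (Smash q a) (Smash q a) :=
  ⟨fun s x y => by ext m; simp [mul_apply, rmul_smul]⟩

/-- Right multiplication by `c ∈ O_q(SU(2))`. -/
def mulRight (c : Oq q) : Smash q a →ₗ[ℂ] Smash q a where
  toFun x := ofFun (rmul a c x) (rmul_finite a c x.finite_support)
  map_add' x y := by ext m; simp [coe_add]
  map_smul' s x := by ext m; simp [coe_smul]
@[simp] theorem coe_mulRight (c : Oq q) (x : Smash q a) : ⇑(mulRight c x) = rmul a c x := rfl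

/-- Left multiplication by `c ∈ O_q(SU(2))`. -/
def mulLeft (c : Oq q) : Smash q a →ₗ[ℂ] Smash q a where
  toFun x := ofFun (fun m => c * x m) (x.finite_support.subset fun m hm => by
    intro h; apply hm; simp [h])
  map_add' x y := by ext m; simp [mul_add]
  map_smul' s x := by ext m; simp
@[simp] theorem mulLeft_apply (c : Oq q) (x : Smash q a) (m : ℤ) : mulLeft c x m = c * x m := rfl

theorem mulRight_mul (c d : Oq q) (x : Smash q a) :
    mulRight (c * d) x = mulRight d (mulRight c x) := by
  ext m; simp [rmul_mul]
theorem mulRight_add (c d : Oq q) (x : Smash q a) :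
    mulRight (c + d) x = mulRight c x + mulRight d x := by
  ext m; simp [rmul_add]
theorem mulRight_smul (s : ℂ) (c : Oq q) (x : Smash q a) :
    mulRight (s • c) x = s • mulRight c x := by
  ext m; simp [rmul_smul]
@[simp] theorem mulRight_one (x : Smash q a) : mulRight 1 x = x := by ext m; simp
@[simp] theorem mulRight_zero (x : Smash q a) : mulRight 0 x = 0 := by ext m; simp
theorem mulRight_mulLeft (c d : Oq q) (x : Smash q a) :
    mulRight c (mulLeft d x) = mulLeft d (mulRight c x) := by
  ext m; exact congrFun (rmul_left d c x) m
theorem mul_mulRight (c : Oq q) (x y : Smash q a) : mulRight c (x * y) = x * mulRight c y := by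
  ext m; exact congrFun (rmul_seqMul c x y) m
theorem mulLeft_mul (c : Oq q) (x y : Smash q a) : mulLeft c (x * y) = mulLeft c x * y := by
  ext m; exact (congrFun (rmul_left c (y m) x) m).symm
theorem mul_single (n : ℤ) (c : Oq q) (x : Smash q a) :
    x * single a n c = single a n (mulRight c x n) := by
  ext m
  rw [mul_apply, single_apply, single_apply]
  split_ifs with h
  · rw [h]; rfl
  · simp
theorem mulRight_mul_eq (c : Oq q) (x y : Smash q a) : mulRight c x * y = x * mulLeft c y := by
  ext m; rw [mul_apply, mul_apply, mulLeft_apply, rmul_mul]; rfl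
@[simp] theorem single_zero (n : ℤ) : single a n (0 : Oq q) = 0 := by ext m; simp
theorem single_eq (n : ℤ) (c : Oq q) : single a n c = mulLeft c (single a n 1) := by
  ext m; simp

/-- The involution as an additive map: `b Φₙ ↦ Φₙ b^*`. -/
def starAdd (q : Param) (a : ℝ) : Smash q a →+ Smash q a :=
  Finsupp.liftAddHom (M := Oq q) fun n =>
    { toFun := fun b => mulRight (star b) (single a n 1)
      map_zero' := by simp
      map_add' := fun b c => by simp [mulRight_add] }

theorem starAdd_single (n : ℤ) (b : Oq q) :
    starAdd q a (single a n b) = mulRight (star b) (single a n 1) :=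
  Finsupp.liftAddHom_apply_single _ _ _

theorem starAdd_smul (s : ℂ) (x : Smash q a) : starAdd q a (s • x) = conj s • starAdd q a x := by
  induction x using induction_single with
  | h0 => simp
  | ha x y hx hy => simp only [smul_add, map_add, hx, hy]
  | hs n b =>
    have : s • single a n b = single a n (s • b) := Finsupp.smul_single _ _ _
    rw [this, starAdd_single, starAdd_single, star_smul, mulRight_smul]; rfl

theorem mulRight_single (c : Oq q) (n : ℤ) (b : Oq q) :
    mulRight c (single a n b) = mulLeft b (mulRight c (single a n 1)) := by
  rw [single_eq, mulRight_mulLeft]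

theorem mulRight_single_α (n : ℤ) : mulRight (α q) (single a n 1) =
    single a (n - 1) ((qpw q a (n - 1) / wt q a (n - 1)) • α q
      + (qc q * Complex.I / wt q a (n - 1)) • γs q) +
    single a (n + 1) (((qpw q a (n + 1))⁻¹ / wt q a (n + 1)) • α q
      - (qc q * Complex.I / wt q a (n + 1)) • γs q) := by
  ext m
  simp only [coe_mulRight, rmul_apply_α, single_apply, add_apply]
  split_ifs <;> first
    | (exfalso; omega)
    | (simp only [zero_mul, smul_zero, sub_zero, add_zero]; done)
    | (have hm : m = n - 1 := by omega
       subst hm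
       simp only [zero_mul, one_mul, smul_zero, add_zero, zero_add]; try module)
    | (have hm : m = n + 1 := by omega
       subst hm
       simp only [zero_mul, one_mul, smul_zero, add_zero, zero_add]; try module)

theorem mulRight_single_αs (n : ℤ) : mulRight (αs q) (single a n 1) =
    single a (n - 1) (((qpw q a (n - 1))⁻¹ / wt q a (n - 1)) • αs q
      + (Complex.I / wt q a (n - 1)) • γ q) +
    single a (n + 1) ((qpw q a (n + 1) / wt q a (n + 1)) • αs q
      - (Complex.I / wt q a (n + 1)) • γ q) := by
  have hq := qc_ne_zero q
  ext m
  simp only [coe_mulRight, rmul_apply_αs, single_apply, add_apply]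
  split_ifs <;> first
    | (exfalso; omega)
    | (simp only [zero_mul, smul_zero, sub_zero, add_zero]; done)
    | (have hm : m = n - 1 := by omega
       subst hm
       simp only [zero_mul, one_mul, smul_zero, add_zero, zero_add]
       match_scalars <;> field_simp)
    | (have hm : m = n + 1 := by omega
       subst hm
       simp only [zero_mul, one_mul, smul_zero, add_zero, zero_add]
       match_scalars <;> field_simp)

theorem mulRight_single_γ (n : ℤ) : mulRight (γ q) (single a n 1) =
    single a (n - 1) ((qpw q a (n - 1) / wt q a (n - 1)) • γ q
      - (Complex.I / wt q a (n - 1)) • αs q) +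
    single a (n + 1) (((qpw q a (n + 1))⁻¹ / wt q a (n + 1)) • γ q
      + (Complex.I / wt q a (n + 1)) • αs q) := by
  ext m
  simp only [coe_mulRight, rmul_apply_γ, single_apply, add_apply]
  split_ifs <;> first
    | (exfalso; omega)
    | (simp only [zero_mul, smul_zero, sub_zero, add_zero]; done)
    | (have hm : m = n - 1 := by omega
       subst hm
       simp only [zero_mul, one_mul, smul_zero, add_zero, zero_add]; try module)
    | (have hm : m = n + 1 := by omega
       subst hm
       simp only [zero_mul, one_mul, smul_zero, add_zero, zero_add]; try module)

theorem mulRight_single_γs (n : ℤ) : mulRight (γs q) (single a n 1) =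
    single a (n - 1) (((qpw q a (n - 1))⁻¹ / wt q a (n - 1)) • γs q
      - ((qc q)⁻¹ * Complex.I / wt q a (n - 1)) • α q) +
    single a (n + 1) ((qpw q a (n + 1) / wt q a (n + 1)) • γs q
      + ((qc q)⁻¹ * Complex.I / wt q a (n + 1)) • α q) := by
  ext m
  simp only [coe_mulRight, rmul_apply_γs, single_apply, add_apply]
  split_ifs <;> first
    | (exfalso; omega)
    | (simp only [zero_mul, smul_zero, sub_zero, add_zero]; done)
    | (have hm : m = n - 1 := by omega
       subst hm
       simp only [zero_mul, one_mul, smul_zero, add_zero, zero_add]; try module)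
    | (have hm : m = n + 1 := by omega
       subst hm
       simp only [zero_mul, one_mul, smul_zero, add_zero, zero_add]; try module)

theorem conj_qpw (q : Param) (a : ℝ) (m : ℤ) : conj (qpw q a m) = qpw q a m := by
  simp [qpw]
theorem conj_wt (q : Param) (a : ℝ) (m : ℤ) : conj (wt q a m) = wt q a m := by
  simp [wt]

theorem single_smul (s : ℂ) (n : ℤ) (b : Oq q) : single a n (s • b) = s • single a n b := by
  ext m; simp

theorem single_add (n : ℤ) (b c : Oq q) :
    single a n (b + c) = single a n b + single a n c := by
  ext m; simp only [single_apply, add_apply]; split_ifs <;> simp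
theorem single_sub (n : ℤ) (b c : Oq q) :
    single a n (b - c) = single a n b - single a n c := by
  rw [sub_eq_add_neg, single_add, ← neg_one_smul ℂ c, single_smul, neg_one_smul, sub_eq_add_neg]

theorem starAdd_mulLeft (b : Oq q) (x : Smash q a) :
    starAdd q a (mulLeft b x) = mulRight (star b) (starAdd q a x) := by
  induction x using induction_single with
  | h0 => simp
  | ha x y hx hy => simp only [map_add, hx, hy]
  | hs n c =>
    have : mulLeft b (single a n c) = single a n (b * c) := by
      ext m; simp only [mulLeft_apply, single_apply]; split_ifs <;> simp
    rw [this, starAdd_single, starAdd_single, star_mul, mulRight_mul]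

theorem starAdd_mulRight_base {u : Oq q}
    (h : ∀ n, starAdd q a (mulRight u (single a n 1)) = single a n (star u)) (x : Smash q a) :
    starAdd q a (mulRight u x) = mulLeft (star u) (starAdd q a x) := by
  induction x using induction_single with
  | h0 => simp
  | ha x y hx hy => simp only [map_add, hx, hy]
  | hs n c =>
    rw [mulRight_single, starAdd_mulLeft, h, single_eq, mulRight_mulLeft, starAdd_single]

theorem starAdd_mulRight (u : Oq q) (x : Smash q a) :
    starAdd q a (mulRight u x) = mulLeft (star u) (starAdd q a x) := by
  revert x
  have hc := conj_qc q
  have hq := qc_ne_zero q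
  have h6 := Complex.I_sq
  refine induction (P := fun u => ∀ x : Smash q a,
    starAdd q a (mulRight u x) = mulLeft (star u) (starAdd q a x)) ?_ ?_ ?_ ?_ ?_ ?_ ?_ ?_ u
  · refine starAdd_mulRight_base fun n => ?_
    rw [mulRight_single_α]
    simp only [map_add, map_sub, starAdd_single, starAdd_smul, single_add, single_sub, single_smul,
      star_α, star_αs, star_γ, star_γs, mulRight_single_α, mulRight_single_αs, mulRight_single_γ,
      mulRight_single_γs, map_div₀, map_mul, map_inv₀, conj_qpw, conj_wt, Complex.conj_I, hc,
      sub_add_cancel, add_sub_cancel_right, wt_eq, qpw_succ, qpw_pred]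
    have h0 := qpw_ne_zero q a n
    have h1 := qpw_sq_ne q a n
    have h2 := qpw_sq_ne q a (n + 1)
    have h3 := qpw_sq_ne q a (n - 1)
    rw [qpw_succ] at h2; rw [qpw_pred] at h3
    generalize qpw q a n = z at *; generalize qc q = w at *
    have h4 : z ^ 2 + w ^ 2 ≠ 0 := by
      intro h; apply h3; field_simp; rw [h, mul_zero]
    have h5 : w ^ 2 * z ^ 2 + 1 ≠ 0 := by rwa [← mul_pow]
    have h7 : z ^ 2 * w ^ 2 + 1 ≠ 0 := by rwa [mul_comm]
    have h8 : w ^ 2 + z ^ 2 ≠ 0 := by rwa [add_comm]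
    match_scalars <;> field_simp <;> ring_nf <;> (try simp only [h6]) <;> (try ring_nf)
  · refine starAdd_mulRight_base fun n => ?_
    rw [mulRight_single_αs]
    simp only [map_add, map_sub, starAdd_single, starAdd_smul, single_add, single_sub, single_smul,
      star_α, star_αs, star_γ, star_γs, mulRight_single_α, mulRight_single_αs, mulRight_single_γ,
      mulRight_single_γs, map_div₀, map_mul, map_inv₀, conj_qpw, conj_wt, Complex.conj_I, hc,
      sub_add_cancel, add_sub_cancel_right, wt_eq, qpw_succ, qpw_pred]
    have h0 := qpw_ne_zero q a n
    have h1 := qpw_sq_ne q a n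
    have h2 := qpw_sq_ne q a (n + 1)
    have h3 := qpw_sq_ne q a (n - 1)
    rw [qpw_succ] at h2; rw [qpw_pred] at h3
    generalize qpw q a n = z at *; generalize qc q = w at *
    have h4 : z ^ 2 + w ^ 2 ≠ 0 := by
      intro h; apply h3; field_simp; rw [h, mul_zero]
    have h5 : w ^ 2 * z ^ 2 + 1 ≠ 0 := by rwa [← mul_pow]
    have h7 : z ^ 2 * w ^ 2 + 1 ≠ 0 := by rwa [mul_comm]
    have h8 : w ^ 2 + z ^ 2 ≠ 0 := by rwa [add_comm]
    match_scalars <;> field_simp <;> ring_nf <;> (try simp only [h6]) <;> (try ring_nf)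
  · refine starAdd_mulRight_base fun n => ?_
    rw [mulRight_single_γ]
    simp only [map_add, map_sub, starAdd_single, starAdd_smul, single_add, single_sub, single_smul,
      star_α, star_αs, star_γ, star_γs, mulRight_single_α, mulRight_single_αs, mulRight_single_γ,
      mulRight_single_γs, map_div₀, map_mul, map_inv₀, conj_qpw, conj_wt, Complex.conj_I, hc,
      sub_add_cancel, add_sub_cancel_right, wt_eq, qpw_succ, qpw_pred]
    have h0 := qpw_ne_zero q a n
    have h1 := qpw_sq_ne q a n
    have h2 := qpw_sq_ne q a (n + 1)
    have h3 := qpw_sq_ne q a (n - 1)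
    rw [qpw_succ] at h2; rw [qpw_pred] at h3
    generalize qpw q a n = z at *; generalize qc q = w at *
    have h4 : z ^ 2 + w ^ 2 ≠ 0 := by
      intro h; apply h3; field_simp; rw [h, mul_zero]
    have h5 : w ^ 2 * z ^ 2 + 1 ≠ 0 := by rwa [← mul_pow]
    have h7 : z ^ 2 * w ^ 2 + 1 ≠ 0 := by rwa [mul_comm]
    have h8 : w ^ 2 + z ^ 2 ≠ 0 := by rwa [add_comm]
    match_scalars <;> field_simp <;> ring_nf <;> (try simp only [h6]) <;> (try ring_nf)
  · refine starAdd_mulRight_base fun n => ?_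
    rw [mulRight_single_γs]
    simp only [map_add, map_sub, starAdd_single, starAdd_smul, single_add, single_sub, single_smul,
      star_α, star_αs, star_γ, star_γs, mulRight_single_α, mulRight_single_αs, mulRight_single_γ,
      mulRight_single_γs, map_div₀, map_mul, map_inv₀, conj_qpw, conj_wt, Complex.conj_I, hc,
      sub_add_cancel, add_sub_cancel_right, wt_eq, qpw_succ, qpw_pred]
    have h0 := qpw_ne_zero q a n
    have h1 := qpw_sq_ne q a n
    have h2 := qpw_sq_ne q a (n + 1)
    have h3 := qpw_sq_ne q a (n - 1)
    rw [qpw_succ] at h2; rw [qpw_pred] at h3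
    generalize qpw q a n = z at *; generalize qc q = w at *
    have h4 : z ^ 2 + w ^ 2 ≠ 0 := by
      intro h; apply h3; field_simp; rw [h, mul_zero]
    have h5 : w ^ 2 * z ^ 2 + 1 ≠ 0 := by rwa [← mul_pow]
    have h7 : z ^ 2 * w ^ 2 + 1 ≠ 0 := by rwa [mul_comm]
    have h8 : w ^ 2 + z ^ 2 ≠ 0 := by rwa [add_comm]
    match_scalars <;> field_simp <;> ring_nf <;> (try simp only [h6]) <;> (try ring_nf)
  · intro x; ext m; simp
  · intro s c h x; ext m; rw [mulRight_smul, starAdd_smul, h]; simp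
  · intro c d h h' x; ext m; rw [mulRight_add, map_add, h, h']; simp [add_mul]
  · intro c d h h' x; ext m; rw [mulRight_mul, h', h]; simp [mul_assoc]

theorem starAdd_starAdd (x : Smash q a) : starAdd q a (starAdd q a x) = x := by
  induction x using induction_single with
  | h0 => simp
  | ha x y hx hy => simp only [map_add, hx, hy]
  | hs n c =>
    rw [starAdd_single, starAdd_mulRight, starAdd_single]
    ext m; simp

theorem single_mul_starAdd (n : ℤ) (x : Smash q a) :
    single a n 1 * starAdd q a x = mulRight (star (x n)) (single a n 1) := by
  induction x using induction_single with
  | h0 => simp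
  | ha x y hx hy =>
    simp only [map_add, hx, hy, mul_add, add_apply, star_add, mulRight_add]
  | hs m c =>
    rw [starAdd_single, ← mul_mulRight, mul_single, single_apply]
    by_cases h : n = m
    · subst h; simp
    · have h' : ¬ m = n := fun e => h e.symm
      simp [h, h']

theorem starAdd_mul (x y : Smash q a) :
    starAdd q a (x * y) = starAdd q a y * starAdd q a x := by
  induction y using induction_single with
  | h0 => simp
  | ha y z hy hz => simp only [mul_add, add_mul, map_add, hy, hz]
  | hs n c =>
    rw [mul_single, starAdd_single, starAdd_single, ← single_mul_starAdd, starAdd_mulRight,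
      mulRight_mul_eq]

instance : Star (Smash q a) := ⟨starAdd q a⟩

instance : StarRing (Smash q a) where
  star_involutive := starAdd_starAdd
  star_mul := starAdd_mul
  star_add := map_add _

instance : StarModule ℂ (Smash q a) := ⟨starAdd_smul⟩

theorem star_def (x : Smash q a) : star x = starAdd q a x := rfl
theorem star_single (n : ℤ) (b : Oq q) :
    star (single a n b) = mulRight (star b) (single a n 1) := starAdd_single n b

end Smash

end Oq

end

section

namespace Oq

variable {q : Param}

/-! ### The Haar state of `SU_q(2)` -/

/-- Finitely supported vectors with basis `e_{n,k}`, `n ∈ ℕ`, `k ∈ ℤ`. -/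
abbrev Vec : Type := ℕ × ℤ →₀ ℂ

/-- The basis vectors. -/
def bv (n : ℕ) (k : ℤ) : Vec := Finsupp.single (n, k) 1

/-- The weighted shift `e_p ↦ c(p) e_{σ(p)}`. -/
def wop (c : ℕ × ℤ → ℂ) (σ : ℕ × ℤ → ℕ × ℤ) : Module.End ℂ Vec :=
  Finsupp.linearCombination ℂ fun p => c p • Finsupp.single (σ p) 1

@[simp] theorem wop_bv (c : ℕ × ℤ → ℂ) (σ : ℕ × ℤ → ℕ × ℤ) (n : ℕ) (k : ℤ) :
    wop c σ (bv n k) = c (n, k) • bv (σ (n, k)).1 (σ (n, k)).2 := by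
  simp [wop, bv]

theorem end_ext {f g : Module.End ℂ Vec} (h : ∀ n k, f (bv n k) = g (bv n k)) : f = g :=
  Finsupp.lhom_ext' fun p => LinearMap.ext_ring (h p.1 p.2)

/-- `√(1 - q^{2n})`. -/
def sq2 (q : Param) (n : ℕ) : ℂ := ((Real.sqrt (1 - (q : ℝ) ^ (2 * n)) : ℝ) : ℂ)

theorem sq2_mul_self (q : Param) (n : ℕ) : sq2 q n * sq2 q n = 1 - qc q ^ (2 * n) := by
  have : (0 : ℝ) ≤ 1 - (q : ℝ) ^ (2 * n) := by
    have := pow_le_one₀ (n := 2 * n) q.2.1.le q.2.2.le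
    linarith
  rw [sq2, ← Complex.ofReal_mul, Real.mul_self_sqrt this, qc]; push_cast; rfl
@[simp] theorem sq2_zero (q : Param) : sq2 q 0 = 0 := by simp [sq2]
theorem conj_sq2 (q : Param) (n : ℕ) : conj (sq2 q n) = sq2 q n := by simp [sq2]
theorem norm_sq2_le (q : Param) (n : ℕ) : ‖sq2 q n‖ ≤ 1 := by
  have h := pow_nonneg (n := 2 * n) q.2.1.le
  rw [sq2, Complex.norm_real, Real.norm_of_nonneg (Real.sqrt_nonneg _)]
  exact Real.sqrt_le_one.2 (by linarith)

/-- The standard faithful `*`-representation of `O_q(SU(2))`: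
`α e_{n,k} = √(1 - q^{2n}) e_{n-1,k}`, `γ e_{n,k} = q^n e_{n,k+1}`. -/
def rep (q : Param) : Oq q →ₐ[ℂ] Module.End ℂ Vec :=
  lift (x := wop (fun p => sq2 q p.1) (fun p => (p.1 - 1, p.2)))
    (xs := wop (fun p => sq2 q (p.1 + 1)) (fun p => (p.1 + 1, p.2)))
    (y := wop (fun p => qc q ^ p.1) (fun p => (p.1, p.2 + 1)))
    (ys := wop (fun p => qc q ^ p.1) (fun p => (p.1, p.2 - 1))) <| by
  constructor <;> apply end_ext <;> intro n k <;> rcases n with _ | n <;>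
    simp [smul_smul, sq2_mul_self] <;> module

theorem rep_α (n : ℕ) (k : ℤ) : rep q (α q) (bv n k) = sq2 q n • bv (n - 1) k := by simp [rep]
theorem rep_αs (n : ℕ) (k : ℤ) : rep q (αs q) (bv n k) = sq2 q (n + 1) • bv (n + 1) k := by
  simp [rep]
theorem rep_γ (n : ℕ) (k : ℤ) : rep q (γ q) (bv n k) = qc q ^ n • bv n (k + 1) := by simp [rep]
theorem rep_γs (n : ℕ) (k : ℤ) : rep q (γs q) (bv n k) = qc q ^ n • bv n (k - 1) := by simp [rep]

/-- The standard inner product. -/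
def ip (v w : Vec) : ℂ := v.sum fun p c => conj c * w p

theorem ip_add_left (u v w : Vec) : ip (u + v) w = ip u w + ip v w :=
  Finsupp.sum_add_index' (by simp) (by intros; simp [add_mul])
theorem ip_smul_left (c : ℂ) (v w : Vec) : ip (c • v) w = conj c * ip v w := by
  rw [ip, Finsupp.sum_smul_index' (by simp), ip, Finsupp.mul_sum]
  simp [mul_assoc]
theorem ip_add_right (u v w : Vec) : ip u (v + w) = ip u v + ip u w := by
  simp [ip, mul_add, Finsupp.sum_add]
theorem ip_smul_right (c : ℂ) (v w : Vec) : ip v (c • w) = c * ip v w := by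
  rw [ip, ip, Finsupp.mul_sum]
  simp only [Finsupp.smul_apply, smul_eq_mul]; congr 1; ext p d; ring
@[simp] theorem ip_bv (n : ℕ) (k : ℤ) (w : Vec) : ip (bv n k) w = w (n, k) := by
  rw [ip, bv, Finsupp.sum_single_index] <;> simp
@[simp] theorem ip_zero_left (w : Vec) : ip 0 w = 0 := by simp [ip]
@[simp] theorem ip_zero_right (w : Vec) : ip w 0 = 0 := by simp [ip]

theorem vec_induction {P : Vec → Prop} (h0 : P 0) (ha : ∀ v w, P v → P w → P (v + w))
    (hs : ∀ (c : ℂ) n k, P (c • bv n k)) (v : Vec) : P v := by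
  refine Finsupp.induction_linear v h0 ha fun p c => ?_
  have := hs c p.1 p.2
  rwa [bv, Finsupp.smul_single, smul_eq_mul, mul_one] at this

theorem ip_self_re (v : Vec) : ip v v = ((∑ p ∈ v.support, ‖v p‖ ^ 2 : ℝ) : ℂ) := by
  rw [ip, Finsupp.sum]; push_cast
  exact Finset.sum_congr rfl fun p _ => by rw [Complex.conj_mul']

theorem ip_self_nonneg (v : Vec) : 0 ≤ (ip v v).re := by
  rw [ip_self_re, Complex.ofReal_re]; positivity
theorem coe_ip_self (v : Vec) : (((ip v v).re : ℝ) : ℂ) = ip v v := by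
  rw [ip_self_re, Complex.ofReal_re]
theorem norm_apply_sq_le (v : Vec) (p : ℕ × ℤ) : ‖v p‖ ^ 2 ≤ (ip v v).re := by
  rw [ip_self_re, Complex.ofReal_re]
  by_cases h : p ∈ v.support
  · exact Finset.single_le_sum (f := fun p => ‖v p‖ ^ 2) (fun _ _ => by positivity) h
  · rw [Finsupp.notMem_support_iff.1 h]; simp only [norm_zero]; exact (by norm_num : (0 : ℝ) ^ 2 = 0).le.trans (Finset.sum_nonneg fun _ _ => by positivity)

theorem ip_adj_of {f g : Module.End ℂ Vec}
    (h : ∀ n k n' k', ip (f (bv n k)) (bv n' k') = ip (bv n k) (g (bv n' k'))) (v w : Vec) :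
    ip (f v) w = ip v (g w) := by
  induction v using vec_induction with
  | h0 => simp
  | ha u v hu hv => rw [map_add, ip_add_left, ip_add_left, hu, hv]
  | hs c n k =>
    rw [map_smul, ip_smul_left, ip_smul_left]
    congr 1
    induction w using vec_induction with
    | h0 => simp
    | ha u v hu hv => rw [map_add, ip_add_right, ip_add_right, hu, hv]
    | hs c n k => rw [map_smul, ip_smul_right, ip_smul_right, h]

theorem bv_apply (n n' : ℕ) (k k' : ℤ) : bv n k (n', k') = if n = n' ∧ k = k' then 1 else 0 := by
  rw [bv, Finsupp.single_apply]; simp [Prod.ext_iff]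

theorem ip_rep (x : Oq q) (v w : Vec) : ip (rep q x v) w = ip v (rep q (star x) w) := by
  have hc := conj_qc q
  revert v w
  refine induction (P := fun x => ∀ v w, ip (rep q x v) w = ip v (rep q (star x) w))
    ?_ ?_ ?_ ?_ ?_ ?_ ?_ ?_ x
  · refine ip_adj_of fun n k n' k' => ?_
    rw [star_α, rep_α, rep_αs, ip_smul_left, ip_bv, ip_bv, conj_sq2, Finsupp.smul_apply, bv_apply,
      bv_apply]
    rcases n with _ | n
    · simp
    · by_cases h : n = n' ∧ k = k'
      · obtain ⟨rfl, rfl⟩ := h; simp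
      · have h' : ¬ (n' = n ∧ k' = k) := fun e => h ⟨e.1.symm, e.2.symm⟩
        simp [h, h']
  · refine ip_adj_of fun n k n' k' => ?_
    rw [star_αs, rep_α, rep_αs, ip_smul_left, ip_bv, ip_bv, conj_sq2, Finsupp.smul_apply, bv_apply,
      bv_apply]
    rcases n' with _ | n'
    · simp
    · by_cases h : n = n' ∧ k = k'
      · obtain ⟨rfl, rfl⟩ := h; simp
      · have h' : ¬ (n' = n ∧ k' = k) := fun e => h ⟨e.1.symm, e.2.symm⟩
        simp [h, h']
  · refine ip_adj_of fun n k n' k' => ?_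
    rw [star_γ, rep_γ, rep_γs, ip_smul_left, ip_bv, ip_bv, map_pow, hc, Finsupp.smul_apply,
      bv_apply, bv_apply]
    by_cases h : n' = n ∧ k' = k + 1
    · obtain ⟨rfl, rfl⟩ := h; simp
    · have h' : ¬ (n' = n ∧ k' - 1 = k) := fun e => h ⟨e.1, by omega⟩
      rw [if_neg h, if_neg h']; simp
  · refine ip_adj_of fun n k n' k' => ?_
    rw [star_γs, rep_γ, rep_γs, ip_smul_left, ip_bv, ip_bv, map_pow, hc, Finsupp.smul_apply,
      bv_apply, bv_apply]
    by_cases h : n' = n ∧ k' = k - 1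
    · obtain ⟨rfl, rfl⟩ := h; simp
    · have h' : ¬ (n' = n ∧ k' + 1 = k) := fun e => h ⟨e.1, by omega⟩
      rw [if_neg h, if_neg h']; simp
  · intro v w; simp
  · intro c x h v w
    rw [star_smul, map_smul, map_smul, LinearMap.smul_apply, LinearMap.smul_apply, ip_smul_left,
      ip_smul_right, h]; rfl
  · intro x y h h' v w
    rw [star_add, map_add, map_add, LinearMap.add_apply, LinearMap.add_apply, ip_add_left,
      ip_add_right, h, h']
  · intro x y h h' v w
    rw [star_mul, map_mul, map_mul, Module.End.mul_apply, Module.End.mul_apply, h, h']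

theorem rep_bounded (x : Oq q) :
    ∃ C : ℝ, 0 ≤ C ∧ ∀ v, (ip (rep q x v) (rep q x v)).re ≤ C * (ip v v).re := by
  have e1 : ∀ v : Vec, (ip (rep q (α q) v) (rep q (α q) v)).re +
      (ip (rep q (γ q) v) (rep q (γ q) v)).re = (ip v v).re := by
    intro v
    rw [ip_rep, ip_rep, star_α, star_γ, ← Complex.add_re, ← ip_add_right, ← Module.End.mul_apply,
      ← Module.End.mul_apply, ← map_mul, ← map_mul, ← LinearMap.add_apply, ← map_add,
      (surel q).r1, map_one, Module.End.one_apply]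
  have e2 : ∀ v : Vec, (ip (rep q (αs q) v) (rep q (αs q) v)).re +
      (q : ℝ) ^ 2 * (ip (rep q (γs q) v) (rep q (γs q) v)).re = (ip v v).re := by
    intro v
    have : (q : ℝ) ^ 2 * (ip (rep q (γs q) v) (rep q (γs q) v)).re =
      (qc q ^ 2 * ip (rep q (γs q) v) (rep q (γs q) v)).re := by
      rw [qc, ← Complex.ofReal_pow, Complex.re_ofReal_mul]
    rw [this, ip_rep, ip_rep, star_αs, star_γs, ← ip_smul_right, ← Complex.add_re, ← ip_add_right,
      ← Module.End.mul_apply, ← Module.End.mul_apply, ← map_mul, ← map_mul, ← LinearMap.smul_apply,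
      ← map_smul, ← LinearMap.add_apply, ← map_add, (surel q).r2, map_one, Module.End.one_apply]
  have hq : 0 < (q : ℝ) ^ 2 := pow_pos q.2.1 2
  refine induction (P := fun x => ∃ C : ℝ, 0 ≤ C ∧
    ∀ v, (ip (rep q x v) (rep q x v)).re ≤ C * (ip v v).re) ?_ ?_ ?_ ?_ ?_ ?_ ?_ ?_ x
  · exact ⟨1, zero_le_one, fun v => by
      have := e1 v; have := ip_self_nonneg (rep q (γ q) v); linarith⟩
  · refine ⟨1, zero_le_one, fun v => ?_⟩
    have := e2 v
    have := mul_nonneg hq.le (ip_self_nonneg (rep q (γs q) v)); linarith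
  · exact ⟨1, zero_le_one, fun v => by
      have := e1 v; have := ip_self_nonneg (rep q (α q) v); linarith⟩
  · refine ⟨((q : ℝ) ^ 2)⁻¹, by positivity, fun v => ?_⟩
    have h1 := e2 v
    have h2 := ip_self_nonneg (rep q (αs q) v)
    rw [inv_mul_eq_div, le_div_iff₀ hq]; linarith
  · exact ⟨1, zero_le_one, fun v => by simp⟩
  · rintro c x ⟨C, hC, h⟩
    refine ⟨‖c‖ ^ 2 * C, by positivity, fun v => ?_⟩
    rw [map_smul, LinearMap.smul_apply, ip_smul_left, ip_smul_right, ← mul_assoc,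
      Complex.conj_mul', ← Complex.ofReal_pow, Complex.re_ofReal_mul, mul_assoc]
    exact mul_le_mul_of_nonneg_left (h v) (by positivity)
  · rintro x y ⟨C, hC, h⟩ ⟨C', hC', h'⟩
    refine ⟨2 * C + 2 * C', by positivity, fun v => ?_⟩
    have par : ∀ u w : Vec, (ip (u + w) (u + w)).re ≤ 2 * (ip u u).re + 2 * (ip w w).re := by
      intro u w
      have h0 := ip_self_nonneg (u + (-1 : ℂ) • w)
      simp only [ip_add_left, ip_add_right, ip_smul_left, ip_smul_right, Complex.add_re] at h0 ⊢
      simp at h0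
      linarith
    rw [map_add, LinearMap.add_apply]
    have := par (rep q x v) (rep q y v)
    have := h v; have := h' v
    nlinarith
  · rintro x y ⟨C, hC, h⟩ ⟨C', hC', h'⟩
    refine ⟨C * C', by positivity, fun v => ?_⟩
    rw [map_mul, Module.End.mul_apply, mul_assoc]
    exact (h _).trans (mul_le_mul_of_nonneg_left (h' v) hC)

/-- The matrix coefficients of `x` in the standard representation. -/
def mc (x : Oq q) (n' : ℕ) (k' : ℤ) (n : ℕ) (k : ℤ) : ℂ := rep q x (bv n k) (n', k')

theorem mc_bounded (x : Oq q) : ∃ C : ℝ, 0 ≤ C ∧ ∀ n' k' n k, ‖mc x n' k' n k‖ ≤ C := by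
  obtain ⟨C, hC, h⟩ := rep_bounded x
  refine ⟨Real.sqrt C, Real.sqrt_nonneg _, fun n' k' n k => ?_⟩
  apply Real.le_sqrt_of_sq_le
  refine (norm_apply_sq_le _ _).trans ((h _).trans ?_)
  rw [ip_bv, bv_apply]; simp

theorem haar_summable (x : Oq q) : Summable fun n : ℕ => qc q ^ (2 * n) * mc x n 0 n 0 := by
  obtain ⟨C, hC, h⟩ := mc_bounded x
  have hq2 : (q : ℝ) ^ 2 < 1 := pow_lt_one₀ q.2.1.le q.2.2 two_ne_zero
  refine Summable.of_norm_bounded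
    ((summable_geometric_of_lt_one (pow_nonneg q.2.1.le 2) hq2).mul_right C) fun n => ?_
  rw [norm_mul, norm_pow, qc, Complex.norm_real, Real.norm_of_nonneg q.2.1.le, pow_mul]
  exact mul_le_mul_of_nonneg_left (h _ _ _ _) (pow_nonneg (pow_nonneg q.2.1.le 2) n)

/-- The Haar state, by the formula of Woronowicz:
`Φ(x) = (1 - q²) ∑ₙ q^{2n} ⟨e_{n,0}, x e_{n,0}⟩`. -/
def haar (q : Param) : Oq q →ₗ[ℂ] ℂ where
  toFun x := (1 - qc q ^ 2) * ∑' n : ℕ, qc q ^ (2 * n) * mc x n 0 n 0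
  map_add' x y := by
    rw [← mul_add, ← (haar_summable x).tsum_add (haar_summable y)]
    simp [mc, mul_add]
  map_smul' c x := by
    simp only [mc, map_smul, LinearMap.smul_apply, Finsupp.smul_apply, smul_eq_mul,
      RingHom.id_apply, mul_left_comm _ c, tsum_mul_left]

theorem haar_apply (x : Oq q) :
    haar q x = (1 - qc q ^ 2) * ∑' n : ℕ, qc q ^ (2 * n) * mc x n 0 n 0 := rfl

theorem haar_one : haar q 1 = 1 := by
  have hq2 : ‖qc q ^ 2‖ < 1 := by
    rw [norm_pow, qc, Complex.norm_real, Real.norm_of_nonneg q.2.1.le]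
    exact pow_lt_one₀ q.2.1.le q.2.2 two_ne_zero
  have h1 : (1 : ℂ) - qc q ^ 2 ≠ 0 := by
    intro h
    rw [← sub_eq_zero.1 h] at hq2
    simp at hq2
  have : ∀ n : ℕ, mc (1 : Oq q) n 0 n 0 = 1 := fun n => by simp [mc, bv_apply]
  simp only [haar_apply, this, mul_one, pow_mul]
  rw [tsum_geometric_of_norm_lt_one hq2, mul_inv_cancel₀ h1]

theorem one_sub_pos (q : Param) : 0 < 1 - (q : ℝ) ^ 2 := by
  have := pow_lt_one₀ q.2.1.le q.2.2 two_ne_zero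
  linarith

theorem mc_star (x : Oq q) (n' : ℕ) (k' : ℤ) (n : ℕ) (k : ℤ) :
    mc (star x) n' k' n k = conj (mc x n k n' k') := by
  have h := ip_rep x (bv n' k') (bv n k)
  rw [ip_bv] at h
  have h2 : ∀ v : Vec, ip v (bv n k) = conj (v (n, k)) := by
    intro v
    induction v using vec_induction with
    | h0 => simp
    | ha u v hu hv => rw [ip_add_left, hu, hv]; simp
    | hs c l j =>
      rw [ip_smul_left, ip_bv, bv_apply, Finsupp.smul_apply, bv_apply]
      simp only [smul_eq_mul, map_mul, eq_comm (a := n), eq_comm (a := k)]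
      split_ifs <;> simp
  rw [mc, ← h, h2]; rfl

theorem haar_star (x : Oq q) : haar q (star x) = conj (haar q x) := by
  have hc := conj_qc q
  simp only [haar_apply, mc_star, map_mul, map_sub, map_one, map_pow, hc, Complex.conj_tsum]

/-- The Haar state as a sum of vector functionals. -/
theorem haar_star_mul (x y : Oq q) : haar q (star x * y) =
    (1 - qc q ^ 2) * ∑' n : ℕ, qc q ^ (2 * n) * ip (rep q x (bv n 0)) (rep q y (bv n 0)) := by
  rw [haar_apply]
  congr 2; ext n
  rw [ip_rep, ip_bv, mc, map_mul, Module.End.mul_apply]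

theorem haar_re (x : Oq q) : haar q (star x * x) =
    (((1 - (q : ℝ) ^ 2) * ∑' n : ℕ, (q : ℝ) ^ (2 * n) *
      (ip (rep q x (bv n 0)) (rep q x (bv n 0))).re : ℝ) : ℂ) := by
  rw [haar_star_mul]
  push_cast
  simp only [coe_ip_self]; rfl

theorem haar_nonneg (x : Oq q) : 0 ≤ (haar q (star x * x)).re := by
  rw [haar_re, Complex.ofReal_re]
  exact mul_nonneg (one_sub_pos q).le (tsum_nonneg fun n =>
    mul_nonneg (pow_nonneg q.2.1.le _) (ip_self_nonneg _))

theorem haar_im (x : Oq q) : (((haar q (star x * x)).re : ℝ) : ℂ) = haar q (star x * x) := by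
  rw [haar_re, Complex.ofReal_re]

theorem haar_summable_re (x : Oq q) : Summable fun n : ℕ => (q : ℝ) ^ (2 * n) *
    (ip (rep q x (bv n 0)) (rep q x (bv n 0))).re := by
  obtain ⟨C, hC, h⟩ := rep_bounded x
  have hq2 : (q : ℝ) ^ 2 < 1 := pow_lt_one₀ q.2.1.le q.2.2 two_ne_zero
  refine Summable.of_nonneg_of_le (fun n => mul_nonneg (pow_nonneg q.2.1.le _) (ip_self_nonneg _))
    (fun n => ?_) ((summable_geometric_of_lt_one (pow_nonneg q.2.1.le 2) hq2).mul_right C)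
  rw [pow_mul]
  refine mul_le_mul_of_nonneg_left ((h _).trans ?_) (pow_nonneg (pow_nonneg q.2.1.le 2) n)
  rw [ip_bv, bv_apply]; simp

theorem haar_bounded (b : Oq q) : ∃ C : ℝ, 0 ≤ C ∧ ∀ x,
    (haar q (star (b * x) * (b * x))).re ≤ C * (haar q (star x * x)).re := by
  obtain ⟨C, hC, h⟩ := rep_bounded b
  refine ⟨C, hC, fun x => ?_⟩
  rw [haar_re, haar_re, Complex.ofReal_re, Complex.ofReal_re, mul_left_comm,
    ← tsum_mul_left (a := C)]
  refine mul_le_mul_of_nonneg_left ?_ (one_sub_pos q).le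
  refine (haar_summable_re (b * x)).tsum_le_tsum (fun n => ?_) ((haar_summable_re x).mul_left C)
  rw [map_mul, Module.End.mul_apply, mul_left_comm]
  exact mul_le_mul_of_nonneg_left (h _) (pow_nonneg q.2.1.le _)

/-! Invariance of the Haar state. -/

/-- `e_{n,k} ↦ e_{n,k+1}`. -/
def opT : Module.End ℂ Vec := wop (fun _ => 1) (fun p => (p.1, p.2 + 1))
/-- `e_{n,k} ↦ q^{k-n} e_{n,k}`. -/
def opQ (q : Param) : Module.End ℂ Vec := wop (fun p => qc q ^ (p.2 - p.1)) (fun p => p)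
/-- The operator implementing the twisted derivation `x ↦ X ▷ x`. -/
def opY (q : Param) : Module.End ℂ Vec :=
  wop (fun p => qc q / (1 - qc q ^ 2) * ((qc q ^ p.1)⁻¹ * sq2 q p.1))
    (fun p => (p.1 - 1, p.2 + 1)) +
  wop (fun p => -(1 / (1 - qc q ^ 2)) * ((qc q ^ p.1)⁻¹ * sq2 q (p.1 + 1)))
    (fun p => (p.1 + 1, p.2 - 1))

/-- `x ↦ k ▷ x`. -/
abbrev rk (x : Oq q) : Oq q := ract (kHom q).toLinearMap x

theorem qc_sq_ne (q : Param) : (1 : ℂ) - qc q ^ 2 ≠ 0 := by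
  rw [qc, ← Complex.ofReal_pow, ← Complex.ofReal_one, ← Complex.ofReal_sub, Complex.ofReal_ne_zero]
  exact (one_sub_pos q).ne'

theorem rep_opT (x : Oq q) : rep q x * opT = opT * rep q x := by
  refine induction (P := fun x => rep q x * opT = opT * rep q x) ?_ ?_ ?_ ?_ ?_ ?_ ?_ ?_ x
  · apply end_ext; intro n k; simp [opT, rep_α]
  · apply end_ext; intro n k; simp [opT, rep_αs]
  · apply end_ext; intro n k; simp [opT, rep_γ]
  · apply end_ext; intro n k; simp [opT, rep_γs]
  · simp
  · intro c x h; rw [map_smul, smul_mul_assoc, h, mul_smul_comm]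
  · intro x y h h'; rw [map_add, add_mul, h, h', mul_add]
  · intro x y h h'; rw [map_mul, mul_assoc, h', ← mul_assoc, h, mul_assoc]

theorem rep_opQ (x : Oq q) : rep q (rk x) * opQ q = opQ q * rep q x := by
  have hq := qc_ne_zero q
  refine induction (P := fun x => rep q (rk x) * opQ q = opQ q * rep q x)
    ?_ ?_ ?_ ?_ ?_ ?_ ?_ ?_ x
  · apply end_ext; intro n k
    rcases n with _ | n
    · simp [opQ, rk, ract_α, rep_α]
    · simp [opQ, rk, ract_α, rep_α, smul_smul]
      congr 1
      simp only [zpow_sub₀ hq, zpow_add₀ hq, zpow_natCast, zpow_one]; field_simp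
  · apply end_ext; intro n k; simp [opQ, rk, ract_αs, rep_αs, smul_smul]
    congr 1
    simp only [zpow_sub₀ hq, zpow_add₀ hq, zpow_natCast, zpow_one]; field_simp
  · apply end_ext; intro n k; simp [opQ, rk, ract_γ, rep_γ, smul_smul]
    congr 1
    simp only [zpow_sub₀ hq, zpow_add₀ hq, zpow_natCast, zpow_one]; field_simp
  · apply end_ext; intro n k; simp [opQ, rk, ract_γs, rep_γs, smul_smul]
    congr 1
    simp only [zpow_sub₀ hq, zpow_add₀ hq, zpow_natCast, zpow_one]; field_simp
  · simp
  · intro c x h; simp only [rk, map_smul] at *; rw [smul_mul_assoc, h, mul_smul_comm]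
  · intro x y h h'; simp only [rk, map_add] at *; rw [add_mul, h, h', mul_add]
  · intro x y h h'
    simp only [rk, ract_mul_char, map_mul] at *
    rw [mul_assoc, h', ← mul_assoc, h, mul_assoc]

theorem rep_opY (x : Oq q) :
    rep q (ract (Xfun q) x) + rep q (rk x) * opY q = opY q * rep q x := by
  have hq := qc_ne_zero q
  have hq2 := qc_sq_ne q
  refine induction (P := fun x =>
    rep q (ract (Xfun q) x) + rep q (rk x) * opY q = opY q * rep q x)
    ?_ ?_ ?_ ?_ ?_ ?_ ?_ ?_ x
  · apply end_ext; intro n k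
    rcases n with _ | n
    · simp [opY, rk, ract_α, rep_α, rep_γs, smul_smul]
      have h1 := sq2_mul_self q 1
      rw [← sub_eq_add_neg, sub_eq_zero]; congr 1
      linear_combination (norm := (field_simp; ring)) (-(qc q * (1 - qc q ^ 2)⁻¹)) * h1
    · simp [opY, rk, ract_α, rep_α, rep_γs, smul_smul]
      have h1 := sq2_mul_self q (n + 1)
      have h2 := sq2_mul_self q (n + 1 + 1)
      match_scalars
      · linear_combination (norm := (field_simp; ring)) (-(qc q * (1 - qc q ^ 2)⁻¹ * (qc q ^ (n + 1))⁻¹)) * h2 + ((1 - qc q ^ 2)⁻¹ * (qc q ^ n)⁻¹) * h1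
      · field_simp; ring
  · apply end_ext; intro n k; simp [opY, rk, ract_αs, rep_αs, rep_γ, smul_smul]
    have h1 := sq2_mul_self q (n + 1)
    have h2 := sq2_mul_self q n
    rcases n with _ | n
    · simp at h1 ⊢
      match_scalars
      · linear_combination (norm := (field_simp; ring)) (-(1 - qc q ^ 2)⁻¹) * h1
      · field_simp
    · simp only [Nat.add_sub_cancel]
      match_scalars
      · linear_combination (norm := (field_simp; ring)) ((1 - qc q ^ 2)⁻¹ * (qc q ^ (n + 1))⁻¹) * h2 - ((1 - qc q ^ 2)⁻¹ * (qc q ^ (n + 1))⁻¹) * h1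
      · field_simp; ring
  · apply end_ext; intro n k; simp [opY, rk, ract_γ, rep_γ, rep_αs, smul_smul]
    rcases n with _ | n
    · simp
      match_scalars
      field_simp; ring
    · simp only [Nat.add_sub_cancel]
      match_scalars <;> (field_simp; try ring)
  · apply end_ext; intro n k; simp [opY, rk, ract_γs, rep_γs, rep_α, smul_smul]
    rcases n with _ | n
    · simp
      match_scalars
      field_simp
    · simp only [Nat.add_sub_cancel]
      match_scalars <;> (field_simp; try ring)
  · simp
  · intro c x h
    simp only [rk, map_smul] at *; rw [smul_mul_assoc, ← smul_add, h, mul_smul_comm]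
  · intro x y h h'
    simp only [rk, map_add] at *
    rw [add_mul, mul_add, ← h, ← h']; abel
  · intro x y h h'
    rw [ractX_mul, map_add, map_mul, map_mul, rk, ract_mul_char, map_mul, map_mul, ← mul_assoc,
      ← h, add_mul, mul_assoc _ (opY q), ← h', mul_add, mul_assoc, add_assoc]

end Oq

end

section

namespace Oq

variable {q : Param}

theorem opQ_apply (v : Vec) (n : ℕ) (k : ℤ) : (opQ q v) (n, k) = qc q ^ (k - n) * v (n, k) := by
  induction v using vec_induction with
  | h0 => simp
  | ha u v hu hv => simp [hu, hv, mul_add]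
  | hs c m j =>
    rw [map_smul, opQ, wop_bv]
    simp only [Finsupp.smul_apply, bv_apply, smul_eq_mul]
    split_ifs with h
    · obtain ⟨rfl, rfl⟩ := h; ring
    · simp

theorem opT_apply (v : Vec) (n : ℕ) (k : ℤ) : (opT v) (n, k + 1) = v (n, k) := by
  induction v using vec_induction with
  | h0 => simp
  | ha u v hu hv => simp [hu, hv]
  | hs c m j =>
    rw [map_smul, opT, wop_bv]
    simp only [Finsupp.smul_apply, bv_apply, smul_eq_mul, add_left_inj, one_mul]

/-- Coefficients of `opY`. -/
def cm (q : Param) (n : ℕ) : ℂ := qc q / (1 - qc q ^ 2) * ((qc q ^ n)⁻¹ * sq2 q n)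
/-- Coefficients of `opY`. -/
def cp (q : Param) (n : ℕ) : ℂ := -(1 / (1 - qc q ^ 2)) * ((qc q ^ n)⁻¹ * sq2 q (n + 1))

theorem opY_bv (n : ℕ) (k : ℤ) :
    opY q (bv n k) = cm q n • bv (n - 1) (k + 1) + cp q n • bv (n + 1) (k - 1) := by
  rw [opY, LinearMap.add_apply, wop_bv, wop_bv]; rfl

theorem opY_apply_zero (v : Vec) : (opY q v) (0, 0) = cm q 1 * v (1, -1) := by
  induction v using vec_induction with
  | h0 => simp
  | ha u v hu hv => simp [hu, hv, mul_add]
  | hs c m j =>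
    rw [map_smul, opY_bv]
    simp only [Finsupp.smul_apply, Finsupp.add_apply, bv_apply, smul_eq_mul]
    rcases m with _ | _ | m
    · simp [cm]
    · by_cases h : j = -1
      · subst h; simp; ring
      · have h' : ¬ (j + 1 = 0) := fun e => h (by omega)
        simp [h, h']
    · simp

theorem opY_apply_succ (v : Vec) (n : ℕ) :
    (opY q v) (n + 1, 0) = cm q (n + 2) * v (n + 2, -1) + cp q n * v (n, 1) := by
  induction v using vec_induction with
  | h0 => simp
  | ha u v hu hv => simp only [map_add, Finsupp.add_apply, hu, hv]; ring
  | hs c m j =>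
    rw [map_smul, opY_bv]
    simp only [Finsupp.smul_apply, Finsupp.add_apply, bv_apply, smul_eq_mul]
    have e1 : (m - 1 = n + 1 ∧ j + 1 = 0) ↔ (m = n + 2 ∧ j = -1) := by omega
    have e2 : (m + 1 = n + 1 ∧ j - 1 = 0) ↔ (m = n ∧ j = 1) := by omega
    simp only [e1, e2]
    by_cases h1 : m = n + 2 ∧ j = -1
    · obtain ⟨rfl, rfl⟩ := h1; simp; ring
    · by_cases h2 : m = n ∧ j = 1
      · obtain ⟨rfl, rfl⟩ := h2; simp; ring
      · simp [h1, h2]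

theorem mc_rk (x : Oq q) (n' : ℕ) (k' : ℤ) (n : ℕ) (k : ℤ) :
    mc (rk x) n' k' n k = qc q ^ ((k' - n') - (k - n)) * mc x n' k' n k := by
  have h := congrArg (fun f : Module.End ℂ Vec => f (bv n k) (n', k')) (rep_opQ x)
  simp only [Module.End.mul_apply] at h
  rw [opQ_apply, opQ, wop_bv, map_smul, Finsupp.smul_apply, smul_eq_mul] at h
  rw [zpow_sub₀ (qc_ne_zero q) (k' - n'), div_mul_eq_mul_div, eq_div_iff (zpow_ne_zero _ (qc_ne_zero q)),
    mul_comm]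
  exact h

theorem mc_shift (x : Oq q) (n' : ℕ) (k' : ℤ) (n : ℕ) (k : ℤ) :
    mc x n' (k' + 1) n (k + 1) = mc x n' k' n k := by
  have h := congrArg (fun f : Module.End ℂ Vec => f (bv n k) (n', k' + 1)) (rep_opT x)
  simp only [Module.End.mul_apply] at h
  rw [opT_apply, opT, wop_bv, one_smul] at h
  exact h

theorem haar_rk (x : Oq q) : haar q (rk x) = haar q x := by
  simp only [haar_apply, mc_rk, sub_self, zpow_zero, one_mul]

theorem mc_X (x : Oq q) (n : ℕ) : mc (ract (Xfun q) x) n 0 n 0 =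
    (opY q (rep q x (bv n 0))) (n, 0) -
      (cm q n * mc (rk x) n 0 (n - 1) 1 + cp q n * mc (rk x) n 0 (n + 1) (-1)) := by
  have h := congrArg (fun f : Module.End ℂ Vec => f (bv n 0) (n, 0)) (rep_opY x)
  simp only [Module.End.mul_apply, LinearMap.add_apply, Finsupp.add_apply] at h
  rw [opY_bv, map_add, map_smul, map_smul, Finsupp.add_apply, Finsupp.smul_apply,
    Finsupp.smul_apply, smul_eq_mul, smul_eq_mul, zero_add, zero_sub] at h
  rw [← h]; simp only [mc]; ring

/-- The partial sums of `Φ(X ▷ x)`. -/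
def psum (x : Oq q) : ℕ → ℂ
  | 0 => 0
  | n + 1 => qc q ^ (2 * n) * (cm q (n + 1) * mc x (n + 1) (-1) n 0) -
      qc q ^ (2 * n + 2) * (cp q n * mc x n 1 (n + 1) 0)

theorem psum_succ (x : Oq q) (n : ℕ) :
    qc q ^ (2 * n) * mc (ract (Xfun q) x) n 0 n 0 = psum x (n + 1) - psum x n := by
  have hq := qc_ne_zero q
  have hC : ∀ n, mc x n 0 (n + 1) (-1) = mc x n 1 (n + 1) 0 := fun n => (mc_shift x n 0 (n + 1) (-1)).symm
  rw [mc_X, mc_rk, mc_rk, hC]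
  rcases n with _ | n
  · rw [opY_apply_zero]
    have e : ((0 : ℤ) - (0 : ℕ) - (-1 - (0 + 1 : ℕ))) = (2 : ℕ) := by norm_num
    rw [e, zpow_natCast]
    simp only [psum, cm, sq2_zero, mc]; ring
  · rw [opY_apply_succ]
    have e : ((0 : ℤ) - (n + 1 : ℕ) - (-1 - (n + 1 + 1 : ℕ))) = (2 : ℕ) := by push_cast; ring
    have e' : ((0 : ℤ) - (n + 1 : ℕ) - (1 - (n + 1 - 1 : ℕ))) = -((2 : ℕ) : ℤ) := by
      push_cast; simp; ring
    have hA := mc_shift x (n + 1) (-1) n 0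
    norm_num at hA
    rw [e, e', zpow_neg, zpow_natCast, Nat.add_sub_cancel, hA]
    simp only [psum]
    change _ * (cm q (n + 2) * mc x (n + 2) (-1) (n + 1) 0 + cp q n * mc x n 1 (n + 1) 0 - _) = _
    field_simp; ring

theorem psum_tendsto (x : Oq q) : Filter.Tendsto (psum x) Filter.atTop (nhds 0) := by
  obtain ⟨C, hC, h⟩ := mc_bounded x
  rw [← Filter.tendsto_add_atTop_iff_nat 1]
  have hq := qc_ne_zero q
  have e : ∀ n, psum x (n + 1) = qc q ^ n * (1 / (1 - qc q ^ 2) * (sq2 q (n + 1) *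
      (mc x (n + 1) (-1) n 0 + qc q ^ 2 * mc x n 1 (n + 1) 0))) := by
    intro n
    have := qc_sq_ne q
    simp only [psum, cm, cp]; field_simp; ring
  simp only [e]
  have h0 : Filter.Tendsto (fun n : ℕ => qc q ^ n) Filter.atTop (nhds 0) := by
    apply tendsto_pow_atTop_nhds_zero_of_norm_lt_one
    rw [qc, Complex.norm_real, Real.norm_of_nonneg q.2.1.le]; exact q.2.2
  refine h0.zero_mul_isBoundedUnder_le ⟨‖1 / (1 - qc q ^ 2)‖ * (1 * (C + ‖qc q ^ 2‖ * C)), ?_⟩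
  refine Filter.eventually_map.2 (Filter.Eventually.of_forall fun n => ?_)
  simp only [Function.comp]
  rw [norm_mul, norm_mul]
  gcongr
  · exact norm_sq2_le q _
  · refine (norm_add_le _ _).trans ?_
    rw [norm_mul]
    gcongr
    · exact h _ _ _ _
    · exact h _ _ _ _

theorem haar_X (x : Oq q) : haar q (ract (Xfun q) x) = 0 := by
  have h := (haar_summable (ract (Xfun q) x)).hasSum.tendsto_sum_nat
  simp only [psum_succ, Finset.sum_range_sub] at h
  have h' := (psum_tendsto x).sub_const (psum x 0)
  have := tendsto_nhds_unique h h'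
  rw [haar_apply]
  simp only [psum_succ, this]; simp [psum]

end Oq

end

section

namespace Oq

variable {q : Param}

variable {a : ℝ}

/-- `[a+m]`. -/
def spc (q : Param) (a : ℝ) (m : ℤ) : ℂ := ((qnum q (a + m) : ℝ) : ℂ)

theorem spc_eq (q : Param) (a : ℝ) (m : ℤ) :
    spc q a m = (qpw q a m - (qpw q a m)⁻¹) / (qc q - (qc q)⁻¹) := by
  rw [spc, qnum, dbr, Real.rpow_neg q.2.1.le, qpw, qc]; push_cast; rfl

theorem qc_sub_inv_ne (q : Param) : qc q - (qc q)⁻¹ ≠ 0 := by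
  have hq := qc_ne_zero q
  intro h
  apply qc_sq_ne q
  field_simp at h
  linear_combination -h

/-- Left multiplication by `√-1 B_t` on `∑ xₘ Φₘ`, as `√-1 B_t Φₘ = [a+m] Φₘ`. -/
def lmulB (a : ℝ) (x : ℤ → Oq q) : ℤ → Oq q := fun m =>
  Complex.I • ract (Xfun q) (x m) + spc q a m • rk (x m)

theorem lmulB_rmul (c : Oq q) (x : ℤ → Oq q) :
    lmulB a (rmul a c x) = rmul a c (lmulB a x) := by
  have hq := qc_ne_zero q
  refine induction (P := fun c => ∀ x, lmulB a (rmul a c x) = rmul a c (lmulB a x))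
    ?_ ?_ ?_ ?_ ?_ ?_ ?_ ?_ c x
  · intro x; ext m
    have h0 := qpw_ne_zero q a m
    have h1 := qpw_sq_ne q a m
    have hI := Complex.I_sq
    have h2 : qc q ^ 2 - 1 ≠ 0 := fun h => qc_sq_ne q (by linear_combination -h)
    simp only [lmulB, rmul_apply_α, map_add, map_sub, map_smul, ractX_mul, rk, ract_mul_char,
      ract_α, ract_αs, ract_γ, ract_γs, AlgHom.toLinearMap_apply, Xfun_α, Xfun_γ, Xfun_αs, Xfun_γs,
      kHom_α, kHom_αs, kHom_γ, kHom_γs, spc_eq, wt_eq, qpw_succ, qpw_pred]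
    generalize qpw q a m = z at *
    generalize qc q = w at *
    simp only [mul_add, add_mul, mul_sub, smul_mul_assoc, mul_smul_comm, mul_neg, neg_smul]
    match_scalars <;> field_simp <;> ring_nf <;> (try simp only [hI]) <;> (try ring_nf)
  · intro x; ext m
    have h0 := qpw_ne_zero q a m
    have h1 := qpw_sq_ne q a m
    have hI := Complex.I_sq
    have h2 : qc q ^ 2 - 1 ≠ 0 := fun h => qc_sq_ne q (by linear_combination -h)
    simp only [lmulB, rmul_apply_αs, map_add, map_sub, map_smul, ractX_mul, rk, ract_mul_char,
      ract_α, ract_αs, ract_γ, ract_γs, AlgHom.toLinearMap_apply, Xfun_α, Xfun_γ, Xfun_αs, Xfun_γs,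
      kHom_α, kHom_αs, kHom_γ, kHom_γs, spc_eq, wt_eq, qpw_succ, qpw_pred]
    generalize qpw q a m = z at *
    generalize qc q = w at *
    simp only [mul_add, add_mul, mul_sub, smul_mul_assoc, mul_smul_comm, mul_neg, neg_smul]
    match_scalars <;> field_simp <;> ring_nf <;> (try simp only [hI]) <;> (try ring_nf)
  · intro x; ext m
    have h0 := qpw_ne_zero q a m
    have h1 := qpw_sq_ne q a m
    have hI := Complex.I_sq
    have h2 : qc q ^ 2 - 1 ≠ 0 := fun h => qc_sq_ne q (by linear_combination -h)
    simp only [lmulB, rmul_apply_γ, map_add, map_sub, map_smul, ractX_mul, rk, ract_mul_char,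
      ract_α, ract_αs, ract_γ, ract_γs, AlgHom.toLinearMap_apply, Xfun_α, Xfun_γ, Xfun_αs, Xfun_γs,
      kHom_α, kHom_αs, kHom_γ, kHom_γs, spc_eq, wt_eq, qpw_succ, qpw_pred]
    generalize qpw q a m = z at *
    generalize qc q = w at *
    simp only [mul_add, add_mul, mul_sub, smul_mul_assoc, mul_smul_comm, mul_neg, neg_smul]
    match_scalars <;> field_simp <;> ring_nf <;> (try simp only [hI]) <;> (try ring_nf)
  · intro x; ext m
    have h0 := qpw_ne_zero q a m
    have h1 := qpw_sq_ne q a m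
    have hI := Complex.I_sq
    have h2 : qc q ^ 2 - 1 ≠ 0 := fun h => qc_sq_ne q (by linear_combination -h)
    simp only [lmulB, rmul_apply_γs, map_add, map_sub, map_smul, ractX_mul, rk, ract_mul_char,
      ract_α, ract_αs, ract_γ, ract_γs, AlgHom.toLinearMap_apply, Xfun_α, Xfun_γ, Xfun_αs, Xfun_γs,
      kHom_α, kHom_αs, kHom_γ, kHom_γs, spc_eq, wt_eq, qpw_succ, qpw_pred]
    generalize qpw q a m = z at *
    generalize qc q = w at *
    simp only [mul_add, add_mul, mul_sub, smul_mul_assoc, mul_smul_comm, mul_neg, neg_smul]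
    match_scalars <;> field_simp <;> ring_nf <;> (try simp only [hI]) <;> (try ring_nf)
  · intro x; simp
  · intro s c h x; rw [rmul_smul, rmul_smul, ← h]; ext m; simp [lmulB, smul_add, smul_comm s]
  · intro c d h h' x
    rw [rmul_add, rmul_add, ← h, ← h']; ext m
    simp only [lmulB, Pi.add_apply, map_add, smul_add, rk]; abel
  · intro c d h h' x; rw [rmul_mul, rmul_mul, h', h]

theorem spc_injective {m n : ℤ} (h : spc q a m = spc q a n) : m = n := by
  have hd : (q : ℝ) - (q : ℝ)⁻¹ ≠ 0 := by
    intro h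
    apply qc_sub_inv_ne q
    rw [qc]; exact_mod_cast h
  rw [spc, spc, Complex.ofReal_inj, qnum, qnum, div_left_inj' hd] at h
  have mono : StrictAnti fun s : ℝ => dbr q s := by
    intro s t hst
    have h1 := Real.rpow_lt_rpow_of_exponent_gt q.2.1 q.2.2 hst
    have h2 := Real.rpow_lt_rpow_of_exponent_gt q.2.1 q.2.2 (neg_lt_neg hst)
    simp only [dbr]; linarith
  have := mono.injective h
  exact_mod_cast add_left_cancel this

/-- The Haar state is `k`-invariant and `X`-invariant, so `Φ ⊗ id` turns `x ↦ √-1 B_t x` into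
multiplication by `[a+m]` on the coefficient of `Φₘ`. -/
theorem haar_lmulB (x : ℤ → Oq q) (m : ℤ) :
    haar q (lmulB a x m) = spc q a m * haar q (x m) := by
  rw [lmulB, map_add, map_smul, map_smul, haar_X, haar_rk]; simp

theorem lmulB_single (n : ℤ) (b : Oq q) (hb : ract (Xfun q) b = 0) (hb' : rk b = b) :
    lmulB a (Pi.single n b) = spc q a n • Pi.single n b := by
  ext m
  rw [lmulB, Pi.smul_apply]
  by_cases h : m = n
  · subst h; rw [Pi.single_eq_same, hb, hb']; simp
  · rw [Pi.single_eq_of_ne h]; simp [rk]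

theorem lmulB_rmul_single (n : ℤ) (c : Oq q) :
    lmulB a (rmul a c (Pi.single n 1)) = spc q a n • rmul a c (Pi.single n 1) := by
  rw [lmulB_rmul, lmulB_single n 1 (by simp) (by simp [rk]), map_smul]

theorem haar_rmul_single_ne {n m : ℤ} (h : m ≠ n) (c : Oq q) :
    haar q (rmul a c (Pi.single n 1) m) = 0 := by
  have h1 := lmulB_rmul_single (a := a) n c
  have h2 := haar_lmulB (a := a) (rmul a c (Pi.single n 1)) m
  rw [h1, Pi.smul_apply, map_smul, smul_eq_mul] at h2
  have h3 : (spc q a n - spc q a m) * haar q (rmul a c (Pi.single n 1) m) = 0 := by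
    rw [sub_mul, h2, sub_self]
  refine (mul_eq_zero.1 h3).resolve_left fun h4 => h ?_
  exact (spc_injective (sub_eq_zero.1 h4)).symm

theorem rmul_const_one (c : Oq q) : rmul a c (fun _ => 1) = fun _ => c := by
  have main : ∀ x : Oq q, rmul a c (fun _ => x) = fun _ => x * c := by
    refine induction (P := fun c => ∀ x, rmul a c (fun _ => x) = fun _ => x * c)
      ?_ ?_ ?_ ?_ ?_ ?_ ?_ ?_ c
    · intro x; ext m
      have h0 := qpw_ne_zero q a m
      have h1 := qpw_sq_ne q a m
      simp only [rmul_apply_α, wt_eq]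
      match_scalars <;> (field_simp; try ring)
    · intro x; ext m
      have h0 := qpw_ne_zero q a m
      have h1 := qpw_sq_ne q a m
      simp only [rmul_apply_αs, wt_eq]
      match_scalars <;> (field_simp; try ring)
    · intro x; ext m
      have h0 := qpw_ne_zero q a m
      have h1 := qpw_sq_ne q a m
      simp only [rmul_apply_γ, wt_eq]
      match_scalars <;> (field_simp; try ring)
    · intro x; ext m
      have h0 := qpw_ne_zero q a m
      have h1 := qpw_sq_ne q a m
      simp only [rmul_apply_γs, wt_eq]
      match_scalars <;> (field_simp; try ring)
    · intro x; simp
    · intro s c h x; rw [rmul_smul, h]; ext m; simp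
    · intro c d h h' x; rw [rmul_add, h, h']; ext m; simp [mul_add]
    · intro c d h h' x; rw [rmul_mul, h, h']; ext m; simp [mul_assoc]
  simpa using main 1

theorem haar_rmul_single_same (n : ℤ) (c : Oq q) :
    haar q (rmul a c (Pi.single n 1) n) = haar q c := by
  obtain ⟨N, hN⟩ := rmul_local a c
  have h1 : rmul a c ((fun _ => 1) - ∑ l ∈ Finset.Icc (n - N) (n + N), Pi.single l 1) n = 0 := by
    refine hN _ n fun l hl => ?_
    rw [abs_le] at hl
    have : l ∈ Finset.Icc (n - N : ℤ) (n + N) := by rw [Finset.mem_Icc]; omega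
    rw [Pi.sub_apply, Finset.sum_apply, Finset.sum_pi_single, if_pos this, sub_self]
  rw [map_sub, map_sum, rmul_const_one, Pi.sub_apply, Finset.sum_apply, sub_eq_zero] at h1
  rw [congrArg (haar q) h1, map_sum]
  refine (Finset.sum_eq_single n (fun l _ hl => haar_rmul_single_ne hl.symm c) fun h => ?_).symm
  exact absurd (Finset.mem_Icc.2 ⟨by omega, by omega⟩) h

/-- `Φₙ c = ∑ₘ bₘ Φₘ` with `Φ(bₘ) = δₙₘ Φ(c)`. -/
theorem haar_rmul_single (n m : ℤ) (c : Oq q) :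
    haar q (rmul a c (Pi.single n 1) m) = if m = n then haar q c else 0 := by
  split_ifs with h
  · rw [h, haar_rmul_single_same]
  · exact haar_rmul_single_ne h c

/-! ### The spectral projections `Φₙ` as functionals on `O_q(SU(2))` -/

/-- The functional `(Φₙ, c) = ε(Φₙ ◁ c)`, where `ε(Φₘ) = δₘ₀`. -/
def Phi (q : Param) (a : ℝ) (n : ℤ) : Oq q →ₗ[ℂ] ℂ where
  toFun c := ractI a c (Pi.single n (1 : ℂ)) 0
  map_add' c d := by rw [ractI_add]; rfl
  map_smul' s c := by rw [ractI_smul]; rfl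

theorem counit_rmul_single (n : ℤ) (c : Oq q) :
    rmul a c (Pi.single n 1) 0 = ract (Phi q a n) c := by
  rw [rmul_def, ract_apply]
  generalize comulHom q c = s
  induction s using TensorProduct.induction_on with
  | zero => simp
  | add s s' hs hs' =>
    simp only [map_add, MulOpposite.unop_add, LinearMap.add_apply, hs, hs', Pi.add_apply]
  | tmul u v =>
    rw [mulT_tmul]
    have e : (fun m => (Pi.single n 1 : ℤ → Oq q) m * u) =
        fun m => (LinearMap.toSpanSingleton ℂ (Oq q) u) ((Pi.single n 1 : ℤ → ℂ) m) := by
      ext m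
      by_cases h : m = n
      · subst h; simp
      · simp [h]
    rw [e, ractI_map]
    simp [Phi]

theorem counit_ract (h : Oq q →ₗ[ℂ] ℂ) (x : Oq q) : counitHom q (ract h x) = h x := by
  have h2 := conv_apply (counitHom q).toLinearMap h x
  have h1 : WithConv.toConv (counitHom q).toLinearMap = (1 : Dual q) := by
    ext x; rw [LinearMap.convOne_apply]; rfl
  rw [h1, one_mul] at h2
  exact h2.symm

/-- `√-1 B_t Φₙ = [a+n] Φₙ` for `t = q^a - q^{-a}`. -/
theorem Bt_mul_Phi (n : ℤ) :
    Complex.I • (Bt q (dbr q a) * WithConv.toConv (Phi q a n)) =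
      spc q a n • WithConv.toConv (Phi q a n) := by
  ext c
  have h1 := congrArg (counitHom q) (congrFun (lmulB_rmul_single (a := a) n c) 0)
  rw [lmulB, Pi.smul_apply, counit_rmul_single] at h1
  simp only [map_add, map_smul, rk, counit_ract, smul_eq_mul, AlgHom.toLinearMap_apply] at h1
  have h2 := conv_apply (Bt q (dbr q a)).ofConv (Phi q a n) c
  change Complex.I * (WithConv.toConv (Bt q (dbr q a)).ofConv * WithConv.toConv (Phi q a n)) c =
    spc q a n * Phi q a n c
  rw [h2, Bt_apply, ← h1, spc, qnum, add_comm]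
  have hI := Complex.I_sq
  simp only [Int.cast_zero, zero_add, add_zero]
  rw [qc]; push_cast
  linear_combination (-(((q : ℝ) : ℂ) - ((q : ℝ) : ℂ)⁻¹)⁻¹ * (dbr q a : ℂ) * kHom q (ract (Phi q a n) c)) * hI

/-- `∑ₙ Φₙ = 1`, a finite sum at each `c`. -/
theorem sum_Phi (c : Oq q) : ∃ N : ℕ, (∀ n : ℤ, N < |n| → Phi q a n c = 0) ∧
    ∑ n ∈ Finset.Icc (-(N : ℤ)) N, Phi q a n c = counitHom q c := by
  obtain ⟨N, hN⟩ := ractI_local ℂ a c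
  refine ⟨N, fun n hn => hN _ 0 fun l hl => ?_, ?_⟩
  · rw [sub_zero] at hl
    rw [Pi.single_eq_of_ne]; rintro rfl; exact absurd hl (not_le.2 hn)
  have h1 : ractI a c ((fun _ => 1) - ∑ l ∈ Finset.Icc (-(N : ℤ)) N, Pi.single l (1 : ℂ)) 0 = 0 := by
    refine hN _ 0 fun l hl => ?_
    rw [sub_zero, abs_le] at hl
    have : l ∈ Finset.Icc (-(N : ℤ)) N := by rw [Finset.mem_Icc]; omega
    rw [Pi.sub_apply, Finset.sum_apply, Finset.sum_pi_single, if_pos this, sub_self]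
  have h2 : ractI a c (fun _ => (1 : ℂ)) = fun _ => counitHom q c := by
    have main : ∀ x : ℂ, ractI a c (fun _ => x) = fun _ => x * counitHom q c := by
      refine induction (P := fun c => ∀ x : ℂ, ractI a c (fun _ => x) = fun _ => x * counitHom q c)
        ?_ ?_ ?_ ?_ ?_ ?_ ?_ ?_ c
      · intro x; ext m
        have h0 := qpw_ne_zero q a m
        have h1 := qpw_sq_ne q a m
        simp only [ractI_α, hop_apply, wt_eq, smul_eq_mul, counitHom_α]
        field_simp
      · intro x; ext m
        have h0 := qpw_ne_zero q a m
        have h1 := qpw_sq_ne q a m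
        simp only [ractI_αs, hop_apply, wt_eq, smul_eq_mul, counitHom_αs]
        field_simp; ring
      · intro x; ext m
        simp only [ractI_γ, hop_apply, smul_eq_mul, counitHom_γ]; ring
      · intro x; ext m
        simp only [ractI_γs, hop_apply, smul_eq_mul, counitHom_γs]; ring
      · intro x; simp
      · intro s c h x; rw [ractI_smul, h]; ext m; simp; ring
      · intro c d h h' x; rw [ractI_add, h, h']; ext m; simp [mul_add]
      · intro c d h h' x; rw [ractI_mul, h, h']; ext m; simp [mul_assoc]
    simpa using main 1
  rw [map_sub, map_sum, h2, Pi.sub_apply, Finset.sum_apply, sub_eq_zero] at h1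
  exact h1.symm

/-- The right action is `(Φₙ ◁ c, d) = (Φₙ, c d)`, expanded in the `Φₘ`. -/
theorem Phi_mul_apply (n : ℤ) (c d : Oq q) :
    Phi q a n (c * d) = ∑ᶠ m, ractI a c (Pi.single n (1 : ℂ)) m * Phi q a m d := by
  obtain ⟨N, hN⟩ := ractI_local ℂ a c
  set x : ℤ → ℂ := ractI a c (Pi.single n 1) with hx
  have h0 : ∀ m, x m ≠ 0 → m ∈ Finset.Icc (n - N : ℤ) (n + N) := by
    intro m hm
    by_contra h
    refine hm (hN _ m fun l hl => ?_)
    rw [abs_le] at hl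
    rw [Pi.single_eq_of_ne]
    rintro rfl
    exact h (Finset.mem_Icc.2 ⟨by omega, by omega⟩)
  have h1 : x = ∑ m ∈ Finset.Icc (n - N : ℤ) (n + N), x m • Pi.single m (1 : ℂ) := by
    ext l
    rw [Finset.sum_apply]
    simp only [Pi.smul_apply, Pi.single_apply, smul_eq_mul, mul_ite, mul_one, mul_zero,
      Finset.sum_ite_eq]
    split_ifs with h
    · rfl
    · by_contra h'; exact h (h0 l h')
  rw [finsum_eq_sum_of_support_subset (s := Finset.Icc (n - N : ℤ) (n + N)) _ fun m hm => by
    exact Finset.mem_coe.2 (h0 m fun e => hm (by simp [e]))]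
  change ractI a (c * d) (Pi.single n 1) 0 = _
  rw [ractI_mul, ← hx]
  conv_lhs => rw [h1]
  rw [map_sum, Finset.sum_apply]
  refine Finset.sum_congr rfl fun m _ => ?_
  rw [map_smul]; rfl

end Oq

end

section

namespace Oq

variable {q : Param}

namespace Smash
variable {a : ℝ}

/-- `{a+n} / {a}`. -/
def ratio (q : Param) (a : ℝ) (n : ℤ) : ℝ := cbr q (a + n) / cbr q a

theorem cbr_pos (q : Param) (s : ℝ) : 0 < cbr q s :=
  add_pos (Real.rpow_pos_of_pos q.2.1 _) (Real.rpow_pos_of_pos q.2.1 _)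
theorem ratio_pos (q : Param) (a : ℝ) (n : ℤ) : 0 < ratio q a n := div_pos (cbr_pos _ _) (cbr_pos _ _)

/-- The functional `b Φₙ ↦ ({a+n} / {a}) Φ(b)`, where `Φ` is the Haar state. -/
def integral (q : Param) (a : ℝ) : Smash q a →ₗ[ℂ] ℂ :=
  Finsupp.lsum (M := Oq q) (R := ℂ) ℂ fun n => ((ratio q a n : ℝ) : ℂ) • haar q

theorem integral_single (n : ℤ) (b : Oq q) :
    integral q a (single a n b) = ratio q a n * haar q b :=
  (Finsupp.lsum_single _ _ _ _).trans rfl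

theorem haar_mulRight_single (n m : ℤ) (c : Oq q) :
    haar q (mulRight c (single a n 1) m) = if m = n then haar q c else 0 := by
  rw [coe_mulRight, ← haar_rmul_single (a := a)]
  have e : ⇑(single a n (1 : Oq q)) = Pi.single n 1 := by
    funext l
    rw [single_apply, Pi.single_apply]
  rw [e]

theorem integral_star_mul_single (y : Smash q a) (m : ℤ) (c : Oq q) :
    integral q a (star y * single a m c) = ratio q a m * haar q (star (y m) * c) := by
  rw [mul_single, integral_single, star_def]
  congr 1
  induction y using induction_single with
  | h0 => simp
  | ha x y hx hy =>
    simp only [map_add, add_apply, star_add, add_mul, hx, hy]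
  | hs n b =>
    rw [starAdd_single, ← mulRight_mul, haar_mulRight_single, single_apply]
    split_ifs with h
    · rfl
    · simp

/-- The form `⟨y, x⟩ = φ(y^* x) = ∑ₘ ({a+m}/{a}) Φ(yₘ^* xₘ)`. -/
theorem integral_star_mul (y x : Smash q a) (s : Finset ℤ) (hs : ∀ m, x m ≠ 0 → m ∈ s) :
    integral q a (star y * x) = ∑ m ∈ s, (ratio q a m : ℂ) * haar q (star (y m) * x m) := by
  have hx : x = ∑ m ∈ s, single a m (x m) := by
    have : ∀ l, (∑ m ∈ s, single a m (x m)) l = ∑ m ∈ s, single a m (x m) l := fun l =>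
      Finsupp.finsetSum_apply (N := Oq q) s (fun m => (single a m (x m) : ℤ →₀ Oq q)) l
    ext l
    rw [this]
    simp only [single_apply, Finset.sum_ite_eq]
    split_ifs with h
    · rfl
    · by_contra h'; exact h (hs l h')
  conv_lhs => rw [hx]
  rw [Finset.mul_sum, map_sum]
  exact Finset.sum_congr rfl fun m _ => integral_star_mul_single y m (x m)

theorem exists_support (x : Smash q a) : ∃ s : Finset ℤ, ∀ m, x m ≠ 0 → m ∈ s :=
  ⟨x.finite_support.toFinset, fun m hm => by simpa using hm⟩

theorem integral_re (x : Smash q a) (s : Finset ℤ) (hs : ∀ m, x m ≠ 0 → m ∈ s) :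
    (integral q a (star x * x)).re = ∑ m ∈ s, ratio q a m * (haar q (star (x m) * x m)).re := by
  rw [integral_star_mul x x s hs, Complex.re_sum]
  simp only [Complex.re_ofReal_mul]

theorem integral_nonneg (x : Smash q a) : 0 ≤ (integral q a (star x * x)).re := by
  obtain ⟨s, hs⟩ := exists_support x
  rw [integral_re x s hs]
  exact Finset.sum_nonneg fun m _ => mul_nonneg (ratio_pos q a m).le (haar_nonneg _)

theorem integral_conj (y x : Smash q a) :
    conj (integral q a (star y * x)) = integral q a (star x * y) := by
  obtain ⟨s, hs⟩ := exists_support x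
  obtain ⟨s', hs'⟩ := exists_support y
  rw [integral_star_mul y x (s ∪ s') fun m hm => Finset.mem_union_left _ (hs m hm),
    integral_star_mul x y (s ∪ s') fun m hm => Finset.mem_union_right _ (hs' m hm), map_sum]
  refine Finset.sum_congr rfl fun m _ => ?_
  rw [map_mul, Complex.conj_ofReal, ← haar_star, star_mul, star_star]

theorem mulLeft_bounded (b : Oq q) : ∃ C : ℝ, 0 ≤ C ∧ ∀ x : Smash q a,
    (integral q a (star (mulLeft b x) * mulLeft b x)).re ≤ C * (integral q a (star x * x)).re := by
  obtain ⟨C, hC, h⟩ := haar_bounded b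
  refine ⟨C, hC, fun x => ?_⟩
  obtain ⟨s, hs⟩ := exists_support x
  rw [integral_re x s hs, integral_re (mulLeft b x) s fun m hm => hs m fun h0 => hm (by simp [h0]),
    Finset.mul_sum]
  refine Finset.sum_le_sum fun m _ => ?_
  rw [mul_left_comm, mulLeft_apply]
  exact mul_le_mul_of_nonneg_left (h _) (ratio_pos q a m).le

theorem proj_bounded (n : ℤ) (x : Smash q a) :
    (integral q a (star (single a n 1 * x) * (single a n 1 * x))).re ≤
      (integral q a (star x * x)).re := by
  have he : star (single a n (1 : Oq q)) = single a n 1 := by rw [star_single]; simp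
  have hee : single a n (1 : Oq q) * single a n 1 = single a n 1 := by rw [mul_single]; simp
  have h1 : star (single a n 1 * x) * (single a n 1 * x) = star x * (single a n 1 * x) := by
    rw [star_mul, he, mul_assoc, ← mul_assoc (single a n 1), hee]
  have h2 : star (single a n 1 * x) * x = star x * (single a n 1 * x) := by
    rw [star_mul, he, mul_assoc]
  have h3 := integral_nonneg (x - single a n 1 * x)
  rw [star_sub, sub_mul, mul_sub, mul_sub, h1, h2] at h3
  rw [h1]
  simp only [map_sub, Complex.sub_re, sub_self, sub_zero] at h3
  linarith

theorem left_bounded (z : Smash q a) : ∃ C : ℝ, 0 ≤ C ∧ ∀ x : Smash q a,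
    (integral q a (star (z * x) * (z * x))).re ≤ C * (integral q a (star x * x)).re := by
  induction z using induction_single with
  | h0 => exact ⟨0, le_rfl, fun x => by simp⟩
  | ha y z hy hz =>
    obtain ⟨C, hC, h⟩ := hy
    obtain ⟨C', hC', h'⟩ := hz
    refine ⟨2 * C + 2 * C', by positivity, fun x => ?_⟩
    have h0 := integral_nonneg (y * x - z * x)
    have e1 : star ((y + z) * x) * ((y + z) * x) + star (y * x - z * x) * (y * x - z * x) =
        (2 : ℂ) • (star (y * x) * (y * x)) + (2 : ℂ) • (star (z * x) * (z * x)) := by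
      rw [add_mul, star_add, star_sub]
      simp only [add_mul, mul_add, sub_mul, mul_sub, two_smul]; abel
    have e2 := congrArg (fun w => (integral q a w).re) e1
    simp only [map_add, map_smul, Complex.add_re, smul_eq_mul] at e2
    have e3 : ∀ w : ℂ, (2 * w).re = 2 * w.re := fun w => by simp
    rw [e3, e3] at e2
    have := h x; have := h' x
    linarith
  | hs n b =>
    obtain ⟨C, hC, h⟩ := mulLeft_bounded (a := a) b
    refine ⟨C, hC, fun x => ?_⟩
    rw [single_eq, ← mulLeft_mul]
    exact (h _).trans (mul_le_mul_of_nonneg_left (proj_bounded n x) hC)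

end Smash

variable {a : ℝ}

open Smash in
/-- `C_c(SL_q(2,ℝ)_t) = O_q(S_t²) ⋈ 𝓘_c` for `t = q^a - q^{-a}`: the finite sums `∑ₙ bₙ Φₙ` with
`bₙ ∈ O_q(S_t²)`. -/
def Cc (q : Param) (a : ℝ) : NonUnitalStarSubalgebra ℂ (Smash q a) where
  carrier := {x | ∀ m, x m ∈ podles q (dbr q a)}
  add_mem' hx hy m := add_mem (hx m) (hy m)
  zero_mem' m := zero_mem _
  smul_mem' s x hx m := (podles q (dbr q a)).toSubalgebra.smul_mem (hx m) s
  mul_mem' {x y} hx hy m := rmul_mem_podles (hy m) hx m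
  star_mem' {x} hx m := by
    have key : ∀ s : Finset ℤ, (∑ n ∈ s, mulRight (star (x n)) (single a n 1) : Smash q a) m ∈
        podles q (dbr q a) := by
      intro s
      induction s using Finset.induction_on with
      | empty => exact zero_mem _
      | insert n s hn ih =>
        rw [Finset.sum_insert hn]
        refine add_mem ?_ ih
        refine rmul_mem_podles (star_mem (hx n)) (fun l => ?_) m
        rw [single_apply]
        split_ifs
        · exact one_mem _
        · exact zero_mem _
    exact key (Finsupp.support (x : ℤ →₀ Oq q))

theorem mem_Cc {x : Smash q a} : x ∈ Cc q a ↔ ∀ m, x m ∈ podles q (dbr q a) := Iff.rfl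

/-- The invariant integral `φ_t` on `C_c(SL_q(2,ℝ)_t)`: `φ_t(b Φₙ) = ({a+n} / {a}) Φ(b)`. -/
def phi (q : Param) (a : ℝ) : Cc q a →ₗ[ℂ] ℂ where
  toFun x := Smash.integral q a x
  map_add' _ _ := map_add _ _ _
  map_smul' s x := map_smul (Smash.integral q a) s (x : Smash q a)

theorem phi_apply (x : Cc q a) : phi q a x = Smash.integral q a x := rfl

/-! ### The regular representation -/

/-- `C_c(SL_q(2,ℝ)_t)` with the pre-inner product `⟨y, x⟩ = φ_t(y^* x)`. -/
def PreHreg (q : Param) (a : ℝ) : Type := Cc q a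

instance : AddCommGroup (PreHreg q a) := inferInstanceAs (AddCommGroup (Cc q a))
instance : Module ℂ (PreHreg q a) := inferInstanceAs (Module ℂ (Cc q a))

/-- The identity map `C_c → PreHreg`. -/
def toPre (q : Param) (a : ℝ) : Cc q a ≃ₗ[ℂ] PreHreg q a := LinearEquiv.refl ℂ _
/-- The identity map `PreHreg → C_c`. -/
def ofPre (q : Param) (a : ℝ) : PreHreg q a ≃ₗ[ℂ] Cc q a := (toPre q a).symm

@[simp] theorem ofPre_toPre (x : Cc q a) : ofPre q a (toPre q a x) = x := rfl
@[simp] theorem toPre_ofPre (x : PreHreg q a) : toPre q a (ofPre q a x) = x := rfl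

abbrev preCore (q : Param) (a : ℝ) : PreInnerProductSpace.Core ℂ (PreHreg q a) where
  inner y x := phi q a (star (ofPre q a y) * ofPre q a x)
  conj_inner_symm x y := Smash.integral_conj _ _
  re_inner_nonneg x := Smash.integral_nonneg _
  add_left x y z := by rw [map_add, star_add, add_mul, map_add]
  smul_left x y r := by simp [smul_mul_assoc]

instance : SeminormedAddCommGroup (PreHreg q a) :=
  InnerProductSpace.Core.toSeminormedAddCommGroup (c := preCore q a)
instance : InnerProductSpace ℂ (PreHreg q a) := InnerProductSpace.ofCore (preCore q a)

theorem pre_inner_def (y x : PreHreg q a) :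
    ⟪y, x⟫_ℂ = phi q a (star (ofPre q a y) * ofPre q a x) := rfl
theorem pre_norm_def (x : PreHreg q a) :
    ‖x‖ = √(phi q a (star (ofPre q a x) * ofPre q a x)).re := rfl

/-- The Hilbert space `H_reg`. -/
abbrev Hreg (q : Param) (a : ℝ) : Type := UniformSpace.Completion (PreHreg q a)

/-- Left multiplication by `z`. -/
def leftMulLin (z : Cc q a) : PreHreg q a →ₗ[ℂ] PreHreg q a :=
  (toPre q a).toLinearMap ∘ₗ LinearMap.mulLeft ℂ z ∘ₗ (ofPre q a).toLinearMap

theorem leftMulLin_bounded (z : Cc q a) :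
    ∃ C : ℝ, ∀ x, ‖leftMulLin z x‖ ≤ C * ‖x‖ := by
  obtain ⟨C, hC, h⟩ := Smash.left_bounded (z : Smash q a)
  refine ⟨√C, fun x => ?_⟩
  rw [pre_norm_def, pre_norm_def, ← Real.sqrt_mul hC]
  exact Real.sqrt_le_sqrt (h (ofPre q a x : Cc q a))

/-- Left multiplication by `z`, as a bounded operator. -/
def leftMul (z : Cc q a) : PreHreg q a →L[ℂ] PreHreg q a :=
  (leftMulLin z).mkContinuousOfExistsBound (leftMulLin_bounded z)

@[simp] theorem leftMul_apply (z : Cc q a) (x : PreHreg q a) :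
    leftMul z x = toPre q a (z * ofPre q a x) := rfl

/-- The operator `π_reg(z)`, the extension of left multiplication by `z` to `H_reg`. -/
def piOp (z : Cc q a) : Hreg q a →L[ℂ] Hreg q a := (leftMul z).completion

theorem piOp_coe (z : Cc q a) (x : PreHreg q a) :
    piOp z (x : Hreg q a) = ((toPre q a (z * ofPre q a x) : PreHreg q a) : Hreg q a) :=
  (leftMul z).completion_apply_coe x

theorem op_ext {S T : Hreg q a →L[ℂ] Hreg q a} (h : ∀ x : PreHreg q a, S x = T x) : S = T := by
  ext x
  induction x using UniformSpace.Completion.induction_on with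
  | hp => exact isClosed_eq S.continuous T.continuous
  | ih x => exact h x

theorem piOp_smul (s : ℂ) (z : Cc q a) : piOp (s • z) = s • piOp z := by
  refine op_ext fun x => ?_
  rw [smul_apply, piOp_coe, piOp_coe, smul_mul_assoc, map_smul]
  exact UniformSpace.Completion.coe_smul s _
theorem piOp_add (z w : Cc q a) : piOp (z + w) = piOp z + piOp w := by
  refine op_ext fun x => ?_
  rw [add_apply, piOp_coe, piOp_coe, piOp_coe, add_mul, map_add]
  exact UniformSpace.Completion.coe_add _ _
theorem piOp_mul (z w : Cc q a) : piOp (z * w) = piOp z * piOp w := by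
  refine op_ext fun x => ?_
  change piOp (z * w) (x : Hreg q a) = piOp z (piOp w (x : Hreg q a))
  rw [piOp_coe, piOp_coe, piOp_coe, ofPre_toPre, mul_assoc]
theorem piOp_star (z : Cc q a) : piOp (star z) = star (piOp z) := by
  refine (ContinuousLinearMap.eq_adjoint_iff _ _).mpr fun x y => ?_
  induction x, y using UniformSpace.Completion.induction_on₂ with
  | hp =>
    exact isClosed_eq (((piOp (star z)).continuous.comp continuous_fst).inner continuous_snd)
      (continuous_fst.inner ((piOp z).continuous.comp continuous_snd))
  | ih x y =>
    rw [piOp_coe, piOp_coe, UniformSpace.Completion.inner_coe, UniformSpace.Completion.inner_coe,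
      pre_inner_def, pre_inner_def, ofPre_toPre, ofPre_toPre, star_mul, star_star, mul_assoc]

/-- The regular representation `π_reg`, by left multiplication: `π_reg(z) Λ(x) = Λ(z x)`. -/
def piReg (q : Param) (a : ℝ) : Cc q a →⋆ₙₐ[ℂ] (Hreg q a →L[ℂ] Hreg q a) where
  toFun := piOp
  map_smul' := piOp_smul
  map_zero' := by simpa using piOp_smul (0 : ℂ) (0 : Cc q a)
  map_add' := piOp_add
  map_mul' := piOp_mul
  map_star' := piOp_star

theorem piReg_apply_coe (z x : Cc q a) :
    piReg q a z (toPre q a x : Hreg q a) = (toPre q a (z * x) : Hreg q a) :=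
  piOp_coe z (toPre q a x)

end Oq

end

end QSL

end

/-! The form $\langle y,x\rangle=\varphi_t(y^*x)$ is an orthogonal direct sum of copies of the Haar
form. By `Smash.integral_star_mul`, $\varphi_t(y^*x)=\sum_m\frac{\{a+m\}}{\{a\}}\Phi(y_m^*x_m)$,
where $x_m$ is the coefficient of $\Phi_m$. This formula rests on the invariance of the Haar state,
through `haar_rmul_single`. The weights are positive, so faithfulness of $\varphi_t$ reduces to
faithfulness of $\Phi$ on all of $\mathcal O_q(SU(2))$; the Podleś sphere plays no further role.

By `haar_re`, $\Phi(x^*x)=(1-q^2)\sum_n q^{2n}\|x e_{n,0}\|^2$ in the standard representation. Hence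
$\Phi(x^*x)=0$ forces $x e_{n,0}=0$ for every $n$, and what remains is that the vectors $e_{n,0}$
separate the algebra (`eq_zero_of_rep`). Write $x$ as a combination of the monomials
$\gamma^j\gamma^{*k}\alpha^i$, with $\alpha^i$ read as $\alpha^{*|i|}$ for $i<0$; these span by
`span_pbw`. Such a monomial sends $e_{n,0}$ to a multiple of $e_{n-i,\,j-k}$, and for $m=n-i\ge 0$
the multiple is $c\,(q^m)^{j+k}$ with $c\ne 0$ depending only on $i$ and $n$ (`rep_pbw_apply`). So
the $e_{m,l}$-coordinate of $x e_{m+i,0}$ is $c\,P(q^m)$, where the polynomial $P$ collects the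
coefficients of $x$ with the given $i$ and with $j-k=l$, placed in degree $j+k$. It vanishes at the
infinitely many distinct points $q^m$, so $P=0$. Since $j-k$ and $j+k$ determine $j$ and $k$, every
coefficient of $x$ is zero.

Faithfulness of $\varphi_t$ says that $\Lambda$ is injective. If $\pi_{\mathrm{reg}}(z)=0$, then
$\Lambda(zz^*)=\pi_{\mathrm{reg}}(z)\Lambda(z^*)=0$, so $zz^*=0$. Then $\varphi_t((z^*)^*z^*)=0$ and
$z^*=0$. -/

namespace QSL.Oq

variable {q : Param}

/-! ### Spanning monomials of `O_q(SU(2))` -/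

/-- The powers of `α` for nonnegative exponents, and of `α^*` for negative ones. -/
def apow (q : Param) : ℤ → Oq q
  | .ofNat i => α q ^ i
  | .negSucc i => αs q ^ (i + 1)

/-- The monomials `γ^j γ^{*k} α^i` and `γ^j γ^{*k} α^{*i}`. -/
def pbw (q : Param) (p : ℤ × ℕ × ℕ) : Oq q := γ q ^ p.2.1 * γs q ^ p.2.2 * apow q p.1

theorem γ_commute_γs : Commute (γ q) (γs q) := (surel q).r3.symm

/-- Each factor `γ` or `γs` that `α` passes on its way to the right costs one factor $q$. This puts
`α` next to the power of `α` or `αs` at the end of a monomial. -/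
theorem α_mul_γ_pow (j k : ℕ) :
    α q * (γ q ^ j * γs q ^ k) = qc q ^ (j + k) • (γ q ^ j * γs q ^ k * α q) := by
  have h1 : ∀ j : ℕ, α q * γ q ^ j = qc q ^ j • (γ q ^ j * α q) := by
    intro j
    induction j with
    | zero => simp
    | succ j ih =>
      rw [pow_succ, ← mul_assoc, ih, smul_mul_assoc, mul_assoc, (surel q).r4, mul_smul_comm,
        smul_smul, ← mul_assoc, pow_succ]
  have h2 : ∀ k : ℕ, α q * γs q ^ k = qc q ^ k • (γs q ^ k * α q) := by
    intro k
    induction k with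
    | zero => simp
    | succ k ih =>
      rw [pow_succ, ← mul_assoc, ih, smul_mul_assoc, mul_assoc, (surel q).r5, mul_smul_comm,
        smul_smul, ← mul_assoc, pow_succ]
  rw [← mul_assoc, h1, smul_mul_assoc, mul_assoc, h2, mul_smul_comm, smul_smul, pow_add, mul_assoc]

theorem αs_mul_γ_pow (j k : ℕ) :
    αs q * (γ q ^ j * γs q ^ k) = (qc q)⁻¹ ^ (j + k) • (γ q ^ j * γs q ^ k * αs q) := by
  have hq := qc_ne_zero q
  -- The relations move `αs` to the left. Reading them in the other direction requires dividing by
  -- $q$.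
  have r6 : αs q * γs q = (qc q)⁻¹ • (γs q * αs q) := by
    rw [(surel q).r6, smul_smul, inv_mul_cancel₀ hq, one_smul]
  have r7 : αs q * γ q = (qc q)⁻¹ • (γ q * αs q) := by
    rw [(surel q).r7, smul_smul, inv_mul_cancel₀ hq, one_smul]
  have h1 : ∀ j : ℕ, αs q * γ q ^ j = (qc q)⁻¹ ^ j • (γ q ^ j * αs q) := by
    intro j
    induction j with
    | zero => simp
    | succ j ih =>
      rw [pow_succ, ← mul_assoc, ih, smul_mul_assoc, mul_assoc, r7, mul_smul_comm,
        smul_smul, ← mul_assoc, pow_succ]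
  have h2 : ∀ k : ℕ, αs q * γs q ^ k = (qc q)⁻¹ ^ k • (γs q ^ k * αs q) := by
    intro k
    induction k with
    | zero => simp
    | succ k ih =>
      rw [pow_succ, ← mul_assoc, ih, smul_mul_assoc, mul_assoc, r6, mul_smul_comm,
        smul_smul, ← mul_assoc, pow_succ]
  rw [← mul_assoc, h1, smul_mul_assoc, mul_assoc, h2, mul_smul_comm, smul_smul, pow_add, mul_assoc]

/-- Absorbs the factor `γ q * γs q` that appears when `α` and `αs` cancel. The trailing `x` stands
for the power of `α` or `αs` that is left behind it. -/
theorem γ_pow_mul_γγs (j k : ℕ) (x : Oq q) :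
    γ q ^ j * γs q ^ k * (γ q * γs q * x) = γ q ^ (j + 1) * γs q ^ (k + 1) * x := by
  have h : γs q ^ k * γ q = γ q * γs q ^ k := ((γ_commute_γs (q := q)).pow_right k).symm.eq
  rw [← mul_assoc, ← mul_assoc, mul_assoc _ _ (γ q), h, pow_succ, pow_succ]
  simp only [mul_assoc]

/-- A generator `γ` or `γs` only raises an exponent. A generator `α` or `αs` is first moved to the
right, where it either lengthens a power of the same kind or meets one of the opposite kind. In the
second case $\alpha^*\alpha=1-\gamma\gamma^*$ or $\alpha\alpha^*=1-q^2\gamma\gamma^*$ shortens the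
power and leaves two monomials. -/
theorem gen_mul_pbw_mem (p : ℤ × ℕ × ℕ) :
    α q * pbw q p ∈ Submodule.span ℂ (Set.range (pbw q)) ∧
    αs q * pbw q p ∈ Submodule.span ℂ (Set.range (pbw q)) ∧
    γ q * pbw q p ∈ Submodule.span ℂ (Set.range (pbw q)) ∧
    γs q * pbw q p ∈ Submodule.span ℂ (Set.range (pbw q)) := by
  obtain ⟨i, j, k⟩ := p
  have mem : ∀ p, pbw q p ∈ Submodule.span ℂ (Set.range (pbw q)) := fun p =>
    Submodule.subset_span ⟨p, rfl⟩
  have e1 : αs q * α q = 1 - γ q * γs q := by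
    rw [← (surel q).r3, ← (surel q).r1]; abel
  have e2 : α q * αs q = 1 - qc q ^ 2 • (γ q * γs q) := by
    rw [← (surel q).r2]; abel
  refine ⟨?_, ?_, ?_, ?_⟩
  · simp only [pbw]
    rw [← mul_assoc, α_mul_γ_pow, smul_mul_assoc]
    refine Submodule.smul_mem _ _ ?_
    rcases i with i | i
    · convert mem (Int.ofNat (i + 1), j, k) using 1
      simp only [pbw, apow, pow_succ' (α q), mul_assoc]
    · have h : apow q (-(i : ℤ)) = αs q ^ i := by
        rcases i with _ | i
        · exact (pow_zero (α q)).trans (pow_zero (αs q)).symm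
        · rfl
      have : γ q ^ j * γs q ^ k * α q * apow q (.negSucc i) =
          pbw q (-(i : ℤ), j, k) - qc q ^ 2 • pbw q (-(i : ℤ), j + 1, k + 1) := by
        simp only [pbw, h]
        rw [← γ_pow_mul_γγs, apow, pow_succ', mul_assoc, ← mul_assoc (α q), e2, sub_mul, one_mul,
          mul_sub, smul_mul_assoc, mul_smul_comm]
      rw [this]
      exact sub_mem (mem _) (Submodule.smul_mem _ _ (mem _))
  · simp only [pbw]
    rw [← mul_assoc, αs_mul_γ_pow, smul_mul_assoc]
    refine Submodule.smul_mem _ _ ?_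
    -- Exponent zero is separate from the positive ones: there is no `α` to cancel, and `αs` starts
    -- the negative powers.
    rcases i with (_ | i) | i
    · convert mem (Int.negSucc 0, j, k) using 1
      simp [pbw, apow]
    · have : γ q ^ j * γs q ^ k * αs q * apow q (.ofNat (i + 1)) =
          pbw q (.ofNat i, j, k) - pbw q (.ofNat i, j + 1, k + 1) := by
        simp only [pbw, apow]
        rw [← γ_pow_mul_γγs, pow_succ' (α q), mul_assoc, ← mul_assoc (αs q), e1, sub_mul, one_mul,
          mul_sub]
      rw [this]
      exact sub_mem (mem _) (mem _)
    · convert mem (Int.negSucc (i + 1), j, k) using 1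
      simp only [pbw, apow, pow_succ' (αs q), mul_assoc]
  · convert mem (i, j + 1, k) using 1
    simp only [pbw, pow_succ' (γ q), mul_assoc]
  · convert mem (i, j, k + 1) using 1
    -- The new `γs` stands to the left of `γ q ^ j` and has to commute past it.
    have h : γs q * γ q ^ j = γ q ^ j * γs q := ((γ_commute_γs (q := q)).symm.pow_right j).eq
    simp only [pbw]
    rw [pow_succ' (γs q), ← mul_assoc, ← mul_assoc, h, mul_assoc (γ q ^ j)]

/-- The elements whose left multiplication preserves the span form a subalgebra containing the
generators, hence everything. The span is therefore a left ideal, and it contains `1`. -/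
theorem span_pbw : Submodule.span ℂ (Set.range (pbw q)) = ⊤ := by
  set S := Submodule.span ℂ (Set.range (pbw q)) with hS
  -- Left multiplication by `u` is linear, so stability of the span can be tested on monomials.
  have base : ∀ u : Oq q, (∀ p, u * pbw q p ∈ S) → ∀ y ∈ S, u * y ∈ S := by
    intro u hu y hy
    exact (Submodule.span_le (p := S.comap (LinearMap.mulLeft ℂ u))).2
      (by rintro _ ⟨p, rfl⟩; exact hu p) hy
  -- The quantifier over all `y ∈ S` is part of the induction predicate; the product step applies
  -- the hypothesis for the left factor to `x' * y`.
  have main : ∀ x : Oq q, ∀ y ∈ S, x * y ∈ S := by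
    refine induction (P := fun x => ∀ y ∈ S, x * y ∈ S) ?_ ?_ ?_ ?_ ?_ ?_ ?_ ?_
    · exact base _ fun p => (gen_mul_pbw_mem p).1
    · exact base _ fun p => (gen_mul_pbw_mem p).2.1
    · exact base _ fun p => (gen_mul_pbw_mem p).2.2.1
    · exact base _ fun p => (gen_mul_pbw_mem p).2.2.2
    · intro y hy; rwa [one_mul]
    · intro c x h y hy; rw [smul_mul_assoc]; exact S.smul_mem c (h y hy)
    · intro x x' h h' y hy; rw [add_mul]; exact add_mem (h y hy) (h' y hy)
    · intro x x' h h' y hy; rw [mul_assoc]; exact h _ (h' y hy)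
  refine eq_top_iff.2 fun x _ => ?_
  rw [← mul_one x]
  refine main x 1 (Submodule.subset_span ⟨(0, 0, 0), ?_⟩)
  simp [pbw, show apow q 0 = 1 from pow_zero _]

/-! ### Faithfulness of the standard representation -/

theorem sq2_ne_zero {n : ℕ} (hn : n ≠ 0) : sq2 q n ≠ 0 := by
  have h : (q : ℝ) ^ (2 * n) < 1 := pow_lt_one₀ q.2.1.le q.2.2 (by omega)
  rw [sq2, Complex.ofReal_ne_zero]
  exact (Real.sqrt_pos.2 (by linarith)).ne'

theorem rep_γ_pow (j n : ℕ) (l : ℤ) :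
    rep q (γ q ^ j) (bv n l) = (qc q ^ n) ^ j • bv n (l + j) := by
  induction j generalizing l with
  | zero => simp
  | succ j ih =>
    rw [pow_succ, map_mul, Module.End.mul_apply, rep_γ, map_smul, ih, smul_smul]
    congr 1
    · ring
    · congr 1; push_cast; ring

theorem rep_γs_pow (j n : ℕ) (l : ℤ) :
    rep q (γs q ^ j) (bv n l) = (qc q ^ n) ^ j • bv n (l - j) := by
  induction j generalizing l with
  | zero => simp
  | succ j ih =>
    rw [pow_succ, map_mul, Module.End.mul_apply, rep_γs, map_smul, ih, smul_smul]
    congr 1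
    · ring
    · congr 1; push_cast; ring

/-- The scalar is the product of $\sqrt{1-q^{2r}}$ for $r=n,n-1,\dots$, with $i$ factors. It meets
the factor $r=0$ exactly when $i>n$, so the truncated subtraction `n - i` is harmless. Only the
vanishing or nonvanishing of the scalar matters later, and that it does not depend on `l`. -/
theorem rep_α_pow (i n : ℕ) : ∃ c : ℂ, (i ≤ n → c ≠ 0) ∧ (n < i → c = 0) ∧
    ∀ l, rep q (α q ^ i) (bv n l) = c • bv (n - i) l := by
  induction i generalizing n with
  | zero => exact ⟨1, by simp, by simp, by simp⟩
  | succ i ih =>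
    obtain ⟨c, h1, h2, h3⟩ := ih (n - 1)
    refine ⟨sq2 q n * c, fun h => mul_ne_zero (sq2_ne_zero (by omega)) (h1 (by omega)),
      fun h => ?_, fun l => ?_⟩
    -- At level `0` the first factor `sq2 q 0` already vanishes. There `n - 1` is again `0`, so the
    -- induction hypothesis need not give zero.
    · rcases n with _ | n
      · simp
      · rw [h2 (by omega), mul_zero]
    · rw [pow_succ, map_mul, Module.End.mul_apply, rep_α, map_smul, h3, smul_smul,
        show n - 1 - i = n - (i + 1) by omega]

/-- `αs` raises the level, so only the factors `sq2 q r` with `r ≥ 1` occur and nothing is killed.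
-/
theorem rep_αs_pow (i n : ℕ) : ∃ c : ℂ, c ≠ 0 ∧
    ∀ l, rep q (αs q ^ i) (bv n l) = c • bv (n + i) l := by
  induction i generalizing n with
  | zero => exact ⟨1, by simp, by simp⟩
  | succ i ih =>
    obtain ⟨c, h1, h2⟩ := ih (n + 1)
    refine ⟨sq2 q (n + 1) * c, mul_ne_zero (sq2_ne_zero (by omega)) h1, fun l => ?_⟩
    rw [pow_succ, map_mul, Module.End.mul_apply, rep_αs, map_smul, h2, smul_smul,
      show n + 1 + i = n + (i + 1) by omega]

/-- Treats lowering and raising uniformly: `apow q i` changes the level by `-i` for either sign of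
`i`. The default value of `toNat` is reached only when `n < i`, where the scalar is zero. -/
theorem rep_apow (i : ℤ) (n : ℕ) : ∃ c : ℂ, (i ≤ n → c ≠ 0) ∧ (n < i → c = 0) ∧
    ∀ l, rep q (apow q i) (bv n l) = c • bv (n - i).toNat l := by
  rcases i with i | i
  · obtain ⟨c, h1, h2, h3⟩ := rep_α_pow (q := q) i n
    refine ⟨c, fun h => h1 (by simpa using h), fun h => h2 (by simpa using h), fun l => ?_⟩
    rw [apow, h3, show (n - Int.ofNat i : ℤ).toNat = n - i by simp]
  · obtain ⟨c, h1, h2⟩ := rep_αs_pow (q := q) (i + 1) n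
    refine ⟨c, fun _ => h1, fun h => ?_, fun l => ?_⟩
    -- A negative exponent never exceeds `n`, so the vanishing clause is vacuous.
    · exact absurd h (by have := Int.negSucc_lt_zero i; omega)
    · rw [apow, h2, show (n - Int.negSucc i : ℤ).toNat = n + (i + 1) by
        rw [Int.negSucc_eq]; omega]

/-- A matrix entry from `bv n 0` to `bv m l` sees only the monomials whose `α`-exponent is `n - m`
and whose `γ`-exponents differ by `l`. The `γ`-part acts last, at level `m`, where each of its `j +
k` factors contributes $q^m$. The scalar `c` comes from the `α`-part alone, so it is common to all
these monomials and can be divided out: the entry of a linear combination becomes `c` times a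
polynomial evaluated at $q^m$. -/
theorem rep_pbw_apply (i : ℤ) (m n : ℕ) (hn : (n : ℤ) = m + i) (l : ℤ) : ∃ c : ℂ, c ≠ 0 ∧
    ∀ p : ℤ × ℕ × ℕ, rep q (pbw q p) (bv n 0) (m, l) =
      c * if p.1 = i ∧ (p.2.1 : ℤ) - p.2.2 = l then (qc q ^ m) ^ (p.2.1 + p.2.2) else 0 := by
  obtain ⟨c, hc, -, h⟩ := rep_apow (q := q) i n
  -- Nonvanishing needs `i ≤ n`, which is `0 ≤ m`.
  refine ⟨c, hc (by omega), ?_⟩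
  rintro ⟨i', j, k⟩
  obtain ⟨d, -, hd0, hd⟩ := rep_apow (q := q) i' n
  rw [pbw, map_mul, map_mul, Module.End.mul_apply, Module.End.mul_apply, hd]
  simp only [map_smul, rep_γs_pow, rep_γ_pow, Finsupp.smul_apply, smul_eq_mul, bv_apply]
  by_cases hi : i' = i
  · subst hi
    have hm : (n - i' : ℤ).toNat = m := by omega
    -- Both scalars are existential witnesses for the same operator at the same level, so they are
    -- identified by comparing the coordinate at `(m, 0)`.
    have hcd : d = c := by
      have h1 := congrArg (fun v : Vec => v (m, 0)) ((hd 0).symm.trans (h 0))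
      simpa [hm, bv_apply] using h1
    rw [hm, hcd]
    by_cases hl : (j : ℤ) - k = l
    · have hl' : (0 : ℤ) - k + j = l := by omega
      rw [if_pos ⟨rfl, hl'⟩, if_pos ⟨rfl, hl⟩, pow_add]; ring
    · have hl' : ¬ ((0 : ℤ) - k + j = l) := by omega
      simp only [hl, hl', and_false, if_false, mul_zero]
  · rw [if_neg (c := i' = i ∧ _) (fun e => hi e.1), mul_zero]
    -- With the wrong `α`-exponent, either the vector is killed or it lands at the level `n - i'`,
    -- which differs from `m`.
    by_cases hlt : (n : ℤ) < i'
    · rw [hd0 hlt, zero_mul]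
    · rw [if_neg (by omega)]; simp

/-- An element of `O_q(SU(2))` that vanishes on the vectors `e_{n,0}` is zero. -/
theorem eq_zero_of_rep {x : Oq q} (hx : ∀ n, rep q x (bv n 0) = 0) : x = 0 := by
  -- Only spanning is used here. The rest of the argument shows that all coefficients vanish, so
  -- linear independence of the monomials is not presupposed.
  obtain ⟨f, rfl⟩ : ∃ f : ℤ × ℕ × ℕ →₀ ℂ, Finsupp.linearCombination ℂ (pbw q) f = x := by
    rw [← LinearMap.mem_range, Finsupp.range_linearCombination, span_pbw]; trivial
  suffices f = 0 by simp [this]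
  ext ⟨i, j, k⟩
  -- With `i` and the difference `j - k` fixed, the sum of the two `γ`-exponents becomes the degree.
  let P : Polynomial ℂ := ∑ p ∈ f.support,
    if p.1 = i ∧ (p.2.1 : ℤ) - p.2.2 = j - k then
      Polynomial.C (f p) * Polynomial.X ^ (p.2.1 + p.2.2) else 0
  -- The condition on `m` makes the source level `n = m + i` a natural number. The entry of `x` from
  -- `bv n 0` to `bv m (j - k)` is then `c * P.eval (qc q ^ m)`.
  have hroot : ∀ m : ℕ, 0 ≤ m + i → P.eval (qc q ^ m) = 0 := by
    intro m hm
    obtain ⟨n, hn⟩ := Int.eq_ofNat_of_zero_le hm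
    obtain ⟨c, hc, h⟩ := rep_pbw_apply (q := q) i m n hn.symm (j - k)
    have h1 := congrArg (fun v : Vec => v (m, (j : ℤ) - k)) (hx n)
    simp only [Finsupp.linearCombination_apply, Finsupp.sum, map_sum, map_smul,
      LinearMap.sum_apply, LinearMap.smul_apply, Finsupp.finsetSum_apply, Finsupp.smul_apply, h,
      smul_eq_mul, Finsupp.coe_zero, Pi.zero_apply] at h1
    refine (mul_eq_zero.1 (Eq.trans ?_ h1)).resolve_left hc
    rw [Polynomial.eval_finsetSum, Finset.mul_sum]
    refine Finset.sum_congr rfl fun p _ => ?_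
    split_ifs
    · simp; ring
    · simp
  -- Distinct exponents give distinct points because $0<q<1$, so the roots found above form an
  -- infinite set.
  have hinj : Function.Injective fun m : ℕ => qc q ^ m := by
    intro m m' h
    refine pow_right_injective₀ q.2.1 q.2.2.ne (?_ : (q : ℝ) ^ m = (q : ℝ) ^ m')
    simp only [qc] at h
    exact_mod_cast h
  have hP : P = 0 := by
    refine Polynomial.eq_zero_of_infinite_isRoot _
      -- From `(-i).toNat` onwards, `m + i` is nonnegative; for `i ≥ 0` this is every `m`.
      (((Set.Ici_infinite (-i).toNat).image hinj.injOn).mono ?_)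
    rintro _ ⟨m, hm, rfl⟩
    exact hroot m (by have := Set.mem_Ici.1 hm; omega)
  -- In degree `j + k` a single term survives: a pair of exponents with the same difference and the
  -- same sum as `(j, k)` equals `(j, k)`.
  have hcoef := congrArg (fun Q => Polynomial.coeff Q (j + k)) hP
  simp only [P, Polynomial.finsetSum_coeff, Polynomial.coeff_zero] at hcoef
  rw [Finset.sum_eq_single (i, j, k)] at hcoef
  · simpa using hcoef
  · rintro ⟨i', j', k'⟩ _ hne
    split_ifs with h
    · rw [Polynomial.coeff_C_mul, Polynomial.coeff_X_pow, if_neg, mul_zero]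
      intro e
      simp only at h e
      obtain ⟨rfl, h⟩ := h
      exact hne (by rw [show j' = j by omega, show k' = k by omega])
    · simp
  · intro h
    rw [Finsupp.notMem_support_iff] at h
    simp [h]

/-! ### Faithfulness of the Haar state and of the invariant integral -/

theorem eq_zero_of_ip_self {v : Vec} (h : (ip v v).re = 0) : v = 0 := by
  ext p
  have h1 := norm_apply_sq_le v p
  rw [h] at h1
  exact norm_eq_zero.1 (pow_eq_zero_iff two_ne_zero |>.1 (le_antisymm h1 (sq_nonneg _)))

/-- The Haar state is faithful on `O_q(SU(2))`. -/
theorem haar_faithful {x : Oq q} (h : (haar q (star x * x)).re = 0) : x = 0 := by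
  rw [haar_re, Complex.ofReal_re] at h
  have h1 := (mul_eq_zero.1 h).resolve_left (one_sub_pos q).ne'
  -- Summability is essential: a `tsum` equal to zero carries no information without it. With it, a
  -- vanishing sum of nonnegative terms has every term zero, and the weights $q^{2n}$ can be
  -- cancelled.
  have h2 := (haar_summable_re x).hasSum
  rw [h1, hasSum_zero_iff_of_nonneg fun n =>
    mul_nonneg (pow_nonneg q.2.1.le _) (ip_self_nonneg _)] at h2
  exact eq_zero_of_rep fun n => eq_zero_of_ip_self
    ((mul_eq_zero.1 (congrFun h2 n)).resolve_left (pow_ne_zero _ q.2.1.ne'))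

/-- By `integral_re` the components at different `Φₘ` do not interact, and each contributes a
positive multiple of the Haar form. The argument works on the whole smash product, with coefficients
in $\mathcal O_q(SU(2))$; the Podleś sphere only restricts it. -/
theorem Smash.integral_faithful {a : ℝ} {x : Smash q a}
    (h : (integral q a (star x * x)).re = 0) : x = 0 := by
  obtain ⟨s, hs⟩ := exists_support x
  rw [integral_re x s hs, Finset.sum_eq_zero_iff_of_nonneg fun m _ =>
    mul_nonneg (ratio_pos q a m).le (haar_nonneg _)] at h
  ext m
  -- Assuming `x m ≠ 0` places `m` in `s`, so the corresponding summand is among those shown to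
  -- vanish.
  by_contra hm
  exact hm (haar_faithful ((mul_eq_zero.1 (h m (hs m hm))).resolve_left (ratio_pos q a m).ne'))

/-- The hypothesis involves only the real part, which is the quantity under the square root in
`pre_norm_def`. -/
theorem phi_faithful {a : ℝ} {x : Cc q a} (h : (phi q a (star x * x)).re = 0) : x = 0 :=
  Subtype.ext (Smash.integral_faithful h)

theorem phi_nonneg {a : ℝ} (x : Cc q a) : 0 ≤ (phi q a (star x * x)).re :=
  Smash.integral_nonneg (x : Smash q a)

/-! ### Injectivity of the regular representation -/

/-- The seminorm on `PreHreg` is thus a norm, and no nonzero element is lost in passing to the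
completion. Nonnegativity of `phi` is what allows the square root to be undone. -/
theorem eq_zero_of_norm_toPre {a : ℝ} {x : Cc q a} (h : ‖toPre q a x‖ = 0) : x = 0 :=
  phi_faithful ((Real.sqrt_eq_zero (phi_nonneg x)).1 ((pre_norm_def (toPre q a x)).symm.trans h))

/-- The algebra is handled without a unit, so the operator cannot be tested on $\Lambda(1)$; the
vector $\Lambda(z^*)$ takes its place. Faithfulness of the integral enters twice, to get $zz^*=0$
from its image in `Hreg` and then to get $z^*=0$. -/
theorem piReg_eq_zero {a : ℝ} {z : Cc q a} (h : piReg q a z = 0) : z = 0 := by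
  have key : z * star z = 0 := by
    have h1 := piReg_apply_coe z (star z)
    rw [h, zero_apply] at h1
    refine eq_zero_of_norm_toPre ?_
    -- The embedding into the completion is isometric, so the seminorm of `z * star z` can be
    -- computed in `Hreg`, where the vector is zero.
    rw [← UniformSpace.Completion.norm_coe, ← h1, norm_zero]
  -- Faithfulness is applied to `star z`, for which the product $(z^*)^*z^*$ is `z * star z`.
  refine star_eq_zero.1 (phi_faithful ?_)
  rw [star_star, key, map_zero, Complex.zero_re]

end QSL.Oq

theorem mainTheorem5 (q : QSL.Param) (a : ℝ) :
    (∀ x : QSL.Oq.Cc q a, QSL.Oq.phi q a (star x * x) = 0 → x = 0) ∧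
      Function.Injective (QSL.Oq.piReg q a) := by
  refine ⟨fun x hx => QSL.Oq.phi_faithful (by rw [hx, Complex.zero_re]), ?_⟩
  exact (injective_iff_map_eq_zero _).2 fun z hz => QSL.Oq.piReg_eq_zero hz
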